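/- **Setting.** Let $K$ be a field with algebraic closure $\overline K$, and let $n,\delta,k,s\ge 1$ be integers. A $\Sigma\Pi\Sigma\Pi_\delta(k,s,n)$ circuit over a field $F$ is an expression $C=\sum_{i=1}^k T_i$, $T_i=\prod_{j=1}^s f_{i,j}$, with polynomials $f_{i,j}\in F[x_1,\dots,x_n]$ of total degree at most $\delta$. It is *simple* if $\gcd(T_1,\dots,T_k)=1$, and *minimal* if $\sum_{i\in I}T_i\ne 0$ for every non-empty proper subset $I\subsetneq\{1,\dots,k\}$. Its *rank* is the transcendence degree of $\{f_{i,j}\}$ over $F$, i.e. the maximal number of algebraically independent polynomials in this set. Let $R_\delta(k,s)$ (over $F$) be the smallest positive integer $r$ such that, for every number $m$ of variables, every simple and minimal $\Sigma\Pi\Sigma\Pi_\delta(k,s,m)$ circuit over $F$ that computes the zero polynomial has rank less than $r$. Fix an infinite field $F$ with $K\subseteq F\subseteq\overline K$ (so $F=K$ is allowed if $K$ is infinite, and $F=\overline K$ is always allowed). Put $r:=R_\delta(k,s)$ over $F$, and $$D_1:=(2\delta n)^{2r},\qquad D_2:=\delta+1,\qquad p_{\max}:=2^{2(k+1)}\,(2krsn\delta^2)^{8\delta^2+4\delta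 r}\,\lceil\log_2 D_1\rceil^2+1 .$$ Let $H_1,H_2\subset\overline K$ be arbitrary subsets of sizes $2^{k+2}k^2rs^2\delta^4p_{\max}$ and $\delta s+1$, respectively. For $p\ge 1$, $c\in\overline K$ and $1\le i\le n$ let $$\Psi^{(i)}_{p,c}:=c^{\lfloor D_1^i\rfloor_p}+c^{\lfloor D_2^i\rfloor_p}z_0+\sum_{j=1}^r c^{\lfloor i(n+1)^j\rfloor_p}z_j\in\overline K[z_0,\dots,z_r],$$ where $\lfloor a\rfloor_p\in\{0,\dots,p-1\}$ denotes the residue of $a$ modulo $p$, and let $$\mathcal H_{\delta,k,s}:=\bigl\{(\Psi^{(1)}_{p,c}(\boldsymbol a),\dots,\Psi^{(n)}_{p,c}(\boldsymbol a)) : 1\le p\le p_{\max},\ c\in H_1,\ \boldsymbol a\in H_2^{r+1}\bigr\}\subset\overline K^n .$$ **Theorem.** Assume that $\operatorname{char}(K)=0$ or $\operatorname{char}(K)>\delta^r$. Then $\mathcal H_{\delta,k,s}$ is a hitting set for $\Sigma\Pi\Sigma\Pi_\delta(k,s,n)$ circuits over $K$: every such circuit $C$ that computes a non-zero polynomial satisfies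 $C(\boldsymbol v)\ne 0$ for some $\boldsymbol v\in\mathcal H_{\delta,k,s}$. Moreover, $\mathcal H_{\delta,k,s}$ can be constructed in $\mathrm{poly}(\delta rsn)^{rk\delta^2}$ time: there are one program $P$ for a random access machine over a field (unit-cost addition and truncated subtraction of natural numbers, unit-cost ring operations on field elements, unit-cost tests, memory accesses and output) and one polynomial $q$ with natural coefficients, both independent of the fields and of all parameters, such that $P$, given $n,\delta,k,s,r$ and a list of the elements of $H_1$ and of $H_2$, outputs a list of exactly the points of $\mathcal H_{\delta,k,s}$ (repetitions allowed) within $q(\delta rsn)^{rk\delta^2}$ steps. -/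

import Mathlib

/-!
# Depth-4 circuits, the rank bound, the hitting set, and a random access machine over a field
-/

namespace DepthFour

noncomputable section

/-! ## Transcendence degree of a finite set of polynomials -/

/-- The transcendence degree of a (finite) set `S` of polynomials over `K`: the maximal number of
algebraically independent polynomials in `S`. -/
def trdeg (K : Type*) [Field K] {n : ℕ} (S : Set (MvPolynomial (Fin n) K)) : ℕ :=
  sSup {m : ℕ | ∃ T : Finset (MvPolynomial (Fin n) K),
    (T : Set (MvPolynomial (Fin n) K)) ⊆ S ∧ T.card = m ∧
      AlgebraicIndepOn K id (T : Set (MvPolynomial (Fin n) K))}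

/-! ## Depth-4 circuits -/

/-- A depth-4 circuit `∑ i : Fin k, ∏ j : Fin s, f i j` over `K` in `n` variables, whose inner
polynomials have (total) degree at most `δ`. -/
structure Circuit (K : Type*) [Field K] (δ k s n : ℕ) where
  /-- the polynomials at the bottom two layers -/
  f : Fin k → Fin s → MvPolynomial (Fin n) K
  degree_le : ∀ i j, (f i j).totalDegree ≤ δ

namespace Circuit

variable {K : Type*} [Field K] {δ k s n : ℕ}

/-- The `i`-th multiplication term `T_i = ∏ j, f i j`. -/
def term (C : Circuit K δ k s n) (i : Fin k) : MvPolynomial (Fin n) K :=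
  ∏ j, C.f i j

/-- The polynomial computed by the circuit. -/
def poly (C : Circuit K δ k s n) : MvPolynomial (Fin n) K :=
  ∑ i, C.term i

/-- The set of all polynomials `f i j` of the circuit. -/
def sparsePolys (C : Circuit K δ k s n) : Set (MvPolynomial (Fin n) K) :=
  {g | ∃ i j, C.f i j = g}

/-- The rank of a circuit: the transcendence degree of the set of all its `f i j`. -/
def rank (C : Circuit K δ k s n) : ℕ :=
  trdeg K C.sparsePolys

/-- A circuit is simple if the gcd of its multiplication terms is `1`. -/
def IsSimple (C : Circuit K δ k s n) : Prop :=
  ∀ d : MvPolynomial (Fin n) K, (∀ i, d ∣ C.term i) → IsUnit d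

/-- A circuit is minimal if no nonempty proper subset of its multiplication terms sums to `0`. -/
def IsMinimal (C : Circuit K δ k s n) : Prop :=
  ∀ I : Finset (Fin k), I.Nonempty → I ≠ Finset.univ → ∑ i ∈ I, C.term i ≠ 0

theorem rank_le (C : Circuit K δ k s n) : C.rank ≤ k * s := by
  classical
  refine csSup_le ⟨0, ∅, by simp, by simp, ?_⟩ ?_
  · have : IsEmpty ((∅ : Finset (MvPolynomial (Fin n) K)) : Set (MvPolynomial (Fin n) K)) := by
      simp
    rw [AlgebraicIndepOn, algebraicIndependent_empty_type_iff]
    exact FaithfulSMul.algebraMap_injective _ _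
  · rintro m ⟨T, hT, rfl, -⟩
    have h : T ⊆ (Finset.univ : Finset (Fin k × Fin s)).image (fun x => C.f x.1 x.2) := by
      intro g hg
      obtain ⟨i, j, hij⟩ := hT hg
      exact Finset.mem_image.2 ⟨(i, j), Finset.mem_univ _, hij⟩
    calc T.card ≤ _ := Finset.card_le_card h
      _ ≤ _ := Finset.card_image_le
      _ = k * s := by simp

end Circuit

/-- `R_δ(k,s)` over the field `K`: the smallest positive integer `r` such that, for every number
`n` of variables, every simple and minimal circuit with parameters `δ, k, s, n` over `K` that
computes the zero polynomial has rank smaller than `r`. -/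
def rankBound (K : Type*) [Field K] (δ k s : ℕ) : ℕ :=
  sInf {r : ℕ | 1 ≤ r ∧ ∀ (n : ℕ) (C : Circuit K δ k s n),
    C.IsSimple → C.IsMinimal → C.poly = 0 → C.rank < r}

/-- The minimum in the definition of `rankBound` is attained. -/
theorem rankBound_spec (K : Type*) [Field K] (δ k s : ℕ) :
    1 ≤ rankBound K δ k s ∧ ∀ (n : ℕ) (C : Circuit K δ k s n),
      C.IsSimple → C.IsMinimal → C.poly = 0 → C.rank < rankBound K δ k s :=
  Nat.sInf_mem (s := {r : ℕ | 1 ≤ r ∧ ∀ (n : ℕ) (C : Circuit K δ k s n),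
    C.IsSimple → C.IsMinimal → C.poly = 0 → C.rank < r})
    ⟨k * s + 1, Nat.succ_le_succ (Nat.zero_le _), fun _ C _ _ _ => Nat.lt_succ_of_le C.rank_le⟩

/-! ## The hitting set -/

/-- A set of points of `L ^ n` is a hitting set for the circuits with parameters `δ, k, s, n` over
the subfield `K` of `L` if every such circuit that computes a nonzero polynomial does not vanish
at some point of the set. -/
def IsHittingSet (K : Type*) {L : Type*} [Field K] [Field L] [Algebra K L] (δ k s n : ℕ)
    (H : Set (Fin n → L)) : Prop :=
  ∀ C : Circuit K δ k s n, C.poly ≠ 0 → ∃ v ∈ H, MvPolynomial.aeval v C.poly ≠ 0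

/-- The image of the variable `x_{i+1}` (with `i : Fin n`, so `i + 1` runs through `1, …, n`) under
the homomorphism `Ψ_{D,p,c}` to the polynomial ring in `z_0, …, z_r`. The exponents of `c` are
residues modulo `p`. -/
def psi {L : Type*} [Field L] (n r D₁ D₂ p : ℕ) (c : L) (i : Fin n) :
    MvPolynomial (Fin (r + 1)) L :=
  MvPolynomial.C (c ^ (D₁ ^ (i.val + 1) % p))
    + MvPolynomial.C (c ^ (D₂ ^ (i.val + 1) % p)) * MvPolynomial.X 0
    + ∑ j : Fin r, MvPolynomial.C (c ^ (((i.val + 1) * (n + 1) ^ (j.val + 1)) % p))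
        * MvPolynomial.X j.succ

/-- `D_1 = (2δn)^{2r}`. -/
def D1 (δ n r : ℕ) : ℕ := (2 * δ * n) ^ (2 * r)

/-- `D_2 = δ + 1`. -/
def D2 (δ : ℕ) : ℕ := δ + 1

/-- `p_max = 2^{2(k+1)} (2krsnδ²)^{8δ²+4δr} ⌈log₂ D_1⌉² + 1`. -/
def pMax (δ k s n r : ℕ) : ℕ :=
  2 ^ (2 * (k + 1)) * (2 * k * r * s * n * δ ^ 2) ^ (8 * δ ^ 2 + 4 * δ * r)
    * (Nat.clog 2 (D1 δ n r)) ^ 2 + 1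

/-- The size `2^{k+2} k² r s² δ⁴ p_max` of `H_1`. -/
def size1 (δ k s n r : ℕ) : ℕ :=
  2 ^ (k + 2) * k ^ 2 * r * s ^ 2 * δ ^ 4 * pMax δ k s n r

/-- The size `δs + 1` of `H_2`. -/
def size2 (δ s : ℕ) : ℕ := δ * s + 1

/-- The set `H_{δ,k,s}` of points of `L ^ n`, built from subsets `H₁` and `H₂` of `L`. -/
def hittingSet {L : Type*} [Field L] (δ k s n r : ℕ) (H₁ H₂ : Set L) : Set (Fin n → L) :=
  {v | ∃ p : ℕ, 1 ≤ p ∧ p ≤ pMax δ k s n r ∧ ∃ c ∈ H₁, ∃ a : Fin (r + 1) → L,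
    (∀ j, a j ∈ H₂) ∧ v = fun i => MvPolynomial.eval a (psi n r (D1 δ n r) (D2 δ) p c i)}

/-! ## Random access machines over a field

The machine has registers and an (indirectly addressed) memory for natural numbers, registers and an
(indirectly addressed) memory for field elements, and an output tape of field elements. Every
instruction and every test costs one step. The only operations on natural numbers are addition and
truncated subtraction, so that numbers grow by at most one bit per step; the only operations on
field elements are the ring operations. Programs do not contain field elements, so one program runs
over every field. -/

/-- Instructions. -/
inductive Instr
  /-- `reg x := c` -/
  | const (x c : ℕ)
  /-- `reg x := reg y + reg z` -/
  | add (x y z : ℕ)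
  /-- `reg x := reg y - reg z` (truncated) -/
  | sub (x y z : ℕ)
  /-- `reg x := mem (reg y)` -/
  | load (x y : ℕ)
  /-- `mem (reg x) := reg y` -/
  | store (x y : ℕ)
  /-- `freg x := 0` -/
  | fzero (x : ℕ)
  /-- `freg x := 1` -/
  | fone (x : ℕ)
  /-- `freg x := freg y + freg z` -/
  | fadd (x y z : ℕ)
  /-- `freg x := freg y - freg z` -/
  | fsub (x y z : ℕ)
  /-- `freg x := freg y * freg z` -/
  | fmul (x y z : ℕ)
  /-- `freg x := fmem (reg y)` -/
  | fload (x y : ℕ)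
  /-- `fmem (reg x) := freg y` -/
  | fstore (x y : ℕ)
  /-- append `freg x` to the output -/
  | emit (x : ℕ)

/-- Programs. -/
inductive Program
  | skip
  | instr (i : Instr)
  | seq (P Q : Program)
  /-- if `reg x ≠ 0` then `P` else `Q` -/
  | ite (x : ℕ) (P Q : Program)
  /-- while `reg x ≠ 0` do `P` -/
  | loop (x : ℕ) (P : Program)

/-- States of the machine over `L`. -/
structure State (L : Type*) where
  reg : ℕ → ℕ
  mem : ℕ → ℕ
  freg : ℕ → L
  fmem : ℕ → L
  out : List L

/-- The effect of an instruction. -/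
def Instr.exec {L : Type*} [Field L] : Instr → State L → State L
  | .const x c, σ => { σ with reg := Function.update σ.reg x c }
  | .add x y z, σ => { σ with reg := Function.update σ.reg x (σ.reg y + σ.reg z) }
  | .sub x y z, σ => { σ with reg := Function.update σ.reg x (σ.reg y - σ.reg z) }
  | .load x y, σ => { σ with reg := Function.update σ.reg x (σ.mem (σ.reg y)) }
  | .store x y, σ => { σ with mem := Function.update σ.mem (σ.reg x) (σ.reg y) }
  | .fzero x, σ => { σ with freg := Function.update σ.freg x 0 }
  | .fone x, σ => { σ with freg := Function.update σ.freg x 1 }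
  | .fadd x y z, σ => { σ with freg := Function.update σ.freg x (σ.freg y + σ.freg z) }
  | .fsub x y z, σ => { σ with freg := Function.update σ.freg x (σ.freg y - σ.freg z) }
  | .fmul x y z, σ => { σ with freg := Function.update σ.freg x (σ.freg y * σ.freg z) }
  | .fload x y, σ => { σ with freg := Function.update σ.freg x (σ.fmem (σ.reg y)) }
  | .fstore x y, σ => { σ with fmem := Function.update σ.fmem (σ.reg x) (σ.freg y) }
  | .emit x, σ => { σ with out := σ.out ++ [σ.freg x] }

/-- `Run P σ t τ`: started in the state `σ`, the program `P` halts after `t` steps in the state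
`τ`. -/
inductive Run {L : Type*} [Field L] : Program → State L → ℕ → State L → Prop
  | skip (σ : State L) : Run .skip σ 1 σ
  | instr (i : Instr) (σ : State L) : Run (.instr i) σ 1 (i.exec σ)
  | seq {P Q : Program} {σ τ ρ : State L} {t u : ℕ} :
      Run P σ t τ → Run Q τ u ρ → Run (.seq P Q) σ (t + u) ρ
  | ite_true {x : ℕ} {P Q : Program} {σ τ : State L} {t : ℕ} :
      σ.reg x ≠ 0 → Run P σ t τ → Run (.ite x P Q) σ (t + 1) τ
  | ite_false {x : ℕ} {P Q : Program} {σ τ : State L} {t : ℕ} :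
      σ.reg x = 0 → Run Q σ t τ → Run (.ite x P Q) σ (t + 1) τ
  | loop_true {x : ℕ} {P : Program} {σ τ ρ : State L} {t u : ℕ} :
      σ.reg x ≠ 0 → Run P σ t τ → Run (.loop x P) τ u ρ → Run (.loop x P) σ (t + u + 1) ρ
  | loop_false {x : ℕ} {P : Program} {σ : State L} :
      σ.reg x = 0 → Run (.loop x P) σ 1 σ

/-- The input: the numbers `n, δ, k, s, r` in the registers `0, …, 4`, and the elements of `H_1`
followed by those of `H_2` in the memory for field elements. All other cells contain `0`. -/
def startState {L : Type*} [Field L] (n δ k s r : ℕ) {N₁ N₂ : ℕ} (h₁ : Fin N₁ → L)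
    (h₂ : Fin N₂ → L) : State L where
  reg x := [n, δ, k, s, r].getD x 0
  mem _ := 0
  freg _ := 0
  fmem x := (List.ofFn h₁ ++ List.ofFn h₂).getD x 0
  out := []

/-- The program `P`, started in the state `σ`, halts after at most `T` steps with a list of points
of `L ^ n` on the output tape (each written as its `n` coordinates, one point after the other)
whose members are exactly the points of `H`. -/
def Constructs {L : Type*} [Field L] (P : Program) (σ : State L) (T : ℕ) {n : ℕ}
    (H : Set (Fin n → L)) : Prop :=
  ∃ (t : ℕ) (τ : State L) (pts : List (Fin n → L)), Run P σ t τ ∧ t ≤ T ∧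
    τ.out = pts.flatMap List.ofFn ∧ ∀ v, v ∈ pts ↔ v ∈ H

end

end DepthFour

namespace DepthFour
open MvPolynomial

/-! Let `φ` be a homomorphism to polynomials in other variables that does not raise degrees. A
nonzero circuit polynomial survives `φ` as soon as (A) no irreducible factor of a nonzero `f i j` is
killed, (B) irreducible factors `u`, `u'` with `u ∤ u'` have relatively prime images, and (C) for
every nonempty set `I` of nonzero terms, the factors occurring in the simple part of `∑ i ∈ I, T_i`
contain a maximal algebraically independent set, cut off at size `r = R_δ(k,s)`, whose image is
again independent. Indeed, take the smallest `I` whose sum is nonzero but killed. By (A), (B) and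
minimality of `I`, the image of its simple part is a simple and minimal circuit computing zero, so
its rank is less than `r`. Hence the independent set in (C) was not cut off, the simple part is
algebraic over the subalgebra it generates, and `φ` is injective on that subalgebra; so the simple
part cannot be killed. This is `Circuit.map_poly_ne_zero`.

For a linear substitution, (A), (B) and (C) follow from the nonvanishing of finitely many
polynomials in its coefficients. Setting all variables except `z_0` to zero restricts a polynomial
to a line: (A) and (B) hold if the top forms do not vanish at the direction and the resultants of
the restrictions do not vanish (`isRelPrime_subst`). Condition (C) holds if the Jacobian matrix at
the base point, times the matrix of the remaining coefficients, has nonzero determinant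
(`algebraicIndependent_subst`).

It remains to see that these polynomials stay nonzero when the coefficients are the prescribed
powers of one variable `t`. For top forms this is Kronecker substitution. For Jacobian determinants,
the terms of the multilinear expansion lie in different residue classes of exponents modulo `D₁`
(`kron_genericJac_ne_zero`); the assumption on the characteristic enters only here, through the
Jacobian criterion. For resultants, the coordinates of base point and direction are replaced by
powers of `t` one index at a time (`kron_genericRes_ne_zero`).

The exponents are then reduced modulo `p`. This is harmless unless `p` divides a certain nonzero
product of exponent differences, and a positive integer below `2 ^ M` cannot be divisible by all
numbers up to `2 M` (`exists_mod_kron_ne_zero`). After the reduction the circuit has degree at most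
`δ s p` in `c` and at most `δ s` in the remaining variables, so `H₁` and `H₂` are large enough.

For the running time, expressions and loops are compiled into register programs with cost bounds of
the form `W ^ j`, where `W = (64 δ r s n) ^ (r k δ²)` and `j` is an absolute constant. All sizes and
loop lengths involved are bounded by fixed powers of `W`. -/

/-- The substitution `x_i ↦ t ^ w i` into a univariate polynomial ring. -/
noncomputable def kron {σ F : Type*} [CommSemiring F] (w : σ → ℕ) :
    MvPolynomial σ F →ₐ[F] Polynomial F :=
  aeval fun i => Polynomial.X ^ w i

/-! ### Monomial substitutions with exponents reduced modulo `p` -/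

section Kron

variable {σ F : Type*} [Field F]

theorem kron_monomial (w : σ → ℕ) (m : σ →₀ ℕ) (c : F) :
    kron w (monomial m c) = Polynomial.monomial (Finsupp.weight w m) c := by
  rw [kron, aeval_monomial, ← Polynomial.C_mul_X_pow_eq_monomial, Finsupp.weight_apply]
  congr 1
  simp only [Finsupp.prod, Finsupp.sum, ← pow_mul, smul_eq_mul]
  rw [Finset.prod_pow_eq_pow_sum]
  congr 1
  exact Finset.sum_congr rfl fun i _ => mul_comm _ _

theorem kron_eq_sum (w : σ → ℕ) (G : MvPolynomial σ F) :
    kron w G = ∑ m ∈ G.support, Polynomial.monomial (Finsupp.weight w m) (coeff m G) := by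
  conv_lhs => rw [G.as_sum, map_sum]
  simp only [kron_monomial]

theorem exists_weight_of_coeff_kron_ne_zero {w : σ → ℕ} {G : MvPolynomial σ F} {e : ℕ}
    (h : (kron w G).coeff e ≠ 0) : ∃ m ∈ G.support, Finsupp.weight w m = e := by
  by_contra! hc
  apply h
  rw [kron_eq_sum, Polynomial.finsetSum_coeff]
  exact Finset.sum_eq_zero fun m hm => by rw [Polynomial.coeff_monomial, if_neg (hc m hm)]

theorem eval_kron (w : σ → ℕ) (G : MvPolynomial σ F) (c : F) :
    (kron w G).eval c = eval (fun i => c ^ w i) G := by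
  have : ((Polynomial.aeval c).comp (kron w)) G = aeval (fun i => c ^ w i) G := by
    congr 1
    ext i
    simp [kron]
  rw [AlgHom.comp_apply, Polynomial.coe_aeval_eq_eval] at this
  exact this

/-- The sum of the coefficients of a polynomial in the degrees congruent to `e` modulo `p`. -/
noncomputable def residueCoeff (p e : ℕ) : Polynomial F →ₗ[F] F :=
  Polynomial.lsum fun d => if d ≡ e [MOD p] then LinearMap.id else 0

theorem residueCoeff_monomial (p e d : ℕ) (c : F) :
    residueCoeff p e (Polynomial.monomial d c) = if d ≡ e [MOD p] then c else 0 := by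
  rw [residueCoeff, Polynomial.lsum_apply, Polynomial.sum_monomial_index _ _ (by simp)]
  split_ifs <;> simp

theorem weight_mod (w : σ → ℕ) (p : ℕ) (m : σ →₀ ℕ) :
    Finsupp.weight (fun i => w i % p) m ≡ Finsupp.weight w m [MOD p] := by
  simp only [Finsupp.weight_apply, Finsupp.sum, smul_eq_mul]
  have : ∀ s : Finset σ, (∑ i ∈ s, m i * (w i % p)) ≡ ∑ i ∈ s, m i * w i [MOD p] := by
    classical
    intro s
    induction s using Finset.induction_on with
    | empty => rfl
    | insert a s ha ih =>
      rw [Finset.sum_insert ha, Finset.sum_insert ha]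
      exact Nat.ModEq.add (Nat.ModEq.mul_left _ (Nat.mod_modEq _ _)) ih
  exact this _

/-- Reducing the exponents moves coefficients only within residue classes modulo `p`. Class sums are
therefore invariant, although single coefficients are not. -/
theorem residueCoeff_kron_mod (w : σ → ℕ) (p e : ℕ) (G : MvPolynomial σ F) :
    residueCoeff p e (kron (fun i => w i % p) G) = residueCoeff p e (kron w G) := by
  rw [kron_eq_sum, kron_eq_sum, map_sum, map_sum]
  refine Finset.sum_congr rfl fun m _ => ?_
  rw [residueCoeff_monomial, residueCoeff_monomial]
  have h := weight_mod w p m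
  by_cases h' : Finsupp.weight w m ≡ e [MOD p]
  · rw [if_pos h', if_pos (h.trans h')]
  · rw [if_neg h', if_neg fun h'' => h' (h.symm.trans h'')]

/-- Reducing the exponents of a nonvanishing monomial substitution modulo `p` keeps it nonzero,
unless `p` divides a certain integer that is not too large. -/
theorem exists_not_dvd_imp_kron_mod_ne_zero {w : σ → ℕ} {G : MvPolynomial σ F}
    (hG : kron w G ≠ 0) {B N : ℕ} (hB : ∀ m ∈ G.support, Finsupp.weight w m ≤ 2 ^ B)
    (hN : G.support.card ≤ N) :
    ∃ Q : ℕ, 0 < Q ∧ Q ≤ 2 ^ (B * N) ∧ ∀ p, ¬ p ∣ Q → kron (fun i => w i % p) G ≠ 0 := by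
  classical
  obtain ⟨e, he⟩ : ∃ e, (kron w G).coeff e ≠ 0 := by
    by_contra! h
    exact hG (Polynomial.ext fun e => by simpa using h e)
  obtain ⟨m₀, hm₀, hm₀e⟩ := exists_weight_of_coeff_kron_ne_zero he
  -- Another exponent can merge with `e` modulo `p` only if `p` divides its distance to `e`.
  -- Exponents equal to `e` get the factor 1, which keeps the product positive.
  let d : (σ →₀ ℕ) → ℕ := fun m =>
    if Finsupp.weight w m = e then 1 else ((Finsupp.weight w m : ℤ) - e).natAbs
  have hd : ∀ m ∈ G.support, 0 < d m ∧ d m ≤ 2 ^ B := by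
    intro m hm
    have h1 := hB m hm
    have h2 := hB m₀ hm₀
    have h3 : 0 < 2 ^ B := by positivity
    simp only [d]
    split_ifs with h
    · omega
    · omega
  refine ⟨∏ m ∈ G.support, d m, Finset.prod_pos fun m hm => (hd m hm).1, ?_, ?_⟩
  · calc ∏ m ∈ G.support, d m ≤ ∏ m ∈ G.support, 2 ^ B :=
          Finset.prod_le_prod' fun m hm => (hd m hm).2
      _ = 2 ^ (B * G.support.card) := by rw [Finset.prod_const, pow_mul]
      _ ≤ _ := Nat.pow_le_pow_right (by norm_num) (Nat.mul_le_mul_left _ hN)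
  · intro p hp h0
    -- As `p` does not divide the product, `e` is the only exponent in its class, so the class sum
    -- is the nonzero coefficient at `e`.
    have h1 := residueCoeff_kron_mod w p e G
    rw [h0, map_zero, kron_eq_sum, map_sum] at h1
    apply he
    rw [kron_eq_sum, Polynomial.finsetSum_coeff, h1]
    refine Finset.sum_congr rfl fun m hm => ?_
    rw [residueCoeff_monomial, Polynomial.coeff_monomial]
    by_cases hm' : Finsupp.weight w m = e
    · rw [if_pos hm', if_pos (by rw [hm'])]
    · rw [if_neg hm', if_neg]
      intro hmod
      refine hp (dvd_trans ?_ (Finset.dvd_prod_of_mem d hm))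
      simp only [d, if_neg hm']
      have := (Nat.modEq_iff_dvd.1 hmod.symm)
      exact Int.natCast_dvd.1 this

end Kron

/-- A positive integer at most `2 ^ M` is not divisible by some positive integer at most `2 M`. -/
theorem exists_le_not_dvd {M Q : ℕ} (hM : 4 ≤ M) (hQ : 0 < Q) (hQM : Q ≤ 2 ^ M) :
    ∃ p, 1 ≤ p ∧ p ≤ 2 * M ∧ ¬ p ∣ Q := by
  by_contra! h
  -- Every prime power exactly dividing the central binomial coefficient is at most `2 M`, hence
  -- divides `Q`. This contradicts `4 ^ M < M * centralBinom M ≤ 2 ^ M * 2 ^ M`.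
  have hdvd : Nat.centralBinom M ∣ Q := by
    rw [← Nat.factorization_le_iff_dvd (Nat.centralBinom_ne_zero M) hQ.ne']
    intro q
    by_cases hq : q.Prime
    · refine (hq.pow_dvd_iff_le_factorization hQ.ne').1 (h _ (Nat.pos_of_ne_zero ?_) ?_)
      · exact pow_ne_zero _ hq.ne_zero
      · exact Nat.pow_factorization_choose_le (by omega)
    · rw [Nat.factorization_eq_zero_of_not_prime _ hq]
      exact Nat.zero_le _
  have h1 := Nat.le_of_dvd hQ hdvd
  have h2 := Nat.four_pow_lt_mul_centralBinom M hM
  have h3 : M < 2 ^ M := Nat.lt_two_pow_self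
  have h4 : M * Nat.centralBinom M ≤ 2 ^ M * 2 ^ M := Nat.mul_le_mul h3.le (h1.trans hQM)
  rw [← mul_pow] at h4
  norm_num at h4
  omega

/-- Finitely many nonvanishing monomial substitutions stay nonzero when the exponents are reduced
modulo a suitable small `p`. -/
theorem exists_mod_kron_ne_zero {σ F ι : Type*} [Field F] [Fintype ι] {w : σ → ℕ}
    (G : ι → MvPolynomial σ F) (hG : ∀ l, kron w (G l) ≠ 0) {B M : ℕ} (N : ι → ℕ) (hM : 4 ≤ M)
    (hB : ∀ l, ∀ m ∈ (G l).support, Finsupp.weight w m ≤ 2 ^ B)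
    (hN : ∀ l, (G l).support.card ≤ N l) (hNM : B * ∑ l, N l ≤ M) :
    ∃ p, 1 ≤ p ∧ p ≤ 2 * M ∧ ∀ l, kron (fun i => w i % p) (G l) ≠ 0 := by
  choose Q hQ0 hQ hQp using fun l => exists_not_dvd_imp_kron_mod_ne_zero (hG l) (hB l) (hN l)
  obtain ⟨p, h1, h2, h3⟩ := exists_le_not_dvd (M := M) (Q := ∏ l, Q l) hM
    (Finset.prod_pos fun l _ => hQ0 l) (by
      calc ∏ l, Q l ≤ ∏ l, 2 ^ (B * N l) := Finset.prod_le_prod' fun l _ => hQ l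
        _ = 2 ^ (B * ∑ l, N l) := by rw [Finset.prod_pow_eq_pow_sum, Finset.mul_sum]
        _ ≤ _ := Nat.pow_le_pow_right (by norm_num) hNM)
  exact ⟨p, h1, h2, fun l => hQp l p fun h => h3 (h.trans (Finset.dvd_prod_of_mem _ (Finset.mem_univ l)))⟩

/-! ### Counting monomials, and Kronecker substitution -/

theorem exists_finset_degree_le (σ : Type*) [Fintype σ] (Δ : ℕ) :
    ∃ S : Finset (σ →₀ ℕ), S.card ≤ (Fintype.card σ + 1) ^ Δ ∧
      ∀ m : σ →₀ ℕ, (m.sum fun _ e => e) ≤ Δ → m ∈ S := by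
  classical
  induction Δ with
  | zero =>
    refine ⟨{0}, by simp, fun m hm => ?_⟩
    have : ∀ i, m i = 0 := by simpa [Finsupp.sum] using hm
    simpa using Finsupp.ext this
  | succ Δ ih =>
    obtain ⟨S, hS, hmem⟩ := ih
    let U : Finset (Option σ) := Finset.univ
    -- A monomial of degree at most `Δ + 1` is one of degree at most `Δ` times a variable or 1;
    -- `Option σ` lists these factors.
    refine ⟨(S ×ˢ U).image fun x => x.1 + x.2.elim 0 fun i => Finsupp.single i 1, ?_, ?_⟩
    · refine Finset.card_image_le.trans ?_
      rw [Finset.card_product, pow_succ]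
      exact Nat.mul_le_mul hS (by simp [U])
    · intro m hm
      rw [Finset.mem_image]
      by_cases h0 : m = 0
      · exact ⟨(0, none), Finset.mem_product.2 ⟨hmem 0 (by simp), Finset.mem_univ _⟩, by simp [h0]⟩
      · obtain ⟨i, hi⟩ := Finsupp.ne_iff.1 h0
        have hle : Finsupp.single i 1 ≤ m := by
          rw [Finsupp.single_le_iff]
          exact Nat.one_le_iff_ne_zero.2 (by simpa using hi)
        have hsum : m.degree = (m - Finsupp.single i 1).degree + 1 := by
          conv_lhs => rw [← tsub_add_cancel_of_le hle]
          simp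
        refine ⟨(m - Finsupp.single i 1, some i), ?_, by simpa using tsub_add_cancel_of_le hle⟩
        refine Finset.mem_product.2 ⟨hmem _ ?_, Finset.mem_univ _⟩
        simp only [Finsupp.degree, Finsupp.sum] at hsum hm ⊢
        change ∑ i ∈ m.support, m i = ∑ j ∈ (m - Finsupp.single i 1).support, _ + 1 at hsum
        omega

section

variable {σ F : Type*} [Field F]

theorem card_support_le [Fintype σ] {G : MvPolynomial σ F} {Δ : ℕ} (h : G.totalDegree ≤ Δ) :
    G.support.card ≤ (Fintype.card σ + 1) ^ Δ := by
  obtain ⟨S, hS, hmem⟩ := exists_finset_degree_le σ Δ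
  exact (Finset.card_le_card fun m hm => hmem m ((le_totalDegree hm).trans h)).trans hS

theorem weight_le {w : σ → ℕ} {W : ℕ} (hw : ∀ i, w i ≤ W) {G : MvPolynomial σ F} {Δ : ℕ}
    (h : G.totalDegree ≤ Δ) {m : σ →₀ ℕ} (hm : m ∈ G.support) : Finsupp.weight w m ≤ Δ * W := by
  rw [Finsupp.weight_apply]
  calc (m.sum fun i c => c • w i) ≤ m.sum fun i c => c * W :=
        Finset.sum_le_sum fun i _ => Nat.mul_le_mul_left _ (hw i)
    _ = (m.sum fun _ c => c) * W := by simp only [Finsupp.sum, Finset.sum_mul]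
    _ ≤ Δ * W := Nat.mul_le_mul_right _ ((le_totalDegree hm).trans h)

theorem kron_ne_zero_of_injOn {w : σ → ℕ} {G : MvPolynomial σ F} (hG : G ≠ 0)
    (hw : Set.InjOn (Finsupp.weight w) (G.support : Set (σ →₀ ℕ))) : kron w G ≠ 0 := by
  obtain ⟨m₀, hm₀⟩ := (support_nonempty.2 hG)
  intro h
  have h1 := congrArg (fun P => P.coeff (Finsupp.weight w m₀)) h
  simp only [kron_eq_sum, Polynomial.finsetSum_coeff, Polynomial.coeff_zero,
    Polynomial.coeff_monomial] at h1
  rw [Finset.sum_eq_single_of_mem m₀ hm₀ fun m hm hne => if_neg fun h => hne (hw hm hm₀ h),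
    if_pos rfl] at h1
  exact (mem_support_iff.1 hm₀) h1

/-- The two weights are `D` times the numbers with base-`D` digits `m i` and `m' i`. -/
theorem weight_pow_injective {n D : ℕ} {m m' : Fin n →₀ ℕ} (hm : ∀ i, m i < D)
    (hm' : ∀ i, m' i < D)
    (h : Finsupp.weight (fun i : Fin n => D ^ (i.val + 1)) m
      = Finsupp.weight (fun i : Fin n => D ^ (i.val + 1)) m') : m = m' := by
  rcases Nat.eq_zero_or_pos n with rfl | hn
  · exact Subsingleton.elim _ _
  have hD : 0 < D := (Nat.zero_le _).trans_lt (hm ⟨0, hn⟩)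
  have key : ∀ (m : Fin n →₀ ℕ), Finsupp.weight (fun i : Fin n => D ^ (i.val + 1)) m
      = D * ∑ i, m i * D ^ i.val := by
    intro m
    rw [Finsupp.weight_apply, Finsupp.sum_fintype _ _ (by simp), Finset.mul_sum]
    exact Finset.sum_congr rfl fun i _ => by simp only [smul_eq_mul]; ring
  rw [key, key] at h
  have h2 := Nat.eq_of_mul_eq_mul_left hD h
  have h3 : finFunctionFinEquiv (fun i => (⟨m i, hm i⟩ : Fin D))
      = finFunctionFinEquiv (fun i => (⟨m' i, hm' i⟩ : Fin D)) := by
    apply Fin.ext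
    simpa [finFunctionFinEquiv_apply] using h2
  have h4 := finFunctionFinEquiv.injective h3
  ext i
  exact congrArg Fin.val (congrFun h4 i)

/-- Kronecker substitution does not kill polynomials of small degree. -/
theorem kron_pow_ne_zero {n D : ℕ} {G : MvPolynomial (Fin n) F} (hG : G ≠ 0)
    (hD : G.totalDegree < D) : kron (fun i : Fin n => D ^ (i.val + 1)) G ≠ 0 := by
  have hlt : ∀ m ∈ G.support, ∀ i, m i < D := by
    intro m hm i
    have h1 := (le_totalDegree hm)
    have h2 : m i ≤ m.sum fun _ e => e := by
      by_cases hi : i ∈ m.support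
      · exact Finset.single_le_sum (f := fun i => m i) (fun _ _ => Nat.zero_le _) hi
      · simp [Finsupp.notMem_support_iff.1 hi]
    omega
  exact kron_ne_zero_of_injOn hG fun m hm m' hm' h =>
    weight_pow_injective (hlt m hm) (hlt m' hm') h

end

/-! ### Filtrations -/

/-- Common source of the bounds on total degree, on degree in one variable, and, through `coeffsIn`,
on the degrees of the coefficients of a polynomial. -/
theorem aeval_mem_filtration {F R σ : Type*} [Field F] [CommRing R] [Algebra F R]
    (fil : ℕ → Submodule F R) (hmono : Monotone fil) (h1 : (1 : R) ∈ fil 0)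
    (hmul : ∀ i j a b, a ∈ fil i → b ∈ fil j → a * b ∈ fil (i + j)) {s : σ → R} {W : ℕ}
    (hs : ∀ v, s v ∈ fil W) {P : MvPolynomial σ F} {Δ : ℕ} (hP : P.totalDegree ≤ Δ) :
    aeval s P ∈ fil (Δ * W) := by
  classical
  have hpow : ∀ v e, s v ^ e ∈ fil (e * W) := by
    intro v e
    induction e with
    | zero => simpa using h1
    | succ e ih =>
      rw [pow_succ, Nat.succ_mul]
      exact hmul _ _ _ _ ih (hs v)
  have hprod : ∀ (m : σ →₀ ℕ) (S : Finset σ), ∏ v ∈ S, s v ^ m v ∈ fil ((∑ v ∈ S, m v) * W) := by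
    intro m S
    induction S using Finset.induction_on with
    | empty => simpa using h1
    | insert a S ha ih =>
      rw [Finset.prod_insert ha, Finset.sum_insert ha, Nat.add_mul]
      exact hmul _ _ _ _ (hpow _ _) ih
  rw [P.as_sum, map_sum]
  refine Submodule.sum_mem _ fun m hm => ?_
  rw [aeval_monomial, ← Algebra.smul_def]
  refine Submodule.smul_mem _ _ (hmono (Nat.mul_le_mul_right W ?_) (hprod m m.support))
  exact (le_totalDegree hm).trans hP

theorem totalDegree_aeval_le {F σ τ : Type*} [Field F] {s : σ → MvPolynomial τ F} {W : ℕ}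
    (hs : ∀ v, (s v).totalDegree ≤ W) {P : MvPolynomial σ F} {Δ : ℕ} (hP : P.totalDegree ≤ Δ) :
    (aeval s P).totalDegree ≤ Δ * W := by
  rw [← mem_restrictTotalDegree]
  refine aeval_mem_filtration (fun k => restrictTotalDegree τ F k) ?_ ?_ ?_ ?_ hP
  · intro i j hij a ha
    rw [mem_restrictTotalDegree] at ha ⊢
    exact ha.trans hij
  · simp [mem_restrictTotalDegree]
  · intro i j a b ha hb
    rw [mem_restrictTotalDegree] at ha hb ⊢
    exact (totalDegree_mul _ _).trans (Nat.add_le_add ha hb)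
  · simpa [mem_restrictTotalDegree] using hs

/-- The polynomials all of whose coefficients lie in a given submodule. -/
def coeffsIn {F R : Type*} [Field F] [CommRing R] [Algebra F R] (M : Submodule F R) :
    Submodule F (Polynomial R) where
  carrier := {P | ∀ i, P.coeff i ∈ M}
  zero_mem' i := by simp
  add_mem' ha hb i := by
    rw [Polynomial.coeff_add]
    exact M.add_mem (ha i) (hb i)
  smul_mem' c P hP i := by
    rw [Polynomial.coeff_smul]
    exact M.smul_mem _ (hP i)

theorem aeval_mem_coeffsIn {F R σ : Type*} [Field F] [CommRing R] [Algebra F R]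
    (fil : ℕ → Submodule F R) (hmono : Monotone fil) (h1 : (1 : R) ∈ fil 0)
    (hmul : ∀ i j a b, a ∈ fil i → b ∈ fil j → a * b ∈ fil (i + j)) {s : σ → Polynomial R} {W : ℕ}
    (hs : ∀ v, s v ∈ coeffsIn (fil W)) {P : MvPolynomial σ F} {Δ : ℕ} (hP : P.totalDegree ≤ Δ) :
    aeval s P ∈ coeffsIn (fil (Δ * W)) := by
  refine aeval_mem_filtration (fun k => coeffsIn (fil k)) ?_ ?_ ?_ hs hP
  · exact fun i j hij a ha l => hmono hij (ha l)
  · intro l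
    rw [Polynomial.coeff_one]
    split_ifs
    · exact h1
    · exact zero_mem _
  · intro i j a b ha hb l
    rw [Polynomial.coeff_mul]
    exact Submodule.sum_mem _ fun x _ => hmul _ _ _ _ (ha _) (hb _)

/-! ### Restriction of a polynomial to a line -/

section Line

variable {n : ℕ} {F : Type*} [Field F]

/-- The restriction of `f` to the line `z ↦ a + z v`. -/
noncomputable def line {S : Type*} [CommRing S] [Algebra F S] (a v : Fin n → S)
    (f : MvPolynomial (Fin n) F) : Polynomial S :=
  aeval (fun i => Polynomial.C (a i) + Polynomial.C (v i) * Polynomial.X) f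

/-- The homogeneous component of top degree. -/
noncomputable def topForm {σ : Type*} (f : MvPolynomial σ F) : MvPolynomial σ F :=
  homogeneousComponent f.totalDegree f

theorem topForm_ne_zero {σ : Type*} {f : MvPolynomial σ F} (hf : f ≠ 0) : topForm f ≠ 0 := by
  obtain ⟨m, hm, hm'⟩ := Finset.exists_mem_eq_sup f.support (support_nonempty.2 hf)
    fun m => m.sum fun _ e => e
  intro h
  have h1 := congrArg (coeff m) h
  rw [topForm, coeff_homogeneousComponent, if_pos, coeff_zero] at h1
  · exact mem_support_iff.1 hm h1
  · exact hm'.symm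

theorem totalDegree_topForm_le {σ : Type*} (f : MvPolynomial σ F) :
    (topForm f).totalDegree ≤ f.totalDegree :=
  (homogeneousComponent_isHomogeneous _ _).totalDegree_le

section General

variable {S : Type*} [CommRing S] [Algebra F S]

theorem map_line {S' : Type*} [CommRing S'] [Algebra F S'] (φ : S →ₐ[F] S') (a v : Fin n → S)
    (f : MvPolynomial (Fin n) F) :
    (line a v f).map (φ : S →+* S') = line (fun i => φ (a i)) (fun i => φ (v i)) f := by
  have : ((Polynomial.mapAlgHom φ).comp (aeval (R := F)
      (fun i => Polynomial.C (a i) + Polynomial.C (v i) * Polynomial.X))) =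
      aeval (fun i => Polynomial.C (φ (a i)) + Polynomial.C (φ (v i)) * Polynomial.X) := by
    ext i
    simp
  exact DFunLike.congr_fun this f

theorem eval_line (a v : Fin n → S) (f : MvPolynomial (Fin n) F) (z : S) :
    (line a v f).eval z = aeval (fun i => a i + v i * z) f := by
  have : ((Polynomial.aeval (R := S) z).restrictScalars F).comp (aeval (R := F)
      (fun i => Polynomial.C (a i) + Polynomial.C (v i) * Polynomial.X)) =
      aeval (fun i => a i + v i * z) := by
    ext i
    simp
  have h := DFunLike.congr_fun this f
  rw [line]
  simpa [Polynomial.coe_aeval_eq_eval] using h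

theorem natDegree_linear_pow_le (a v : S) (e : ℕ) :
    ((Polynomial.C a + Polynomial.C v * Polynomial.X) ^ e).natDegree ≤ e := by
  refine Polynomial.natDegree_pow_le.trans ?_
  have : (Polynomial.C a + Polynomial.C v * Polynomial.X).natDegree ≤ 1 := by
    rw [add_comm]
    exact Polynomial.natDegree_linear_le
  calc e * _ ≤ e * 1 := Nat.mul_le_mul_left _ this
    _ = e := mul_one _

theorem natDegree_prod_line_le (a v : Fin n → S) (m : Fin n →₀ ℕ) (T : Finset (Fin n)) :
    (∏ i ∈ T, (Polynomial.C (a i) + Polynomial.C (v i) * Polynomial.X) ^ m i).natDegree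
      ≤ ∑ i ∈ T, m i :=
  (Polynomial.natDegree_prod_le _ _).trans
    (Finset.sum_le_sum fun _ _ => natDegree_linear_pow_le _ _ _)

theorem coeff_prod_line (a v : Fin n → S) (m : Fin n →₀ ℕ) (T : Finset (Fin n)) :
    (∏ i ∈ T, (Polynomial.C (a i) + Polynomial.C (v i) * Polynomial.X) ^ m i).coeff
      (∑ i ∈ T, m i) = ∏ i ∈ T, v i ^ m i := by
  classical
  induction T using Finset.induction_on with
  | empty => simp
  | insert i T hi ih =>
    rw [Finset.prod_insert hi, Finset.sum_insert hi, Finset.prod_insert hi,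
      Polynomial.coeff_mul_add_eq_of_natDegree_le (natDegree_linear_pow_le _ _ _)
        (natDegree_prod_line_le _ _ _ _), ih]
    have : (Polynomial.C (a i) + Polynomial.C (v i) * Polynomial.X).natDegree ≤ 1 := by
      rw [add_comm]
      exact Polynomial.natDegree_linear_le
    have h2 := Polynomial.coeff_pow_of_natDegree_le (m := m i) this
    rw [mul_one] at h2
    rw [h2]
    simp

theorem line_eq_sum (a v : Fin n → S) (f : MvPolynomial (Fin n) F) :
    line a v f = ∑ m ∈ f.support, Polynomial.C (algebraMap F S (coeff m f)) *
      ∏ i, (Polynomial.C (a i) + Polynomial.C (v i) * Polynomial.X) ^ m i := by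
  rw [line]
  conv_lhs => rw [f.as_sum, map_sum]
  refine Finset.sum_congr rfl fun m _ => ?_
  rw [aeval_monomial, Finsupp.prod_fintype _ _ (by simp)]
  rfl

theorem natDegree_line_le (a v : Fin n → S) (f : MvPolynomial (Fin n) F) :
    (line a v f).natDegree ≤ f.totalDegree := by
  rw [line_eq_sum]
  refine Polynomial.natDegree_sum_le_of_forall_le _ _ fun m hm => ?_
  refine (Polynomial.natDegree_C_mul_le _ _).trans ((natDegree_prod_line_le a v m _).trans ?_)
  have := le_totalDegree hm
  rwa [Finsupp.sum_fintype _ _ (by simp)] at this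

/-- Only the monomials of top degree reach this power of the line parameter, and the base point does
not contribute to it. So a direction at which the top form is nonzero is one along which the degree
of `f` is kept. -/
theorem coeff_line (a v : Fin n → S) (f : MvPolynomial (Fin n) F) :
    (line a v f).coeff f.totalDegree = aeval v (topForm f) := by
  rw [line_eq_sum, Polynomial.finsetSum_coeff, topForm, homogeneousComponent_apply, map_sum,
    Finset.sum_filter]
  refine Finset.sum_congr rfl fun m hm => ?_
  have hle := le_totalDegree hm
  rw [Finsupp.sum_fintype _ _ (by simp)] at hle
  have hdeg : m.degree = ∑ i, m i := Finsupp.degree_eq_sum m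
  rw [Polynomial.coeff_C_mul]
  split_ifs with h
  · rw [← h, hdeg, coeff_prod_line, aeval_monomial, Finsupp.prod_fintype _ _ (by simp)]
  · rw [Polynomial.coeff_eq_zero_of_natDegree_lt, mul_zero]
    have := natDegree_prod_line_le a v m Finset.univ
    omega

/-- The resultant of the restrictions of two polynomials to a line. -/
noncomputable def lineRes (f g : MvPolynomial (Fin n) F) (a v : Fin n → S) : S :=
  Polynomial.resultant (line a v f) (line a v g) f.totalDegree g.totalDegree

theorem map_lineRes {S' : Type*} [CommRing S'] [Algebra F S'] (φ : S →ₐ[F] S')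
    (f g : MvPolynomial (Fin n) F) (a v : Fin n → S) :
    φ (lineRes f g a v) = lineRes f g (fun i => φ (a i)) (fun i => φ (v i)) := by
  rw [lineRes, lineRes, ← map_line φ, ← map_line φ, Polynomial.resultant_map_map]
  rfl

/-- The resultant is a combination of the two restrictions over any commutative ring, provided one
of the formal degrees is nonzero. -/
theorem lineRes_eq_zero_of_root (f g : MvPolynomial (Fin n) F) (hf : f.totalDegree ≠ 0)
    (a v : Fin n → S) (z : S) (h1 : aeval (fun i => a i + v i * z) f = 0)
    (h2 : aeval (fun i => a i + v i * z) g = 0) : lineRes f g a v = 0 := by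
  obtain ⟨p, q, -, -, h⟩ := Polynomial.exists_mul_add_mul_eq_C_resultant (line a v f) (line a v g)
    (natDegree_line_le a v f) (natDegree_line_le a v g) (Or.inl hf)
  have h3 := congrArg (Polynomial.eval z) h
  rw [Polynomial.eval_add, Polynomial.eval_mul, Polynomial.eval_mul, eval_line, eval_line, h1, h2,
    zero_mul, zero_mul, add_zero, Polynomial.eval_C] at h3
  exact h3.symm

end General

/-- The resultant of the restrictions of two polynomials to the generic line. -/
noncomputable def genericRes (f g : MvPolynomial (Fin n) F) : MvPolynomial (Fin n ⊕ Fin n) F :=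
  lineRes f g (fun i => X (Sum.inl i)) fun i => X (Sum.inr i)

theorem aeval_genericRes {S : Type*} [CommRing S] [Algebra F S] (f g : MvPolynomial (Fin n) F)
    (s : Fin n ⊕ Fin n → S) :
    aeval s (genericRes f g) = lineRes f g (fun i => s (Sum.inl i)) fun i => s (Sum.inr i) := by
  rw [genericRes, map_lineRes]
  simp

theorem totalDegree_coeff_line_le (f : MvPolynomial (Fin n) F) (l : ℕ) :
    ((line (fun i => (X (Sum.inl i) : MvPolynomial (Fin n ⊕ Fin n) F))
      (fun i => X (Sum.inr i)) f).coeff l).totalDegree ≤ f.totalDegree := by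
  have := aeval_mem_coeffsIn (fun k => restrictTotalDegree (Fin n ⊕ Fin n) F k)
    (s := fun i => Polynomial.C (X (Sum.inl i)) + Polynomial.C (X (Sum.inr i)) * Polynomial.X)
    (W := 1) (P := f) (Δ := f.totalDegree) ?_ ?_ ?_ ?_ le_rfl
  · have h := this l
    rw [mem_restrictTotalDegree, mul_one] at h
    exact h
  · intro i j hij a ha
    rw [mem_restrictTotalDegree] at ha ⊢
    exact ha.trans hij
  · simp [mem_restrictTotalDegree]
  · intro i j a b ha hb
    rw [mem_restrictTotalDegree] at ha hb ⊢
    exact (totalDegree_mul _ _).trans (Nat.add_le_add ha hb)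
  · intro v l
    rw [mem_restrictTotalDegree, Polynomial.coeff_add, Polynomial.coeff_C, Polynomial.coeff_C_mul,
      Polynomial.coeff_X]
    refine (totalDegree_add _ _).trans (max_le ?_ ?_)
    · split_ifs <;> simp
    · split_ifs <;> simp

/-- The Sylvester matrix has `deg g` columns of coefficients of `f`, each of degree at most `deg f`
in the parameters, and `deg f` columns of coefficients of `g`, each of degree at most `deg g`. -/
theorem totalDegree_genericRes_le (f g : MvPolynomial (Fin n) F) :
    (genericRes f g).totalDegree ≤ 2 * (f.totalDegree * g.totalDegree) := by
  rw [genericRes, lineRes, Polynomial.resultant, Matrix.det_apply]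
  refine totalDegree_finsetSum_le fun τ _ => ?_
  have hs : ∀ (u : ℤˣ) (P : MvPolynomial (Fin n ⊕ Fin n) F),
      (u • P).totalDegree ≤ P.totalDegree := by
    intro u P
    rcases Int.units_eq_one_or u with rfl | rfl <;> simp
  refine (hs _ _).trans ((totalDegree_finsetProd _ _).trans ?_)
  rw [Fin.sum_univ_add]
  have h1 : ∀ j i, (Polynomial.sylvester (line (fun i => (X (Sum.inl i) :
      MvPolynomial (Fin n ⊕ Fin n) F)) (fun i => X (Sum.inr i)) f) (line (fun i => X (Sum.inl i))
      (fun i => X (Sum.inr i)) g) f.totalDegree g.totalDegree j (Fin.castAdd _ i)).totalDegree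
      ≤ g.totalDegree := by
    intro j i
    rw [Polynomial.sylvester, Matrix.of_apply, Fin.addCases_left]
    split_ifs
    · exact totalDegree_coeff_line_le g _
    · simp
  have h2 : ∀ j i, (Polynomial.sylvester (line (fun i => (X (Sum.inl i) :
      MvPolynomial (Fin n ⊕ Fin n) F)) (fun i => X (Sum.inr i)) f) (line (fun i => X (Sum.inl i))
      (fun i => X (Sum.inr i)) g) f.totalDegree g.totalDegree j (Fin.natAdd _ i)).totalDegree
      ≤ f.totalDegree := by
    intro j i
    rw [Polynomial.sylvester, Matrix.of_apply, Fin.addCases_right]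
    split_ifs
    · exact totalDegree_coeff_line_le f _
    · simp
  refine (Nat.add_le_add (Finset.sum_le_sum fun i _ => h1 _ i)
    (Finset.sum_le_sum fun i _ => h2 _ i)).trans ?_
  simp only [Finset.sum_const, Finset.card_univ, Fintype.card_fin, smul_eq_mul]
  rw [mul_comm g.totalDegree f.totalDegree, two_mul]

end Line

/-! ### Changing one coordinate of a line -/

section Chain

variable {n : ℕ} {F : Type*} [Field F]

theorem aeval_algebraMap_ne_zero {σ k Ω : Type*} [Field k] [Field Ω] [Algebra F k] [Algebra F Ω]
    [Algebra k Ω] [IsScalarTower F k Ω] {u : σ → k} {P : MvPolynomial σ F} (h : aeval u P ≠ 0) :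
    aeval (fun j => algebraMap k Ω (u j)) P ≠ 0 := by
  have h1 : aeval (fun j => algebraMap k Ω (u j)) P = algebraMap k Ω (aeval u P) :=
    (comp_aeval_apply u (IsScalarTower.toAlgHom F k Ω) P).symm
  rw [h1]
  exact fun h0 => h ((map_eq_zero _).1 h0)

/-- By `hv` the formal degree of the restriction of `f` is its true degree. A formal degree of `g`
that is too large only contributes a power of the nonzero leading coefficient of `f`. -/
theorem lineRes_eq_zero_iff {S : Type*} [Field S] [Algebra F S] {f g : MvPolynomial (Fin n) F}
    {a v : Fin n → S} (hv : aeval v (topForm f) ≠ 0) :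
    lineRes f g a v = 0 ↔ ¬ IsCoprime (line a v f) (line a v g) := by
  rw [← coeff_line a] at hv
  have hd : (line a v f).natDegree = f.totalDegree :=
    le_antisymm (natDegree_line_le a v f) (Polynomial.le_natDegree_of_ne_zero hv)
  have h0 : line a v f ≠ 0 := by
    rintro h
    simp [h] at hv
  obtain ⟨k, hk⟩ := Nat.exists_eq_add_of_le (natDegree_line_le a v g)
  rw [lineRes, hk, Polynomial.resultant_add_right_deg _ _ _ _ _ le_rfl, mul_eq_zero,
    or_iff_right (pow_ne_zero _ hv), ← hd, Polynomial.resultant_eq_zero_iff]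
  simp [h0]

theorem exists_root_of_lineRes_eq_zero {S : Type*} [Field S] [IsAlgClosed S] [Algebra F S]
    {f g : MvPolynomial (Fin n) F} {a v : Fin n → S} (hv : aeval v (topForm f) ≠ 0)
    (h : lineRes f g a v = 0) :
    ∃ z, aeval (fun i => a i + v i * z) f = 0 ∧ aeval (fun i => a i + v i * z) g = 0 := by
  rw [lineRes_eq_zero_iff hv,
    Polynomial.isCoprime_iff_aeval_ne_zero_of_isAlgClosed (k := S) (K := S)] at h
  push Not at h
  obtain ⟨z, h1, h2⟩ := h
  rw [← Polynomial.eval_map_algebraMap, Algebra.algebraMap_self, Polynomial.map_id, eval_line]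
    at h1 h2
  exact ⟨z, h1, h2⟩

/-- If one coordinate of the base point of a line is generic, then the coprimality of the
restrictions of `f` and `g` to the line does not depend on that coordinate of the direction. -/
theorem lineRes_update_ne_zero {k : Type*} [Field k] [Algebra F k] {f g : MvPolynomial (Fin n) F}
    (hf : f.totalDegree ≠ 0) (a v : Fin n → k) (i : Fin n) (η : k)
    (hv : aeval v (topForm f) ≠ 0) (hη : aeval (Function.update v i η) (topForm f) ≠ 0)
    (h : lineRes f g (Function.update (fun j => Polynomial.C (a j)) i Polynomial.X)
      (fun j => Polynomial.C (v j)) ≠ 0) :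
    lineRes f g (Function.update (fun j => Polynomial.C (a j)) i Polynomial.X)
      (fun j => Polynomial.C (Function.update v i η j)) ≠ 0 := by
  classical
  intro h0
  -- In this field the generic base coordinate `x` is transcendental over `k`. A vanishing resultant
  -- for the new direction would produce a common root, and from it an algebraic equation for `x`.
  let Ω := AlgebraicClosure (RatFunc k)
  let ι : Polynomial k →ₐ[k] Ω := Algebra.algHom k (Polynomial k) Ω
  have hι : Function.Injective ι := by
    have : Function.Injective (algebraMap (Polynomial k) Ω) := by
      rw [IsScalarTower.algebraMap_eq (Polynomial k) (RatFunc k) Ω]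
      exact (algebraMap (RatFunc k) Ω).injective.comp (IsFractionRing.injective _ _)
    exact this
  let x : Ω := ι Polynomial.X
  have hx : ¬ IsAlgebraic k x := by
    rintro ⟨P, hP, hPx⟩
    apply hP
    apply hι
    rw [map_zero, ← hPx]
    conv_lhs => rw [← Polynomial.aeval_X_left_apply (R := k) P]
    rw [Polynomial.aeval_algHom_apply]
  have hC : ∀ c : k, ι (Polynomial.C c) = algebraMap k Ω c := fun c => ι.commutes c
  have hupd : (fun j => ι ((Function.update (fun j => Polynomial.C (a j)) i Polynomial.X :
      Fin n → Polynomial k) j)) = Function.update (fun j => algebraMap k Ω (a j)) i x := by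
    funext j
    by_cases hj : j = i
    · subst hj; simp [x]
    · simp [hj, hC]
  -- a common root
  have h1 := congrArg (ι.restrictScalars F) h0
  rw [map_lineRes, map_zero] at h1
  simp only [AlgHom.restrictScalars_apply, hC] at h1
  rw [hupd] at h1
  have htop : ∀ u : Fin n → k, aeval u (topForm f) ≠ 0 →
      aeval (fun j => algebraMap k Ω (u j)) (topForm f) ≠ 0 := by
    exact fun u hu => aeval_algebraMap_ne_zero hu
  obtain ⟨z, hz1, hz2⟩ := exists_root_of_lineRes_eq_zero (htop _ hη) h1
  -- the shifted point on the original line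
  let x' : Ω := x + z * (algebraMap k Ω η - algebraMap k Ω (v i))
  have hpt : (fun j => Function.update (fun j => algebraMap k Ω (a j)) i x j
      + algebraMap k Ω (Function.update v i η j) * z)
      = fun j => Function.update (fun j => algebraMap k Ω (a j)) i x' j
      + algebraMap k Ω (v j) * z := by
    funext j
    by_cases hj : j = i
    · subst hj; simp [x']; ring
    · simp [hj]
  rw [hpt] at hz1 hz2
  have hx' : IsAlgebraic k x' := by
    refine ⟨_, h, ?_⟩
    have h2 := map_lineRes ((Polynomial.aeval (R := k) x').restrictScalars F) f g
      (Function.update (fun j => Polynomial.C (a j)) i Polynomial.X) (fun j => Polynomial.C (v j))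
    have h3 : (fun j => ((Polynomial.aeval (R := k) x').restrictScalars F)
        ((Function.update (fun j => Polynomial.C (a j)) i Polynomial.X : Fin n → Polynomial k) j))
        = Function.update (fun j => algebraMap k Ω (a j)) i x' := by
      funext j
      by_cases hj : j = i
      · subst hj; simp
      · simp [hj]
    rw [h3] at h2
    simp only [AlgHom.restrictScalars_apply, Polynomial.aeval_C] at h2
    rw [h2]
    exact lineRes_eq_zero_of_root f g hf _ _ z hz1 hz2
  let κ := algebraicClosure k Ω
  let x'κ : κ := ⟨x', (mem_algebraicClosure_iff).2 hx'⟩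
  let P : Polynomial κ := line (F := F) (Function.update (fun j => algebraMap k κ (a j)) i x'κ)
    (fun j => algebraMap k κ (v j)) f
  have hP : P ≠ 0 := by
    intro hP
    have h2 := congrArg (fun Q => Q.coeff f.totalDegree) hP
    simp only [P, coeff_line, Polynomial.coeff_zero] at h2
    exact aeval_algebraMap_ne_zero hv h2
  have hz : IsAlgebraic κ z := by
    refine ⟨P, hP, ?_⟩
    rw [← Polynomial.eval_map_algebraMap]
    let φ : κ →ₐ[F] Ω := κ.val.restrictScalars F
    have h2 := map_line (F := F) φ
      (Function.update (fun j => algebraMap k κ (a j)) i x'κ) (fun j => algebraMap k κ (v j)) f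
    have h3 : (fun j => φ
        (Function.update (fun j => algebraMap k κ (a j)) i x'κ j))
        = Function.update (fun j => algebraMap k Ω (a j)) i x' := by
      funext j
      by_cases hj : j = i
      · subst hj
        simp only [Function.update_self]
        rfl
      · simp only [Function.update_of_ne hj]
        rfl
    rw [h3] at h2
    change Polynomial.eval z (P.map (φ : κ →+* Ω)) = 0
    rw [h2, eval_line]
    exact hz1
  have hzk : IsAlgebraic k z := hz.restrictScalars k
  apply hx
  have : x = x' - z * (algebraMap k Ω η - algebraMap k Ω (v i)) := by simp [x']
  rw [this]
  exact hx'.sub (hzk.mul ((isAlgebraic_algebraMap _).sub (isAlgebraic_algebraMap _)))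

/-- Substituting a large power of `t` for `X` in a polynomial in `X` with coefficients in `F[t]`. -/
theorem eval_X_pow_ne_zero {Q : Polynomial (Polynomial F)} (hQ : Q ≠ 0) {N : ℕ}
    (hN : ∀ j, (Q.coeff j).natDegree < N) : Q.eval (Polynomial.X ^ N) ≠ 0 := by
  intro h
  -- This is the degree of the leading term coming from the top coefficient of `Q`. The coefficient
  -- of index `j` contributes only degrees below `N * (j + 1) ≤ N * Q.natDegree` when `j` is
  -- smaller.
  have h1 := congrArg (fun P => P.coeff (N * Q.natDegree + Q.leadingCoeff.natDegree)) h
  simp only [Polynomial.eval_eq_sum_range, Polynomial.finsetSum_coeff, Polynomial.coeff_zero] at h1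
  rw [Finset.sum_range_succ, Finset.sum_eq_zero, zero_add, ← pow_mul, add_comm (N * _),
    Polynomial.coeff_mul_X_pow] at h1
  · exact hQ (by simpa using h1)
  · intro j hj
    rw [← pow_mul, Polynomial.coeff_mul_X_pow']
    split_ifs with h
    · apply Polynomial.coeff_eq_zero_of_natDegree_lt
      have h2 := hN j
      have h3 : N * (j + 1) ≤ N * Q.natDegree := Nat.mul_le_mul_left _ (Finset.mem_range.1 hj)
      rw [Nat.mul_add] at h3
      omega
    · rfl

end Chain

/-! ### Partially specialised points, and the line with generic base point -/

section Points

variable {F : Type*} [Field F]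

/-- The point with coordinates `t ^ w v` for `v ∈ S` and constant coordinates `ζ v` elsewhere. -/
noncomputable def hybridPoint {τ : Type*} (S : τ → Prop) [DecidablePred S] (w : τ → ℕ)
    (ζ : τ → F) (v : τ) : Polynomial F :=
  if S v then Polynomial.X ^ w v else Polynomial.C (ζ v)

/-- Join `ζ₁` and `ζ₂` by the line `ζ₁ + c (ζ₂ - ζ₁)`. The two values are polynomials in `c`, one
nonzero at `c = 0` and the other at `c = 1`, so some `c` in the infinite field avoids the roots of
both. -/
theorem exists_hybridPoint_ne_zero [Infinite F] {τ : Type*} (w : τ → ℕ) (S₁ S₂ : τ → Prop)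
    [DecidablePred S₁] [DecidablePred S₂] {P₁ P₂ : MvPolynomial τ F} {ζ₁ ζ₂ : τ → F}
    (h₁ : aeval (hybridPoint S₁ w ζ₁) P₁ ≠ 0) (h₂ : aeval (hybridPoint S₂ w ζ₂) P₂ ≠ 0) :
    ∃ ζ : τ → F, aeval (hybridPoint S₁ w ζ) P₁ ≠ 0 ∧ aeval (hybridPoint S₂ w ζ) P₂ ≠ 0 := by
  let L : (S : τ → Prop) → [DecidablePred S] → τ → Polynomial (Polynomial F) := fun S _ v =>
    if S v then Polynomial.C (Polynomial.X ^ w v)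
    else Polynomial.C (Polynomial.C (ζ₁ v))
      + Polynomial.X * Polynomial.C (Polynomial.C (ζ₂ v - ζ₁ v))
  have hL : ∀ (S : τ → Prop) [DecidablePred S] (P : MvPolynomial τ F) (c : F),
      (aeval (L S) P).eval (Polynomial.C c)
        = aeval (hybridPoint S w fun v => ζ₁ v + c * (ζ₂ v - ζ₁ v)) P := by
    intro S _ P c
    have : ((Polynomial.aeval (R := Polynomial F) (Polynomial.C c)).restrictScalars F).comp
        (aeval (R := F) (L S)) = aeval (hybridPoint S w fun v => ζ₁ v + c * (ζ₂ v - ζ₁ v)) := by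
      ext v : 1
      by_cases hv : S v <;> simp [L, hybridPoint, hv]
    have h := DFunLike.congr_fun this P
    rw [← h]
    simp [Polynomial.coe_aeval_eq_eval]
  have e₁ : aeval (L S₁) P₁ ≠ 0 := by
    intro h
    have := hL S₁ P₁ 0
    rw [h, Polynomial.eval_zero] at this
    simp only [zero_mul, add_zero] at this
    exact h₁ this.symm
  have e₂ : aeval (L S₂) P₂ ≠ 0 := by
    intro h
    have := hL S₂ P₂ 1
    rw [h, Polynomial.eval_zero] at this
    simp only [one_mul, add_sub_cancel] at this
    exact h₂ this.symm
  have hfin := Polynomial.finite_setOfPred_isRoot (mul_ne_zero e₁ e₂)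
  have hinf : (Set.range (Polynomial.C : F → Polynomial F)).Infinite :=
    Set.infinite_range_of_injective Polynomial.C_injective
  obtain ⟨_, ⟨c, rfl⟩, hc⟩ := (hinf.sdiff hfin).nonempty
  have hc' : ((aeval (L S₁) P₁) * (aeval (L S₂) P₂)).eval (Polynomial.C c) ≠ 0 := hc
  rw [Polynomial.eval_mul, hL, hL] at hc'
  exact ⟨_, left_ne_zero_of_mul hc', right_ne_zero_of_mul hc'⟩

theorem aeval_smul_of_isHomogeneous {σ S : Type*} [CommRing S] [Algebra F S]
    {P : MvPolynomial σ F} {d : ℕ} (hP : P.IsHomogeneous d) (c : S) (v : σ → S) :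
    aeval (fun i => c * v i) P = c ^ d * aeval v P := by
  rw [P.as_sum, map_sum, map_sum, Finset.mul_sum]
  refine Finset.sum_congr rfl fun m hm => ?_
  have h1 : m.degree = d := by
    have := hP (mem_support_iff.1 hm)
    rwa [Finsupp.weight_apply, Finsupp.sum, Finset.sum_congr rfl fun i _ => smul_eq_mul _ _,
      Finset.sum_congr rfl fun i _ => by rw [Pi.one_apply, mul_one]] at this
  rw [aeval_monomial, aeval_monomial, Finsupp.prod, Finsupp.prod]
  simp only [mul_pow, Finset.prod_mul_distrib, Finset.prod_pow_eq_pow_sum]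
  rw [← h1, Finsupp.degree_apply]
  ring

/-- The automorphism `x ↦ x + z υ`, `z ↦ z`. -/
noncomputable def shear {n : ℕ} (υ : Fin n → F) :
    Polynomial (MvPolynomial (Fin n) F) →+* Polynomial (MvPolynomial (Fin n) F) :=
  Polynomial.eval₂RingHom
    (aeval (R := F) (fun i => Polynomial.C (X i) + Polynomial.C (C (υ i)) * Polynomial.X)).toRingHom
    Polynomial.X

theorem shear_C {n : ℕ} (υ : Fin n → F) (f : MvPolynomial (Fin n) F) :
    shear υ (Polynomial.C f) = line X (fun i => C (υ i)) f := by
  simp [shear, line]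

theorem shear_comp {n : ℕ} (υ υ' : Fin n → F) (h : ∀ i, υ' i + υ i = 0) :
    (shear υ).comp (shear υ') = RingHom.id _ := by
  apply Polynomial.ringHom_ext'
  · apply MvPolynomial.ringHom_ext
    · intro c
      simp [shear]
    · intro i
      have h1 : (C (υ' i) : MvPolynomial (Fin n) F) + C (υ i) = 0 := by
        rw [← C_add, h i, C_0]
      have h2 := congrArg (Polynomial.C) h1
      rw [Polynomial.C_add, Polynomial.C_0] at h2
      simp only [shear, AlgHom.toRingHom_eq_coe, RingHom.comp_apply, Polynomial.coe_eval₂RingHom,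
        Polynomial.eval₂_C, RingHom.coe_coe, aeval_X, Polynomial.eval₂_add, Polynomial.eval₂_mul,
        Polynomial.eval₂_X, RingHom.id_apply]
      have h3 : (aeval fun i => Polynomial.C (X i) + Polynomial.C (C (υ i)) * Polynomial.X)
          (C (υ' i)) = (Polynomial.C (C (υ' i)) : Polynomial (MvPolynomial (Fin n) F)) := by
        rw [aeval_C]; rfl
      rw [h3, add_assoc, ← add_mul, add_comm (Polynomial.C (C (υ i))), h2]
      simp
  · simp [shear]

/-- The shear is an automorphism carrying `f` and `g`, as constants in `z`, to their restrictions.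
So the restriction of `f` is prime and does not divide that of `g`. It has positive degree in `z`,
and Gauss's lemma makes the restrictions coprime over the field of fractions, where the resultant
detects coprimality. -/
theorem lineRes_X_ne_zero {n : ℕ} {f g : MvPolynomial (Fin n) F} (hf : Irreducible f)
    (hfg : ¬ f ∣ g) (hf0 : f.totalDegree ≠ 0) {υ : Fin n → F} (hυ : aeval υ (topForm f) ≠ 0) :
    lineRes f g X (fun i => (C (υ i) : MvPolynomial (Fin n) F)) ≠ 0 := by
  let R := MvPolynomial (Fin n) F
  let K := FractionRing R
  let e : Polynomial R ≃+* Polynomial R := RingEquiv.ofRingHom (shear υ) (shear fun i => -υ i)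
    (shear_comp _ _ fun i => by simp) (shear_comp _ _ fun i => by simp)
  have he : ∀ u, e (Polynomial.C u) = line X (fun i => C (υ i)) u := fun u => shear_C υ u
  have hυ' : aeval (fun i => (C (υ i) : R)) (topForm f) ≠ 0 := by
    have h1 : aeval (fun i => (C (υ i) : R)) (topForm f) = C (aeval υ (topForm f)) :=
      (comp_aeval_apply υ (Algebra.ofId F R) (topForm f)).symm
    rw [h1]
    exact fun h => hυ (C_injective _ _ (h.trans C_0.symm))
  have hprime : Prime (e (Polynomial.C f)) :=
    (MulEquiv.prime_iff e.toMulEquiv).2 (Polynomial.prime_C_iff.2 hf.prime)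
  have hndvd : ¬ e (Polynomial.C f) ∣ e (Polynomial.C g) := by
    rw [map_dvd_iff e]
    intro h
    apply hfg
    simpa using (Polynomial.C_dvd_iff_dvd_coeff f _).1 h 0
  rw [he] at hprime
  rw [he, he] at hndvd
  have hdeg : (line X (fun i => (C (υ i) : R)) f).natDegree ≠ 0 := by
    intro h
    have h2 := coeff_line X (fun i => (C (υ i) : R)) f
    rw [Polynomial.coeff_eq_zero_of_natDegree_lt (by omega)] at h2
    exact hυ' h2.symm
  have hprim := hprime.irreducible.isPrimitive hdeg
  have hirr := (hprim.irreducible_iff_irreducible_map_fraction_map (K := K)).1 hprime.irreducible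
  rw [hprim.dvd_iff_fraction_map_dvd_fraction_map K] at hndvd
  have hcop := hirr.coprime_iff_not_dvd.2 hndvd
  intro h
  have h1 := map_lineRes (IsScalarTower.toAlgHom F R K) f g X fun i => (C (υ i) : R)
  rw [h, map_zero] at h1
  have hυK : aeval (fun i => IsScalarTower.toAlgHom F R K (C (υ i))) (topForm f) ≠ 0 := by
    have h3 := (comp_aeval_apply (fun i => (C (υ i) : R)) (IsScalarTower.toAlgHom F R K)
      (topForm f)).symm
    rw [h3]
    intro h4
    apply hυ'
    exact (IsFractionRing.injective R K) (h4.trans (map_zero _).symm)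
  refine (lineRes_eq_zero_iff hυK).1 h1.symm ?_
  rw [← map_line, ← map_line]
  exact hcop

end Points

/-! ### Nonvanishing of the resultant along the prescribed line -/

section Coprime

variable {F : Type*} [Field F]

theorem exists_eval_ne_zero [Infinite F] {σ : Type*} {P : MvPolynomial σ F} (hP : P ≠ 0) :
    ∃ y : σ → F, eval y P ≠ 0 := by
  by_contra! h
  exact hP (MvPolynomial.funext fun y => by rw [h y, map_zero])

/-- The variables `x_j`, `y_j` with `j < i`. -/
def IsBefore {n : ℕ} (i : ℕ) (v : Fin n ⊕ Fin n) : Prop :=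
  Sum.elim Fin.val Fin.val v < i

instance {n : ℕ} (i : ℕ) : DecidablePred (IsBefore (n := n) i) :=
  fun _ => inferInstanceAs (Decidable (_ < _))

/-- The exponents of the base point and of the direction. -/
def lineWeight (n D₁ D₂ : ℕ) : Fin n ⊕ Fin n → ℕ :=
  Sum.elim (fun i => D₁ ^ (i.val + 1)) fun i => D₂ ^ (i.val + 1)

theorem hybridPoint_inl {n : ℕ} (i D₁ D₂ : ℕ) (ζ : Fin n ⊕ Fin n → F) (j : Fin n) :
    hybridPoint (IsBefore i) (lineWeight n D₁ D₂) ζ (Sum.inl j)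
      = if j.val < i then Polynomial.X ^ (D₁ ^ (j.val + 1)) else Polynomial.C (ζ (Sum.inl j)) :=
  rfl

theorem hybridPoint_inr {n : ℕ} (i D₁ D₂ : ℕ) (ζ : Fin n ⊕ Fin n → F) (j : Fin n) :
    hybridPoint (IsBefore i) (lineWeight n D₁ D₂) ζ (Sum.inr j)
      = if j.val < i then Polynomial.X ^ (D₂ ^ (j.val + 1)) else Polynomial.C (ζ (Sum.inr j)) :=
  rfl

/-- Sliding the base point along its line translates the parameter, so common roots of the
restrictions correspond. -/
theorem lineRes_shift_ne_zero {n : ℕ} {f g : MvPolynomial (Fin n) F} (hf0 : f.totalDegree ≠ 0)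
    {ξ υ : Fin n → F} (hυ : aeval υ (topForm f) ≠ 0) (h : lineRes f g ξ υ ≠ 0) (s : F) :
    lineRes f g (fun i => ξ i + s * υ i) υ ≠ 0 := by
  intro h0
  let Ω := AlgebraicClosure F
  have h1 := map_lineRes (Algebra.ofId F Ω) f g (fun i => ξ i + s * υ i) υ
  rw [h0, map_zero] at h1
  obtain ⟨z, h2, h3⟩ := exists_root_of_lineRes_eq_zero
    (aeval_algebraMap_ne_zero (Ω := Ω) hυ) h1.symm
  have h4 : lineRes f g (fun i => Algebra.ofId F Ω (ξ i)) (fun i => Algebra.ofId F Ω (υ i)) = 0 := by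
    apply lineRes_eq_zero_of_root f g hf0 _ _ (Algebra.ofId F Ω s + z)
    · rw [← h2]
      congr 2
      funext i
      simp only [map_add, map_mul]
      change _ = _ + Algebra.ofId F Ω (υ i) * z
      ring
    · rw [← h3]
      congr 2
      funext i
      simp only [map_add, map_mul]
      change _ = _ + Algebra.ofId F Ω (υ i) * z
      ring
  rw [← map_lineRes] at h4
  exact h ((map_eq_zero _).1 h4)

/-- The direction is scaled to have first coordinate 1, which homogeneity of the top form permits,
and the base point is slid along the line until its first coordinate is 1 as well. The prescribed
powers of `t` become 1 at `t = 1`, so the hybrid point specialises to this line, whatever the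
exponents. -/
theorem exists_hybridPoint_one [Infinite F] {n : ℕ} (hn : 0 < n) {f g : MvPolynomial (Fin n) F}
    (hf : Irreducible f) (hfg : ¬ f ∣ g) (hf0 : f.totalDegree ≠ 0) (D₁ D₂ : ℕ) :
    ∃ ζ : Fin n ⊕ Fin n → F, aeval (hybridPoint (IsBefore 1) (lineWeight n D₁ D₂) ζ) (genericRes f g) ≠ 0 := by
  let i₀ : Fin n := ⟨0, hn⟩
  obtain ⟨y, hy⟩ := exists_eval_ne_zero (mul_ne_zero (topForm_ne_zero hf.ne_zero) (X_ne_zero i₀))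
  rw [eval_mul, eval_X] at hy
  let υ : Fin n → F := fun i => (y i₀)⁻¹ * y i
  have hυ : aeval υ (topForm f) ≠ 0 := by
    have h1 := aeval_smul_of_isHomogeneous (homogeneousComponent_isHomogeneous f.totalDegree f)
      (y i₀)⁻¹ y
    rw [topForm, h1]
    exact mul_ne_zero (pow_ne_zero _ (inv_ne_zero (right_ne_zero_of_mul hy)))
      (left_ne_zero_of_mul hy)
  have hυ₀ : υ i₀ = 1 := inv_mul_cancel₀ (right_ne_zero_of_mul hy)
  obtain ⟨ξ, hξ⟩ := exists_eval_ne_zero (lineRes_X_ne_zero hf hfg hf0 hυ)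
  have h2 := map_lineRes (aeval (R := F) ξ) f g X fun i => (C (υ i) : MvPolynomial (Fin n) F)
  simp only [aeval_X, aeval_C, Algebra.algebraMap_self, RingHom.id_apply] at h2
  have h3 : lineRes f g ξ υ ≠ 0 := by
    rw [← h2]
    exact hξ
  have h4 := lineRes_shift_ne_zero hf0 hυ h3 (1 - ξ i₀)
  refine ⟨Sum.elim (fun i => ξ i + (1 - ξ i₀) * υ i) υ, fun h0 => h4 ?_⟩
  have h5 := congrArg (Polynomial.aeval (1 : F)) h0
  rw [comp_aeval_apply, map_zero, aeval_genericRes] at h5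
  rw [← h5]
  congr 1 <;> funext i
  · rw [hybridPoint_inl]
    by_cases hi : i.val < 1
    · have : i = i₀ := Fin.ext (by simpa [i₀] using hi)
      subst this
      rw [if_pos hi]
      simp [hυ₀]
    · rw [if_neg hi]
      simp
  · rw [hybridPoint_inr]
    by_cases hi : i.val < 1
    · have : i = i₀ := Fin.ext (by simpa [i₀] using hi)
      subst this
      rw [if_pos hi]
      simp [hυ₀]
    · rw [if_neg hi]
      simp

/-- With powers of a suitable `c` as constants, setting `t = c` gives the full Kronecker
substitution at `c`. -/
theorem exists_hybridPoint_topForm [Infinite F] {n : ℕ} {f : MvPolynomial (Fin n) F}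
    (hf : f ≠ 0) (D₁ : ℕ) {D₂ : ℕ} (hD₂ : f.totalDegree < D₂) (i : ℕ) :
    ∃ ζ : Fin n ⊕ Fin n → F, aeval (hybridPoint (IsBefore i) (lineWeight n D₁ D₂) ζ)
      (rename Sum.inr (topForm f)) ≠ 0 := by
  have h1 := kron_pow_ne_zero (topForm_ne_zero hf) ((totalDegree_topForm_le f).trans_lt hD₂)
  obtain ⟨c, hc⟩ : ∃ c, (kron (fun i : Fin n => D₂ ^ (i.val + 1)) (topForm f)).eval c ≠ 0 := by
    by_contra! h
    exact h1 (Polynomial.funext fun c => by simp [h c])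
  rw [eval_kron] at hc
  refine ⟨fun v => c ^ lineWeight n D₁ D₂ v, fun h0 => hc ?_⟩
  have h5 := congrArg (Polynomial.aeval c) h0
  rw [comp_aeval_apply, map_zero, aeval_rename] at h5
  rw [← h5]
  change aeval _ _ = aeval _ _
  congr 2
  funext j
  by_cases hj : IsBefore i (Sum.inr j : Fin n ⊕ Fin n) <;> simp [hybridPoint, hj, lineWeight]

theorem aeval_algebraMap_ne_zero' {σ R k : Type*} [CommRing R] [IsDomain R] [Field k] [Algebra F R]
    [Algebra F k] [Algebra R k] [IsScalarTower F R k] [FaithfulSMul R k] {u : σ → R}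
    {P : MvPolynomial σ F} (h : aeval u P ≠ 0) : aeval (fun j => algebraMap R k (u j)) P ≠ 0 := by
  have h1 : aeval (fun j => algebraMap R k (u j)) P = algebraMap R k (aeval u P) :=
    (comp_aeval_apply u (IsScalarTower.toAlgHom F R k) P).symm
  rw [h1]
  exact fun h0 => h ((FaithfulSMul.algebraMap_injective R k) (h0.trans (map_zero _).symm))

/-- The direction coordinate `i` is changed first, while the base coordinate `i` is still generic.
Then that base coordinate is specialised to `t ^ (D₁ ^ (i + 1))`; by `h₁` and `h₂` this exponent
exceeds the degree in `t` of every coefficient of the resultant, so nothing cancels. -/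
theorem exists_hybridPoint_succ [Infinite F] {n : ℕ} {f g : MvPolynomial (Fin n) F}
    (hf : f ≠ 0) (hf0 : f.totalDegree ≠ 0) {D₁ D₂ : ℕ} (hD₂ : f.totalDegree < D₂) (i : Fin n)
    (h₁ : 2 * (f.totalDegree * g.totalDegree) * D₁ ^ i.val < D₁ ^ (i.val + 1))
    (h₂ : 2 * (f.totalDegree * g.totalDegree) * D₂ ^ (i.val + 1) < D₁ ^ (i.val + 1))
    (h : ∃ ζ : Fin n ⊕ Fin n → F, aeval (hybridPoint (IsBefore i) (lineWeight n D₁ D₂) ζ) (genericRes f g) ≠ 0) :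
    ∃ ζ : Fin n ⊕ Fin n → F, aeval (hybridPoint (IsBefore (i.val + 1)) (lineWeight n D₁ D₂) ζ)
      (genericRes f g) ≠ 0 := by
  classical
  obtain ⟨ζ₁, hζ₁⟩ := h
  -- One choice of constants has to keep three things nonzero: the resultant at the old point, and
  -- the top form of `f` at the old and at the new direction.
  obtain ⟨ζ₂, hζ₂⟩ := exists_hybridPoint_topForm hf D₁ hD₂ i
  obtain ⟨ζ₃, h₃, h₄⟩ := exists_hybridPoint_ne_zero _ _ _ hζ₁ hζ₂
  have h₅ : aeval (hybridPoint (IsBefore i) (lineWeight n D₁ D₂) ζ₃)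
      (genericRes f g * rename Sum.inr (topForm f)) ≠ 0 := by
    rw [map_mul]
    exact mul_ne_zero h₃ h₄
  obtain ⟨ζ₄, hζ₄⟩ := exists_hybridPoint_topForm hf D₁ hD₂ (i.val + 1)
  obtain ⟨ζ, h₆, h₇⟩ := exists_hybridPoint_ne_zero _ _ _ h₅ hζ₄
  rw [map_mul] at h₆
  have h₈ := left_ne_zero_of_mul h₆
  have h₉ := right_ne_zero_of_mul h₆
  rw [aeval_rename] at h₉ h₇
  rw [aeval_genericRes] at h₈
  let a : Fin n → Polynomial F := fun j => hybridPoint (IsBefore i) (lineWeight n D₁ D₂) ζ (Sum.inl j)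
  let v : Fin n → Polynomial F := fun j => hybridPoint (IsBefore i) (lineWeight n D₁ D₂) ζ (Sum.inr j)
  let η : Polynomial F := Polynomial.X ^ (D₂ ^ (i.val + 1))
  have hvη : Function.update v i η
      = hybridPoint (IsBefore (i.val + 1)) (lineWeight n D₁ D₂) ζ ∘ Sum.inr := by
    funext j
    by_cases hj : j = i
    · subst hj
      simp [hybridPoint, IsBefore, lineWeight, η]
    · have h1 : j.val < i.val ↔ j.val < i.val + 1 := by
        have : j.val ≠ i.val := fun h => hj (Fin.ext h)
        omega
      simp only [Function.update_of_ne hj, Function.comp_apply, v, hybridPoint_inr, h1]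
  have haη : Function.update a i (Polynomial.X ^ (D₁ ^ (i.val + 1)))
      = hybridPoint (IsBefore (i.val + 1)) (lineWeight n D₁ D₂) ζ ∘ Sum.inl := by
    funext j
    by_cases hj : j = i
    · subst hj
      simp [hybridPoint, IsBefore, lineWeight]
    · have h1 : j.val < i.val ↔ j.val < i.val + 1 := by
        have : j.val ≠ i.val := fun h => hj (Fin.ext h)
        omega
      simp only [Function.update_of_ne hj, Function.comp_apply, a, hybridPoint_inl, h1]
  let k := RatFunc F
  let Q : Polynomial (Polynomial F) := lineRes f g
    (Function.update (fun j => Polynomial.C (a j)) i Polynomial.X)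
    (fun j => Polynomial.C (Function.update v i η j))
  have hfaith : FaithfulSMul (Polynomial F) k :=
    (faithfulSMul_iff_algebraMap_injective _ _).2 (IsFractionRing.injective _ _)
  have hupd : ∀ (b : Fin n → Polynomial F) (c : Polynomial F),
      (fun j => algebraMap (Polynomial F) k (Function.update b i c j))
        = Function.update (fun j => algebraMap (Polynomial F) k (b j)) i
          (algebraMap (Polynomial F) k c) := by
    intro b c
    funext j
    by_cases hj : j = i
    · subst hj; simp
    · simp [hj]
  have hQ : Q ≠ 0 := by
    have hk := lineRes_update_ne_zero (k := k) (f := f) (g := g) hf0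
      (fun j => algebraMap (Polynomial F) k (a j)) (fun j => algebraMap (Polynomial F) k (v j)) i
      (algebraMap (Polynomial F) k η) (aeval_algebraMap_ne_zero' h₉) ?_ ?_
    · intro h0
      apply hk
      have h1 := map_lineRes
        (Polynomial.mapAlgHom (IsScalarTower.toAlgHom F (Polynomial F) k)) f g
        (Function.update (fun j => Polynomial.C (a j)) i Polynomial.X)
        (fun j => Polynomial.C (Function.update v i η j))
      change _ = lineRes _ _ _ _ at h1
      rw [show lineRes f g (Function.update (fun j => Polynomial.C (a j)) i Polynomial.X)
        (fun j => Polynomial.C (Function.update v i η j)) = Q from rfl, h0, map_zero] at h1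
      rw [h1]
      congr 1 <;> funext j
      · by_cases hj : j = i
        · subst hj; simp
        · simp [hj]
      · rw [← hupd]
        simp
    · rw [← hupd, hvη]
      exact aeval_algebraMap_ne_zero' h₇
    · intro h0
      have h1 := map_lineRes ((Polynomial.aeval (R := k)
        (algebraMap (Polynomial F) k (a i))).restrictScalars F) f g
        (Function.update (fun j => Polynomial.C (algebraMap (Polynomial F) k (a j))) i Polynomial.X)
        (fun j => Polynomial.C (algebraMap (Polynomial F) k (v j)))
      rw [h0, map_zero] at h1
      have h2 := map_lineRes (IsScalarTower.toAlgHom F (Polynomial F) k) f g a v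
      apply h₈
      apply FaithfulSMul.algebraMap_injective (Polynomial F) k
      rw [map_zero, h1]
      refine h2.trans ?_
      congr 1 <;> funext j
      · by_cases hj : j = i
        · subst hj; simp
        · simp [hj]
      · simp
  have hdeg : ∀ l, (Q.coeff l).natDegree < D₁ ^ (i.val + 1) := by
    -- Bounds the degrees in `t` of all coordinates: the base coordinates before `i` have degree at
    -- most `D₁ ^ i`, the direction coordinates at most `D₂ ^ (i + 1)`.
    let W := max (D₁ ^ i.val) (D₂ ^ (i.val + 1))
    have hW : 2 * (f.totalDegree * g.totalDegree) * W < D₁ ^ (i.val + 1) := by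
      rcases max_choice (D₁ ^ i.val) (D₂ ^ (i.val + 1)) with h | h
      · simpa only [W, h] using h₁
      · simpa only [W, h] using h₂
    have h1 := aeval_genericRes (S := Polynomial (Polynomial F)) f g
      (Sum.elim (Function.update (fun j => Polynomial.C (a j)) i Polynomial.X)
        (fun j => Polynomial.C (Function.update v i η j)))
    change _ = Q at h1
    rw [← h1]
    have hmem := aeval_mem_coeffsIn (F := F) (fun l => (Polynomial.degreeLE F l))
      (s := (Sum.elim (Function.update (fun j => Polynomial.C (a j)) i Polynomial.X)
        (fun j => Polynomial.C (Function.update v i η j)))) (W := W) ?_ ?_ ?_ ?_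
      (totalDegree_genericRes_le f g)
    · intro l
      have h2 := hmem l
      rw [Polynomial.mem_degreeLE] at h2
      exact (Polynomial.natDegree_le_iff_degree_le.2 h2).trans_lt hW
    · intro i j hij p hp
      rw [Polynomial.mem_degreeLE] at hp ⊢
      exact hp.trans (by exact_mod_cast hij)
    · rw [Polynomial.mem_degreeLE]
      simp
    · intro i j p q hp hq
      rw [Polynomial.mem_degreeLE] at hp hq ⊢
      rw [Nat.cast_add]
      exact (Polynomial.degree_mul_le _ _).trans (add_le_add hp hq)
    · have hCmem : ∀ p : Polynomial F, p.natDegree ≤ W →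
          Polynomial.C p ∈ coeffsIn (F := F) (Polynomial.degreeLE F W) := by
        intro p hp l
        rw [Polynomial.coeff_C, Polynomial.mem_degreeLE]
        split_ifs
        · exact Polynomial.natDegree_le_iff_degree_le.1 hp
        · simp
      rintro (j | j)
      · by_cases hj : j = i
        · subst hj
          intro l
          simp only [Sum.elim_inl, Function.update_self]
          rw [Polynomial.coeff_X, Polynomial.mem_degreeLE]
          split_ifs
          · simp
          · simp
        · simp only [Sum.elim_inl, Function.update_of_ne hj]
          apply hCmem
          simp only [a, hybridPoint_inl]
          split_ifs with hlt
          · rw [Polynomial.natDegree_X_pow]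
            have hD₁ : 0 < D₁ := by
              rcases Nat.eq_zero_or_pos D₁ with rfl | h
              · simp at h₁
              · exact h
            exact (Nat.pow_le_pow_right hD₁ hlt).trans (le_max_left _ _)
          · simp
      · simp only [Sum.elim_inr]
        apply hCmem
        rw [hvη]
        simp only [Function.comp_apply, hybridPoint_inr]
        split_ifs with hlt
        · rw [Polynomial.natDegree_X_pow]
          exact (Nat.pow_le_pow_right (by omega) hlt).trans (le_max_right _ _)
        · simp
  have hfin := eval_X_pow_ne_zero hQ hdeg
  refine ⟨ζ, ?_⟩
  rw [aeval_genericRes]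
  intro h0
  apply hfin
  have h1 := map_lineRes ((Polynomial.aeval (R := Polynomial F)
    (Polynomial.X ^ (D₁ ^ (i.val + 1)) : Polynomial F)).restrictScalars F) f g
    (Function.update (fun j => Polynomial.C (a j)) i Polynomial.X)
    (fun j => Polynomial.C (Function.update v i η j))
  change Polynomial.aeval _ Q = _ at h1
  rw [Polynomial.coe_aeval_eq_eval] at h1
  rw [h1, ← h0]
  congr 1
  · rw [show (fun i_1 => hybridPoint (IsBefore (i.val + 1)) (lineWeight n D₁ D₂) ζ (Sum.inl i_1))
      = Function.update a i (Polynomial.X ^ (D₁ ^ (i.val + 1))) from haη.symm]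
    funext j
    by_cases hj : j = i
    · subst hj; simp
    · simp [hj]
  · rw [show (fun i_1 => hybridPoint (IsBefore (i.val + 1)) (lineWeight n D₁ D₂) ζ (Sum.inr i_1))
      = Function.update v i η from hvη.symm]
    funext j
    simp

theorem totalDegree_ne_zero_of_irreducible {σ : Type*} {f : MvPolynomial σ F}
    (hf : Irreducible f) : f.totalDegree ≠ 0 := by
  intro h
  rw [totalDegree_eq_zero_iff_eq_C] at h
  rw [h] at hf
  refine hf.not_isUnit (IsUnit.map C (IsUnit.mk0 _ ?_))
  intro h0
  rw [h0, C_0] at hf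
  exact hf.ne_zero rfl

/-- The restrictions of coprime polynomials to the line with base point `t ^ (D₁ ^ i)` and direction
`t ^ (D₂ ^ i)` have a nonzero resultant. -/
theorem kron_genericRes_ne_zero [Infinite F] {n : ℕ} {f g : MvPolynomial (Fin n) F}
    (hf : Irreducible f) (hfg : ¬ f ∣ g) {D₁ D₂ : ℕ} (hD₂ : f.totalDegree < D₂)
    (h₁ : 2 * (f.totalDegree * g.totalDegree) < D₁)
    (h₂ : ∀ i, 1 ≤ i → i < n →
      2 * (f.totalDegree * g.totalDegree) * D₂ ^ (i + 1) < D₁ ^ (i + 1)) :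
    kron (lineWeight n D₁ D₂) (genericRes f g) ≠ 0 := by
  have hf0 := totalDegree_ne_zero_of_irreducible hf
  have hn : 0 < n := by
    rcases Nat.eq_zero_or_pos n with rfl | h
    · exact absurd (by rw [totalDegree_eq_zero_iff]; exact fun _ _ i => i.elim0) hf0
    · exact h
  -- The induction starts with one index already replaced. Replacing index 0 by the inductive step
  -- would need `2 deg f deg g D₂ < D₁`, which is not among the hypotheses and fails for `n = r = 1`
  -- and `deg f = deg g = δ`.
  have key : ∀ i, 1 ≤ i → i ≤ n → ∃ ζ : Fin n ⊕ Fin n → F, aeval (hybridPoint (IsBefore i) (lineWeight n D₁ D₂) ζ)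
      (genericRes f g) ≠ 0 := by
    intro i hi
    induction i, hi using Nat.le_induction with
    | base => exact fun _ => exists_hybridPoint_one hn hf hfg hf0 D₁ D₂
    | succ i hi ih =>
      intro hin
      refine exists_hybridPoint_succ hf.ne_zero hf0 hD₂ ⟨i, hin⟩ ?_ (h₂ i hi hin) (ih (by omega))
      rw [pow_succ, mul_comm _ D₁]
      exact Nat.mul_lt_mul_of_pos_right h₁ (by apply Nat.pow_pos; omega)
  obtain ⟨ζ, hζ⟩ := key n hn le_rfl
  have : hybridPoint (IsBefore n) (lineWeight n D₁ D₂) ζ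
      = fun v => Polynomial.X ^ lineWeight n D₁ D₂ v := by
    funext v
    rcases v with j | j <;> simp [hybridPoint, IsBefore]
  rw [this] at hζ
  exact hζ

end Coprime

/-! ### Lattice points in a simplex -/

/-- The points of `ℕ ^ n` with `∑ e_l β_l ≤ N`. -/
def simplex {n : ℕ} (e : Fin n → ℕ) (N : ℕ) : Finset (Fin n → ℕ) :=
  (Fintype.piFinset fun _ => Finset.range (N + 1)).filter fun β => ∑ l, e l * β l ≤ N

theorem mem_simplex {n : ℕ} {e : Fin n → ℕ} (he : ∀ l, 1 ≤ e l) {N : ℕ} {β : Fin n → ℕ} :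
    β ∈ simplex e N ↔ ∑ l, e l * β l ≤ N := by
  rw [simplex, Finset.mem_filter, Fintype.mem_piFinset]
  refine ⟨fun h => h.2, fun h => ⟨fun l => ?_, h⟩⟩
  rw [Finset.mem_range]
  have h1 : e l * β l ≤ ∑ l, e l * β l :=
    Finset.single_le_sum (f := fun l => e l * β l) (fun _ _ => Nat.zero_le _) (Finset.mem_univ l)
  have h2 : 1 * β l ≤ e l * β l := Nat.mul_le_mul_right _ (he l)
  omega

theorem card_simplex_one_le {n : ℕ} (N : ℕ) :
    (simplex (fun _ : Fin n => 1) N).card ≤ (N + 1) ^ n := by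
  refine (Finset.card_filter_le _ _).trans ?_
  simp

/-- Divide the coordinates by the `e l` with remainder: the quotients lie in the weighted simplex,
and there are `∏ e l` possible remainders. -/
theorem card_simplex_one_le_mul {n : ℕ} {e : Fin n → ℕ} (he : ∀ l, 1 ≤ e l) (N : ℕ) :
    (simplex (fun _ : Fin n => 1) N).card ≤ (simplex e N).card * ∏ l, e l := by
  have h1 : (Fintype.piFinset fun l => Finset.range (e l)).card = ∏ l, e l := by simp
  rw [← h1, ← Finset.card_product]
  refine Finset.card_le_card_of_injOn (fun γ => (fun l => γ l / e l, fun l => γ l % e l)) ?_ ?_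
  · intro γ hγ
    rw [Finset.mem_coe, mem_simplex fun _ => le_rfl] at hγ
    rw [Finset.mem_coe, Finset.mem_product, mem_simplex he, Fintype.mem_piFinset]
    refine ⟨le_trans (Finset.sum_le_sum fun l _ => ?_) hγ, fun l => ?_⟩
    · rw [one_mul]
      exact Nat.mul_div_le _ _
    · exact Finset.mem_range.2 (Nat.mod_lt _ (he l))
  · intro γ _ γ' _ h
    funext l
    have h2 := congrFun (congrArg Prod.fst h) l
    have h3 := congrFun (congrArg Prod.snd h) l
    simp only at h2 h3
    rw [← Nat.div_add_mod (γ l) (e l), ← Nat.div_add_mod (γ' l) (e l), h2, h3]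

/-- Otherwise the number `s N` of points of the standard simplex would satisfy `(d + 1) * s N ≤ d *
s (N + d)` and grow exponentially, whereas it is bounded by `(N + 1) ^ n`. -/
theorem exists_card_simplex_lt {n : ℕ} {e : Fin n → ℕ} (he : ∀ l, 1 ≤ e l) :
    ∃ N, (simplex (fun _ : Fin n => 1) (N + ∏ l, e l)).card
      < ((∏ l, e l) + 1) * (simplex e N).card := by
  by_contra! h
  set d := ∏ l, e l with hd
  have hdpos : 0 < d := Finset.prod_pos fun l _ => he l
  let s : ℕ → ℕ := fun N => (simplex (fun _ : Fin n => 1) N).card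
  have h1 : ∀ N, (d + 1) * s N ≤ d * s (N + d) := by
    intro N
    calc (d + 1) * s N ≤ (d + 1) * ((simplex e N).card * d) :=
          Nat.mul_le_mul_left _ (card_simplex_one_le_mul he N)
      _ = d * ((d + 1) * (simplex e N).card) := by ring
      _ ≤ _ := Nat.mul_le_mul_left _ (h N)
  have h2 : ∀ j, (d + 1) ^ j ≤ d ^ j * s (j * d) := by
    intro j
    induction j with
    | zero =>
      simp only [pow_zero, one_mul, zero_mul]
      exact Finset.card_pos.2 ⟨0, (mem_simplex fun _ => le_rfl).2 (by simp)⟩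
    | succ j ih =>
      calc (d + 1) ^ (j + 1) = (d + 1) ^ j * (d + 1) := pow_succ _ _
        _ ≤ d ^ j * s (j * d) * (d + 1) := Nat.mul_le_mul_right _ ih
        _ = d ^ j * ((d + 1) * s (j * d)) := by ring
        _ ≤ d ^ j * (d * s (j * d + d)) := Nat.mul_le_mul_left _ (h1 _)
        _ = d ^ (j + 1) * s ((j + 1) * d) := by rw [pow_succ, Nat.succ_mul]; ring
  have h3 : ∀ j : ℕ, ((d + 1 : ℝ) / d) ^ j ≤ ((j : ℝ) * d + 1) ^ n := by
    intro j
    have h4 : s (j * d) ≤ (j * d + 1) ^ n := card_simplex_one_le _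
    have h5 := (h2 j).trans (Nat.mul_le_mul_left _ h4)
    have hd' : (0 : ℝ) < d := by exact_mod_cast hdpos
    rw [div_pow, div_le_iff₀ (by positivity)]
    have h6 : ((d + 1 : ℝ)) ^ j ≤ d ^ j * ((j : ℝ) * d + 1) ^ n := by exact_mod_cast h5
    linarith
  have hd' : (0 : ℝ) < d := by exact_mod_cast hdpos
  have hlt : 1 < (d + 1 : ℝ) / d := by
    rw [lt_div_iff₀ hd']
    linarith
  have htend := tendsto_pow_const_div_const_pow_of_one_lt n hlt
  have hc : (0 : ℝ) < 1 / (d + 1) ^ n := by positivity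
  obtain ⟨j, hj1, hj2⟩ := ((htend.eventually (gt_mem_nhds hc)).and
    (Filter.eventually_ge_atTop 1)).exists
  have hj3 : (1 : ℝ) ≤ j := by exact_mod_cast hj2
  have h7 : ((j : ℝ) * d + 1) ^ n ≤ (j * (d + 1)) ^ n := by
    apply pow_le_pow_left₀ (by positivity)
    nlinarith
  rw [div_lt_div_iff₀ (by positivity) (by positivity), one_mul, ← mul_pow] at hj1
  exact absurd ((h3 j).trans h7) (not_le.2 hj1)

/-! ### Annihilating polynomials of small degree -/

section Annihilator

variable {n : ℕ} {F : Type*} [Field F]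

/-- For polynomials `b_1, …, b_n` of degrees at most `e_1, …, e_n` in `n` variables, every variable
is a root of a nonzero polynomial of degree at most `∏ e_l` with coefficients in `F[b]`. -/
theorem exists_annihilator {b : Fin n → MvPolynomial (Fin n) F} {e : Fin n → ℕ}
    (he : ∀ l, 1 ≤ e l) (hb : ∀ l, (b l).totalDegree ≤ e l) (i : Fin n) :
    ∃ P : Polynomial (MvPolynomial (Fin n) F), P ≠ 0 ∧ P.natDegree ≤ ∏ l, e l ∧
      P.eval₂ (aeval (R := F) b).toRingHom (X i) = 0 := by
  classical
  obtain ⟨N, hN⟩ := exists_card_simplex_lt he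
  set d := ∏ l, e l with hd
  -- `K` indexes the products `b ^ β * X_i ^ j` with `j ≤ d` and `∑ e_l β_l ≤ N`. They have degree
  -- at most `N + d` and, by the choice of `N`, outnumber the monomials of that degree, so they are
  -- linearly dependent.
  let K := Finset.range (d + 1) ×ˢ simplex e N
  let S := simplex (fun _ : Fin n => 1) (N + d)
  let u : ℕ × (Fin n → ℕ) → MvPolynomial (Fin n) F := fun x => (∏ l, b l ^ x.2 l) * X i ^ x.1
  let Φ : (K → F) →ₗ[F] (S → F) :=
    { toFun := fun c γ => ∑ x : K, c x * coeff (Finsupp.equivFunOnFinite.symm γ.1) (u x.1)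
      map_add' := fun c c' => by
        funext γ
        simp [add_mul, Finset.sum_add_distrib]
      map_smul' := fun a c => by
        funext γ
        simp [mul_assoc, Finset.mul_sum] }
  have hker : LinearMap.ker Φ ≠ ⊥ := by
    apply LinearMap.ker_ne_bot_of_finrank_lt
    simp only [Module.finrank_fintype_fun_eq_card, Fintype.card_coe]
    simpa [K, S, Finset.card_product] using hN
  obtain ⟨c, hc, hc0⟩ := Submodule.exists_mem_ne_zero_of_ne_bot hker
  have hu : ∀ x ∈ K, (u x).totalDegree ≤ N + d := by
    intro x hx
    rw [Finset.mem_product, Finset.mem_range, mem_simplex he] at hx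
    refine (totalDegree_mul _ _).trans (Nat.add_le_add ?_ ?_)
    · refine (totalDegree_finsetProd _ _).trans (le_trans (Finset.sum_le_sum fun l _ => ?_) hx.2)
      refine (totalDegree_pow _ _).trans ?_
      rw [mul_comm]
      exact Nat.mul_le_mul_right _ (hb l)
    · refine (totalDegree_pow _ _).trans ?_
      rw [totalDegree_X]
      omega
  have hsum : ∑ x : K, C (c x) * u x.1 = 0 := by
    ext m
    rw [coeff_sum, coeff_zero]
    simp only [coeff_C_mul]
    by_cases hm : (⇑m : Fin n → ℕ) ∈ S
    · have h1 := congrFun (LinearMap.mem_ker.1 hc) ⟨m, hm⟩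
      have h2 : Finsupp.equivFunOnFinite.symm (⇑m : Fin n → ℕ) = m :=
        Finsupp.equivFunOnFinite.symm_apply_apply m
      simpa [Φ, h2] using h1
    · refine Finset.sum_eq_zero fun x _ => ?_
      rw [coeff_eq_zero_of_totalDegree_lt, mul_zero]
      rw [mem_simplex fun _ => le_rfl] at hm
      have h1 := hu x.1 x.2
      have h2 : ∑ l ∈ m.support, m l = ∑ l, m l :=
        Finset.sum_subset (Finset.subset_univ _) fun l _ hl => by simpa using hl
      simp only [one_mul] at hm
      omega
  let P : Polynomial (MvPolynomial (Fin n) F) :=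
    ∑ x : K, Polynomial.monomial x.1.1 (monomial (Finsupp.equivFunOnFinite.symm x.1.2) (c x))
  refine ⟨P, ?_, ?_, ?_⟩
  · intro hP
    apply hc0
    funext x
    have h1 := congrArg (fun Q => coeff (Finsupp.equivFunOnFinite.symm x.1.2)
      (Q.coeff x.1.1)) hP
    simp only [P, Polynomial.finsetSum_coeff, Polynomial.coeff_zero, coeff_zero,
      Polynomial.coeff_monomial, coeff_sum] at h1
    rw [Finset.sum_eq_single x] at h1
    · simpa using h1
    · intro y _ hy
      split_ifs with h
      · rw [coeff_monomial, if_neg]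
        intro h2
        apply hy
        apply Subtype.ext
        exact Prod.ext h (Finsupp.equivFunOnFinite.symm.injective h2)
      · simp
    · simp
  · refine Polynomial.natDegree_sum_le_of_forall_le _ _ fun x _ => ?_
    refine (Polynomial.natDegree_monomial_le _).trans ?_
    have := x.2
    rw [Finset.mem_product, Finset.mem_range] at this
    omega
  · rw [← hsum, Polynomial.eval₂_finsetSum]
    refine Finset.sum_congr rfl fun x _ => ?_
    rw [Polynomial.eval₂_monomial]
    simp only [u, AlgHom.toRingHom_eq_coe, RingHom.coe_coe]
    rw [aeval_monomial, Finsupp.prod_fintype _ _ (by simp)]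
    simp only [algebraMap_eq, Finsupp.equivFunOnFinite_symm_apply_apply, mul_assoc]

end Annihilator

/-! ### The Jacobian criterion -/

section Jacobian

variable {F : Type*} [Field F] {m n : ℕ}

/-- An algebraically independent family extends by variables to a transcendence basis. -/
theorem exists_basis_extension {f : Fin m → MvPolynomial (Fin n) F}
    (hf : AlgebraicIndependent F f) {δ : ℕ} (hδ : 1 ≤ δ) (hd : ∀ a, (f a).totalDegree ≤ δ) :
    ∃ (b : Fin n → MvPolynomial (Fin n) F) (e : Fin n → ℕ) (ι : Fin m → Fin n),
      AlgebraicIndependent F b ∧ (∀ l, 1 ≤ e l) ∧ (∀ l, (b l).totalDegree ≤ e l) ∧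
      ∏ l, e l ≤ δ ^ m ∧ Function.Injective ι ∧ ∀ a, b (ι a) = f a := by
  classical
  have hX : Algebra.adjoin F (Set.range f ∪ Set.range (X : Fin n → MvPolynomial (Fin n) F)) = ⊤ := by
    rw [eq_top_iff, ← adjoin_range_X]
    exact Algebra.adjoin_mono Set.subset_union_right
  have : Algebra.IsAlgebraic
      (Algebra.adjoin F (Set.range f ∪ Set.range (X : Fin n → MvPolynomial (Fin n) F)))
      (MvPolynomial (Fin n) F) := by
    refine ⟨fun x => isAlgebraic_algebraMap (⟨x, ?_⟩ : Algebra.adjoin F _)⟩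
    rw [hX]
    exact Algebra.mem_top
  obtain ⟨u, hu1, hu2, hu⟩ := exists_isTranscendenceBasis_between (Set.range f)
    (Set.range f ∪ Set.range (X : Fin n → MvPolynomial (Fin n) F)) Set.subset_union_left
    hf.to_subtype_range
  have hcard := hu.lift_cardinalMk_eq (IsTranscendenceBasis.mvPolynomial (Fin n) F)
  have hcard' : Cardinal.mk u = n := by
    simpa using hcard
  have hfin : Finite u := Cardinal.lt_aleph0_iff_finite.1 (hcard' ▸ Cardinal.natCast_lt_aleph0)
  have hn : Nat.card u = n := by
    rw [Nat.card, hcard', Cardinal.toNat_natCast]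
  let ε : u ≃ Fin n := Finite.equivFinOfCardEq hn
  let ι : Fin m → Fin n := fun a => ε ⟨f a, hu1 ⟨a, rfl⟩⟩
  have hι : Function.Injective ι := fun a a' h =>
    hf.injective (Subtype.mk.inj (ε.injective h))
  -- Members coming from `f` get the bound `δ`, added variables the bound 1. So the product does not
  -- depend on `n`.
  refine ⟨fun l => (ε.symm l).1, fun l => if l ∈ Finset.univ.image ι then δ else 1, ι,
    hu.1.comp _ ε.symm.injective, fun l => ?_, fun l => ?_, ?_, hι, fun a => ?_⟩
  · beta_reduce
    split_ifs
    exacts [hδ, le_rfl]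
  · beta_reduce
    rcases hu2 (ε.symm l).2 with ⟨a, ha⟩ | ⟨i, hi⟩
    · have : l ∈ Finset.univ.image ι := by
        refine Finset.mem_image.2 ⟨a, Finset.mem_univ _, ?_⟩
        simp only [ι, ha, Subtype.coe_eta, Equiv.apply_symm_apply]
      rw [if_pos this, ← ha]
      exact hd a
    · rw [← hi, totalDegree_X]
      split_ifs
      exacts [hδ, le_rfl]
  · rw [Finset.prod_ite_mem, Finset.univ_inter, Finset.prod_const,
      Finset.card_image_of_injective _ hι]
    simp
  · simp [ι]

/-- A derivation that kills a transcendence basis kills everything, if the characteristic is zero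
or large enough. -/
theorem derivation_eq_zero {b : Fin n → MvPolynomial (Fin n) F} (hb : AlgebraicIndependent F b)
    {e : Fin n → ℕ} (he : ∀ l, 1 ≤ e l) (hd : ∀ l, (b l).totalDegree ≤ e l)
    (hchar : ringChar F = 0 ∨ ∏ l, e l < ringChar F)
    (D : Derivation F (MvPolynomial (Fin n) F) (MvPolynomial (Fin n) F)) (hD : ∀ l, D (b l) = 0)
    (i : Fin n) : D (X i) = 0 := by
  classical
  -- Take an annihilator `P` of `X i` over `F[b]` of least degree. Its degree is positive and at
  -- most `∏ e l`, so its derivative is nonzero by `hchar`, and `P'(X i) ≠ 0` by minimality.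
  -- Applying `D` to `P(X i) = 0` gives `P'(X i) * D (X i) = 0`.
  have hex : ∃ N, ∃ P : Polynomial (MvPolynomial (Fin n) F), P ≠ 0 ∧ P.natDegree = N ∧
      P.eval₂ (aeval (R := F) b).toRingHom (X i) = 0 := by
    obtain ⟨P, h1, -, h3⟩ := exists_annihilator he hd i
    exact ⟨_, P, h1, rfl, h3⟩
  obtain ⟨P, hP0, hPd, hP⟩ := Nat.find_spec hex
  have hle : P.natDegree ≤ ∏ l, e l := by
    obtain ⟨Q, h1, h2, h3⟩ := exists_annihilator he hd i
    rw [hPd]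
    exact (Nat.find_min' hex ⟨Q, h1, rfl, h3⟩).trans h2
  have hinj : Function.Injective (aeval (R := F) b).toRingHom := hb
  have hpos : P.natDegree ≠ 0 := by
    intro h0
    rw [Polynomial.eq_C_of_natDegree_eq_zero h0, Polynomial.eval₂_C] at hP
    apply hP0
    rw [Polynomial.eq_C_of_natDegree_eq_zero h0, hinj (hP.trans (map_zero _).symm), map_zero]
  have hder : P.derivative ≠ 0 := by
    intro h0
    have h1 : P.derivative.coeff (P.natDegree - 1) = 0 := by rw [h0, Polynomial.coeff_zero]
    rw [Polynomial.coeff_derivative, Nat.sub_add_cancel (Nat.pos_of_ne_zero hpos),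
      Polynomial.coeff_natDegree, mul_eq_zero, Polynomial.leadingCoeff_eq_zero,
      or_iff_right hP0] at h1
    have h2 : ((P.natDegree : ℕ) : MvPolynomial (Fin n) F) = 0 := by
      have : ((P.natDegree - 1 + 1 : ℕ) : MvPolynomial (Fin n) F) = 0 := by exact_mod_cast h1
      rwa [Nat.sub_add_cancel (Nat.pos_of_ne_zero hpos)] at this
    have h3 : ((P.natDegree : ℕ) : F) = 0 := by
      apply C_injective (Fin n) F
      rw [map_natCast, h2, map_zero]
    have h4 : ringChar F ∣ P.natDegree := (ringChar.spec F _).1 h3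
    rcases hchar with h | h
    · rw [h, zero_dvd_iff] at h4
      exact hpos h4
    · exact absurd (Nat.le_of_dvd (Nat.pos_of_ne_zero hpos) h4) (by omega)
  have hval : P.derivative.eval₂ (aeval (R := F) b).toRingHom (X i) ≠ 0 := by
    intro h0
    refine Nat.find_min hex (m := P.derivative.natDegree) ?_ ⟨_, hder, rfl, h0⟩
    rw [← hPd]
    exact Polynomial.natDegree_derivative_lt hpos
  have hzero : ∀ u : MvPolynomial (Fin n) F, D (aeval b u) = 0 := by
    intro u
    induction u using MvPolynomial.induction_on with
    | C a => rw [aeval_C, Derivation.map_algebraMap]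
    | add p q hp hq => rw [map_add, map_add, hp, hq, add_zero]
    | mul_X p j hp => rw [map_mul, aeval_X, Derivation.leibniz, hp, hD]; simp
  have hchain : ∀ Q : Polynomial (MvPolynomial (Fin n) F),
      D (Q.eval₂ (aeval (R := F) b).toRingHom (X i)) =
        Q.derivative.eval₂ (aeval (R := F) b).toRingHom (X i) * D (X i) := by
    intro Q
    induction Q using Polynomial.induction_on' with
    | add p q hp hq =>
      rw [Polynomial.eval₂_add, map_add, hp, hq, Polynomial.derivative_add, Polynomial.eval₂_add,
        add_mul]
    | monomial k a =>
      have h0 : D ((aeval (R := F) b).toRingHom a) = 0 := hzero a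
      rw [Polynomial.eval₂_monomial, Derivation.leibniz, h0, Derivation.leibniz_pow,
        Polynomial.derivative_monomial, Polynomial.eval₂_monomial]
      simp only [map_mul, map_natCast, smul_eq_mul, nsmul_eq_mul]
      ring
  have := hchain P
  rw [hP, map_zero] at this
  exact (mul_eq_zero.1 this.symm).resolve_left hval

/-- Multilinearity in the columns of the product. This is Cauchy–Binet before sorting: all maps `h`
occur, and those that are not injective contribute zero minors. -/
theorem det_mul_eq_sum {R : Type*} [CommRing R] (A : Matrix (Fin m) (Fin n) R)
    (W : Matrix (Fin n) (Fin m) R) :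
    (A * W).det = ∑ h : Fin m → Fin n, (∏ b, W (h b) b) * (A.submatrix id h).det := by
  classical
  have h1 : (A * W).transpose = fun b => ∑ i, W i b • A.transpose i := by
    ext b a
    simp [Matrix.mul_apply, Finset.sum_apply, mul_comm]
  have h2 : (A * W).transpose.det =
      (Matrix.detRowAlternating (n := Fin m) (R := R)).toMultilinearMap
        (fun b => ∑ i, W i b • A.transpose i) := by
    rw [h1]
    rfl
  rw [← Matrix.det_transpose, h2, MultilinearMap.map_sum]
  refine Finset.sum_congr rfl fun h _ => ?_
  rw [MultilinearMap.map_smul_univ, smul_eq_mul, ← Matrix.det_transpose (A.submatrix id h)]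
  rfl

/-- The Jacobian matrix of algebraically independent polynomials has a nonzero maximal minor, if
the characteristic is zero or large enough. -/
theorem exists_jacobian_minor_ne_zero {f : Fin m → MvPolynomial (Fin n) F}
    (hf : AlgebraicIndependent F f) {δ : ℕ} (hδ : 1 ≤ δ) (hd : ∀ a, (f a).totalDegree ≤ δ)
    (hchar : ringChar F = 0 ∨ δ ^ m < ringChar F) :
    ∃ h : Fin m → Fin n, (Matrix.of fun a b => pderiv (h b) (f a)).det ≠ 0 := by
  classical
  obtain ⟨b, e, ι, hb, he, hbe, hprod, hι, hbf⟩ := exists_basis_extension hf hδ hd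
  let J : Matrix (Fin n) (Fin n) (MvPolynomial (Fin n) F) := Matrix.of fun l i => pderiv i (b l)
  have hJ : J.det ≠ 0 := by
    intro h0
    -- A kernel vector `v` is a derivation `∑ v i ∂_i` killing the transcendence basis, hence every
    -- variable, so that `v = 0`.
    obtain ⟨v, hv, hJv⟩ := Matrix.exists_mulVec_eq_zero_iff.2 h0
    apply hv
    let D : Derivation F (MvPolynomial (Fin n) F) (MvPolynomial (Fin n) F) :=
      ∑ i, v i • pderiv i
    have hDa : ∀ u, D u = ∑ i, v i * pderiv i u := by
      intro u
      simp only [D, ← Derivation.coeFnAddMonoidHom_apply, map_sum, Finset.sum_apply]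
      rfl
    have hD : ∀ l, D (b l) = 0 := by
      intro l
      have := congrFun hJv l
      rw [Pi.zero_apply] at this
      rw [hDa, ← this]
      exact Finset.sum_congr rfl fun i _ => mul_comm _ _
    funext i
    have := derivation_eq_zero hb he hbe (hchar.imp id fun h => hprod.trans_lt h) D hD i
    rw [hDa, Finset.sum_eq_single i (fun j _ hj => by rw [pderiv_X_of_ne hj.symm, mul_zero])
      (by simp), pderiv_X_self, mul_one] at this
    exact this
  let Q := FractionRing (MvPolynomial (Fin n) F)
  let JQ : Matrix (Fin n) (Fin n) Q := J.map (algebraMap _ Q)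
  have hJQ : IsUnit JQ.det := by
    have : JQ.det = algebraMap _ Q J.det := (RingHom.map_det (algebraMap _ Q) J).symm
    rw [this, isUnit_iff_ne_zero]
    exact fun h0 => hJ (IsFractionRing.injective _ Q (h0.trans (map_zero _).symm))
  -- The rows of `J` belonging to `f` times the matching columns of the inverse form an identity
  -- matrix. Expanding its determinant exhibits a nonzero minor among the rows of `f`.
  have hone : (JQ.submatrix ι id * JQ⁻¹.submatrix id ι).det = 1 := by
    rw [← Matrix.submatrix_mul _ _ _ _ _ Function.bijective_id, Matrix.mul_nonsing_inv _ hJQ,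
      Matrix.submatrix_one _ hι, Matrix.det_one]
  rw [det_mul_eq_sum] at hone
  obtain ⟨h, -, hh⟩ := Finset.exists_ne_zero_of_sum_ne_zero (hone.symm ▸ one_ne_zero)
  refine ⟨h, fun h0 => right_ne_zero_of_mul hh ?_⟩
  have : (JQ.submatrix ι id).submatrix id h =
      (algebraMap _ Q).mapMatrix (Matrix.of fun a b => pderiv (h b) (f a)) := by
    ext a c
    simp [JQ, J, hbf]
  rw [this, ← RingHom.map_det, h0, map_zero]

end Jacobian

/-! ### Nonvanishing of the Jacobian determinant at the prescribed parameters -/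

section Parameters

variable {F : Type*} [Field F]

theorem kron_rename {σ τ : Type*} (g : σ → τ) (w : τ → ℕ) (P : MvPolynomial σ F) :
    kron w (rename g P) = kron (w ∘ g) P := by
  rw [kron, aeval_rename]
  rfl

theorem kron_mul_left {σ : Type*} (D : ℕ) (w : σ → ℕ) (P : MvPolynomial σ F) :
    kron (fun i => D * w i) P = Polynomial.expand F D (kron w P) := by
  have : kron (fun i => D * w i) = ((Polynomial.expand F D).comp (kron (F := F) w)) := by
    refine algHom_ext fun i => ?_
    simp [kron, pow_mul]
  rw [this]
  rfl

theorem totalDegree_pderiv_le {σ : Type*} (i : σ) (P : MvPolynomial σ F) :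
    (pderiv i P).totalDegree ≤ P.totalDegree - 1 := by
  rw [totalDegree, Finset.sup_le_iff]
  intro m hm
  rw [mem_support_iff, coeff_pderiv] at hm
  have h1 : m + Finsupp.single i 1 ∈ P.support := mem_support_iff.2 (left_ne_zero_of_mul hm)
  have h2 := le_totalDegree h1
  rw [Finsupp.sum_add_index' (fun _ => rfl) (fun _ _ _ => rfl), Finsupp.sum_single_index rfl] at h2
  omega

theorem totalDegree_det_le {σ : Type*} {m : ℕ} (A : Matrix (Fin m) (Fin m) (MvPolynomial σ F))
    {d : ℕ} (h : ∀ a b, (A a b).totalDegree ≤ d) : A.det.totalDegree ≤ m * d := by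
  rw [Matrix.det_apply]
  refine totalDegree_finsetSum_le fun p _ => ?_
  have h1 : (∏ i, A (p i) i).totalDegree ≤ m * d := by
    refine (totalDegree_finsetProd _ _).trans ?_
    refine (Finset.sum_le_sum fun i _ => h (p i) i).trans ?_
    simp
  rcases Int.units_eq_one_or (Equiv.Perm.sign p) with hs | hs <;> rw [hs]
  · simpa using h1
  · simpa using h1

/-- The indices of the parameters: base points, directions, and the remaining coefficients. -/
abbrev Param (n r : ℕ) : Type := Fin n ⊕ Fin n ⊕ (Fin n × Fin r)

/-- The exponents of `c` in the parameters. -/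
def paramWeight (n r D₁ D₂ : ℕ) : Param n r → ℕ :=
  Sum.elim (fun i => D₁ ^ (i.val + 1)) (Sum.elim (fun i => D₂ ^ (i.val + 1))
    fun x => (x.1.val + 1) * (n + 1) ^ (x.2.val + 1))

/-- The determinant of the product of the Jacobian matrix of `f` at the base point and the matrix
of the remaining coefficients. -/
noncomputable def genericJac {m n r : ℕ} (hm : m ≤ r) (f : Fin m → MvPolynomial (Fin n) F) :
    MvPolynomial (Param n r) F :=
  ((Matrix.of fun a i => rename Sum.inl (pderiv i (f a)) :
      Matrix (Fin m) (Fin n) (MvPolynomial (Param n r) F)) *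
    (Matrix.of fun i b => X (Sum.inr (Sum.inr (i, Fin.castLE hm b))) :
      Matrix (Fin n) (Fin m) (MvPolynomial (Param n r) F))).det

theorem totalDegree_genericJac_le {m n r : ℕ} (hm : m ≤ r) {f : Fin m → MvPolynomial (Fin n) F}
    {δ : ℕ} (hδ : 1 ≤ δ) (hd : ∀ a, (f a).totalDegree ≤ δ) :
    (genericJac hm f).totalDegree ≤ m * δ := by
  refine totalDegree_det_le _ fun a b => ?_
  rw [Matrix.mul_apply]
  refine totalDegree_finsetSum_le fun i _ => (totalDegree_mul _ _).trans ?_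
  rw [Matrix.of_apply, Matrix.of_apply, totalDegree_X]
  have h1 := (totalDegree_rename_le (Sum.inl : Fin n → Param n r) (pderiv i (f a))).trans
    (totalDegree_pderiv_le i (f a))
  have h2 := hd a
  omega

theorem sum_digits_lt {n : ℕ} : ∀ {m : ℕ} (c : Fin m → ℕ), (∀ b, c b ≤ n) →
    ∑ b, c b * (n + 1) ^ (b.val + 1) < (n + 1) ^ (m + 1)
  | 0, c, _ => by simp
  | m + 1, c, hc => by
    rw [Fin.sum_univ_castSucc]
    have h1 := sum_digits_lt (fun b => c (Fin.castSucc b)) fun b => hc _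
    have h2 : c (Fin.last m) * (n + 1) ^ (m + 1) ≤ n * (n + 1) ^ (m + 1) :=
      Nat.mul_le_mul_right _ (hc _)
    simp only [Fin.val_castSucc, Fin.val_last]
    rw [pow_succ _ (m + 1)]
    linarith

theorem digits_injective {n m : ℕ} {c c' : Fin m → ℕ} (hc : ∀ b, c b ≤ n) (hc' : ∀ b, c' b ≤ n)
    (h : ∑ b, c b * (n + 1) ^ (b.val + 1) = ∑ b, c' b * (n + 1) ^ (b.val + 1)) : c = c' := by
  have key := weight_pow_injective (D := n + 1) (m := Finsupp.equivFunOnFinite.symm c)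
    (m' := Finsupp.equivFunOnFinite.symm c') (fun b => Nat.lt_succ_of_le (hc b))
    (fun b => Nat.lt_succ_of_le (hc' b)) ?_
  · exact Finsupp.equivFunOnFinite.symm.injective key
  · rw [Finsupp.weight_apply, Finsupp.weight_apply, Finsupp.sum_fintype _ _ (by simp),
      Finsupp.sum_fintype _ _ (by simp)]
    exact h

/-- The determinant expands into a sum over `h` of `t ^ E h` times the minor `h` at the base point.
All exponents in the minors are multiples of `D₁`, while the `E h` are smaller than `D₁` and
pairwise different, having the base-`(n + 1)` digits `h b + 1`. So the terms occupy different
residue classes modulo `D₁`, and the nonzero minor of the Jacobian criterion survives. -/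
theorem kron_genericJac_ne_zero {m n r : ℕ} (hm : m ≤ r) {f : Fin m → MvPolynomial (Fin n) F}
    (hf : AlgebraicIndependent F f) {δ : ℕ} (hδ : 1 ≤ δ) (hd : ∀ a, (f a).totalDegree ≤ δ)
    (hchar : ringChar F = 0 ∨ δ ^ m < ringChar F) {D₁ D₂ : ℕ} (h₁ : m * δ < D₁)
    (h₂ : (n + 1) ^ (m + 1) ≤ D₁) :
    kron (paramWeight n r D₁ D₂) (genericJac hm f) ≠ 0 := by
  classical
  obtain ⟨h₀, hh₀⟩ := exists_jacobian_minor_ne_zero hf hδ hd hchar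
  have hD : 0 < D₁ := by omega
  let minor : (Fin m → Fin n) → MvPolynomial (Fin n) F :=
    fun h => (Matrix.of fun a b => pderiv (h b) (f a)).det
  let E : (Fin m → Fin n) → ℕ := fun h => ∑ b, ((h b).val + 1) * (n + 1) ^ (b.val + 1)
  let p : (Fin m → Fin n) → Polynomial F := fun h => kron (fun i : Fin n => D₁ ^ i.val) (minor h)
  have hexp : ∀ h, kron (fun i : Fin n => D₁ ^ (i.val + 1)) (minor h) =
      Polynomial.expand F D₁ (p h) := by
    intro h
    rw [← kron_mul_left]
    simp only [pow_succ']
  have hp : p h₀ ≠ 0 := by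
    intro h0
    refine kron_pow_ne_zero (D := D₁) hh₀ ?_ ((hexp h₀).trans (by rw [h0, map_zero]))
    refine (totalDegree_det_le _ (d := δ) fun a b => ?_).trans_lt h₁
    exact (totalDegree_pderiv_le _ _).trans ((Nat.sub_le _ _).trans (hd a))
  have hG : kron (paramWeight n r D₁ D₂) (genericJac hm f) =
      ∑ h, Polynomial.X ^ E h * Polynomial.expand F D₁ (p h) := by
    rw [genericJac, det_mul_eq_sum, map_sum]
    refine Finset.sum_congr rfl fun h _ => ?_
    rw [map_mul, map_prod]
    congr 1
    · rw [← Finset.prod_pow_eq_pow_sum]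
      refine Finset.prod_congr rfl fun b _ => ?_
      rw [Matrix.of_apply, kron, aeval_X]
      rfl
    · rw [← hexp]
      have : (Matrix.of fun a i => rename (Sum.inl : Fin n → Param n r)
          (pderiv i (f a))).submatrix id h =
          (rename (R := F) (Sum.inl : Fin n → Param n r)).toRingHom.mapMatrix
            (Matrix.of fun a b => pderiv (h b) (f a)) := by
        ext a b
        simp
      rw [this, ← RingHom.map_det]
      exact kron_rename _ _ _
  have hElt : ∀ h, E h < D₁ := fun h =>
    (sum_digits_lt (fun b => (h b).val + 1) fun b => (h b).2).trans_le h₂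
  have hEinj : ∀ h h', E h = E h' → h = h' := by
    intro h h' hE
    have := digits_injective (n := n) (c := fun b => (h b).val + 1)
      (c' := fun b => (h' b).val + 1) (fun b => (h b).2) (fun b => (h' b).2) hE
    funext b
    have h1 := congrFun this b
    exact Fin.ext (by simpa using h1)
  intro h0
  obtain ⟨l, hl⟩ : ∃ l, (p h₀).coeff l ≠ 0 := by
    by_contra! hc
    exact hp (Polynomial.ext fun l => by rw [hc l, Polynomial.coeff_zero])
  have h3 := congrArg (fun P => P.coeff (l * D₁ + E h₀)) (hG.symm.trans h0)
  simp only [Polynomial.finsetSum_coeff, Polynomial.coeff_zero, Polynomial.coeff_X_pow_mul'] at h3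
  rw [Finset.sum_eq_single h₀, if_pos (Nat.le_add_left _ _), Nat.add_sub_cancel,
    Polynomial.coeff_expand_mul hD] at h3
  · exact hl h3
  · intro h _ hne
    split_ifs with hle
    · rw [Polynomial.coeff_expand hD, if_neg]
      rintro ⟨q, hq⟩
      apply hne
      apply hEinj
      have h4 : l * D₁ + E h₀ = E h + D₁ * q := by omega
      have h5 := congrArg (· % D₁) h4
      simp only [Nat.add_mul_mod_self_left, Nat.mul_add_mod_self_right] at h5
      rw [Nat.mod_eq_of_lt (hElt _), Nat.mod_eq_of_lt (hElt _)] at h5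
      exact h5.symm
    · rfl
  · intro h
    exact absurd (Finset.mem_univ _) h

end Parameters

/-! ### Linear substitutions that preserve algebraic independence -/

section Substitution

variable {F : Type*} [Field F]

theorem exists_line_eq {n : ℕ} (a v : Fin n → F) (f : MvPolynomial (Fin n) F) :
    ∃ q : Polynomial F, line a v f = Polynomial.C (aeval a f) +
      Polynomial.C (∑ i, v i * aeval a (pderiv i f)) * Polynomial.X + Polynomial.X ^ 2 * q := by
  induction f using MvPolynomial.induction_on with
  | C c =>
    refine ⟨0, ?_⟩
    simp [line, ← algebraMap_eq]
  | add p q hp hq =>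
    obtain ⟨p', hp⟩ := hp
    obtain ⟨q', hq⟩ := hq
    refine ⟨p' + q', ?_⟩
    rw [line] at *
    simp only [map_add, mul_add, Finset.sum_add_distrib]
    rw [hp, hq]
    ring
  | mul_X p i hp =>
    obtain ⟨p', hp⟩ := hp
    have h1 : ∑ j, v j * aeval a (pderiv j (p * X i)) =
        v i * aeval a p + (∑ j, v j * aeval a (pderiv j p)) * a i := by
      have h2 : ∀ j, v j * aeval a (pderiv j (p * X i)) =
          (if i = j then v j * aeval a p else 0) + v j * aeval a (pderiv j p) * a i := by
        intro j
        rw [Derivation.leibniz, smul_eq_mul, smul_eq_mul, map_add, map_mul, map_mul, aeval_X]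
        split_ifs with h
        · rw [h, pderiv_X_self, map_one]
          ring
        · rw [pderiv_X_of_ne h, map_zero]
          ring
      simp only [h2, Finset.sum_add_distrib, Finset.sum_mul, Finset.sum_ite_eq, Finset.mem_univ,
        if_true]
    rw [h1]
    refine ⟨Polynomial.C (∑ j, v j * aeval a (pderiv j p)) * Polynomial.C (v i) +
      p' * Polynomial.C (a i) + p' * Polynomial.C (v i) * Polynomial.X, ?_⟩
    rw [line] at *
    rw [map_mul, map_mul, hp, aeval_X, aeval_X]
    simp only [map_add, map_mul]
    ring

/-- If there are homomorphisms to a univariate polynomial ring that prescribe the linear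
coefficients of the `g a` arbitrarily, while their constant coefficients stay fixed, then the `g a`
are algebraically independent. -/
theorem algebraicIndependent_of_linear_coeff [Infinite F] {R : Type*} [CommRing R] [Algebra F R]
    {m : ℕ} {g : Fin m → R} (c : Fin m → F)
    (H : ∀ y : Fin m → F, ∃ ψ : R →ₐ[F] Polynomial F, ∀ a, ∃ q : Polynomial F,
      ψ (g a) = Polynomial.C (c a) + Polynomial.X * (Polynomial.C (y a) + Polynomial.X * q)) :
    AlgebraicIndependent F g := by
  classical
  rw [algebraicIndependent_iff]
  intro P hP
  by_contra hP0
  -- `P` is translated so that the constant coefficients become zero. If `d₀` is the lowest degree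
  -- of a nonzero component of `P'`, then the coefficient of degree `d₀` in the image of the
  -- relation is that component at `y`; so `y` is chosen outside its zero set.
  let P' : MvPolynomial (Fin m) F := aeval (fun a => X a + C (c a)) P
  have hPP' : aeval (fun a => X a - C (c a)) P' = P := by
    have : (aeval (R := F) (fun a : Fin m => (X a - C (c a) : MvPolynomial (Fin m) F))).comp
        (aeval fun a => X a + C (c a)) = AlgHom.id F _ := by
      ext a
      simp [← algebraMap_eq]
    exact DFunLike.congr_fun this P
  have hP'0 : P' ≠ 0 := by
    intro h
    rw [h, map_zero] at hPP'
    exact hP0 hPP'.symm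
  have hex : ∃ d, homogeneousComponent d P' ≠ 0 := by
    by_contra! h
    apply hP'0
    rw [← sum_homogeneousComponent P']
    exact Finset.sum_eq_zero fun d _ => h d
  let d₀ := Nat.find hex
  obtain ⟨y, hy⟩ := exists_eval_ne_zero (Nat.find_spec hex)
  obtain ⟨ψ, hψ⟩ := H y
  choose q hq using hψ
  let s : Fin m → Polynomial F := fun a => Polynomial.C (y a) + Polynomial.X * q a
  have h1 : aeval (fun a => Polynomial.X * s a) P' = 0 := by
    have h2 : ψ (aeval g P) = 0 := by rw [hP, map_zero]
    rw [← h2, ← AlgHom.comp_apply ψ, comp_aeval]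
    have h3 : (aeval (R := F) (fun a => Polynomial.X * s a)).comp
        (aeval fun a : Fin m => (X a + C (c a) : MvPolynomial (Fin m) F)) =
        aeval fun a => ψ (g a) := by
      refine algHom_ext fun a => ?_
      simp only [AlgHom.comp_apply, aeval_X, map_add, hq, ← algebraMap_eq, AlgHom.commutes, s]
      rw [add_comm]
      rfl
    exact DFunLike.congr_fun h3 P
  rw [← sum_homogeneousComponent P', map_sum] at h1
  have h4 := congrArg (fun u => u.coeff d₀) h1
  simp only [Polynomial.finsetSum_coeff, Polynomial.coeff_zero] at h4
  have hd₀ : d₀ < P'.totalDegree + 1 := by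
    by_contra h
    exact Nat.find_spec hex (homogeneousComponent_eq_zero _ _ (by omega))
  rw [Finset.sum_eq_single_of_mem d₀ (Finset.mem_range.2 hd₀)] at h4
  · rw [aeval_smul_of_isHomogeneous (homogeneousComponent_isHomogeneous _ _),
      Polynomial.coeff_X_pow_mul', if_pos le_rfl, Nat.sub_self, Polynomial.coeff_zero_eq_eval_zero]
      at h4
    apply hy
    have h5 : (Polynomial.aeval (R := F) (0 : F)).comp (aeval s) = aeval y := by
      ext a
      simp [s]
    have h6 := DFunLike.congr_fun h5 (homogeneousComponent d₀ P')
    rw [AlgHom.comp_apply, Polynomial.coe_aeval_eq_eval, h4] at h6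
    exact h6.symm
  · intro d _ hne
    rw [aeval_smul_of_isHomogeneous (homogeneousComponent_isHomogeneous _ _),
      Polynomial.coeff_X_pow_mul']
    split_ifs with hle
    · have h7 : homogeneousComponent d P' = 0 := by
        by_contra h
        exact Nat.find_min hex (lt_of_le_of_ne hle hne) h
      rw [h7, map_zero, Polynomial.coeff_zero]
    · rfl

variable {n r : ℕ}

/-- The linear substitution with given parameters. -/
noncomputable def subst (Θ : Param n r → F) :
    MvPolynomial (Fin n) F →ₐ[F] MvPolynomial (Fin (r + 1)) F :=
  aeval fun i => C (Θ (Sum.inl i)) + C (Θ (Sum.inr (Sum.inl i))) * X 0 +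
    ∑ j : Fin r, C (Θ (Sum.inr (Sum.inr (i, j)))) * X j.succ

/-- Setting `z_0 = 0` and the other `z_j` to multiples of one variable turns the images into
restrictions of the `f a` to a line through the base point. Their linear coefficients are `J * B`
applied to the chosen multiples, hence arbitrary, since `J * B` is invertible. No assumption on the
characteristic is needed in this direction. -/
theorem algebraicIndependent_subst [Infinite F] {m : ℕ} (hm : m ≤ r)
    {f : Fin m → MvPolynomial (Fin n) F} {Θ : Param n r → F}
    (h : aeval Θ (genericJac hm f) ≠ 0) :
    AlgebraicIndependent F fun a => subst Θ (f a) := by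
  classical
  let A : Fin n → F := fun i => Θ (Sum.inl i)
  let J : Matrix (Fin m) (Fin n) F := Matrix.of fun a i => aeval A (pderiv i (f a))
  let B : Matrix (Fin n) (Fin m) F :=
    Matrix.of fun i b => Θ (Sum.inr (Sum.inr (i, Fin.castLE hm b)))
  have hdet : aeval Θ (genericJac hm f) = (J * B).det := by
    rw [genericJac, ← AlgHom.coe_toRingHom, RingHom.map_det, RingHom.mapMatrix_apply,
      Matrix.map_mul]
    congr 2
    · ext a i
      simp [J, A, eval_rename, Function.comp_def]
    · ext i b
      simp [B]
  rw [hdet] at h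
  refine algebraicIndependent_of_linear_coeff (fun a => aeval A (f a)) fun y => ?_
  let w : Fin m → F := (J * B)⁻¹.mulVec y
  have hw : (J * B).mulVec w = y := by
    rw [Matrix.mulVec_mulVec, Matrix.mul_nonsing_inv _ (isUnit_iff_ne_zero.2 h), Matrix.one_mulVec]
  let z : Fin r → F := fun j => ∑ b, if Fin.castLE hm b = j then w b else 0
  let v : Fin n → F := fun i => ∑ j, Θ (Sum.inr (Sum.inr (i, j))) * z j
  have hv : v = B.mulVec w := by
    funext i
    simp only [v, z, Finset.mul_sum]
    rw [Finset.sum_comm]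
    refine Finset.sum_congr rfl fun b _ => ?_
    simp [B]
  let ψ : MvPolynomial (Fin (r + 1)) F →ₐ[F] Polynomial F :=
    aeval (Fin.cons 0 fun j => Polynomial.C (z j) * Polynomial.X)
  have hψ : ∀ u, ψ (subst Θ u) = line A v u := by
    intro u
    have : ψ.comp (subst Θ) = aeval (fun i => Polynomial.C (A i) +
        Polynomial.C (v i) * Polynomial.X) := by
      refine algHom_ext fun i => ?_
      simp only [AlgHom.comp_apply, subst, aeval_X, map_add, map_mul, map_sum, ← algebraMap_eq,
        AlgHom.commutes, ψ, Fin.cons_zero, Fin.cons_succ, mul_zero, add_zero, v, Finset.sum_mul,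
        A, ← mul_assoc]
      rfl
    exact DFunLike.congr_fun this u
  refine ⟨ψ, fun a => ?_⟩
  obtain ⟨q, hq⟩ := exists_line_eq A v (f a)
  refine ⟨q, ?_⟩
  have h1 : ∑ i, v i * aeval A (pderiv i (f a)) = y a := by
    rw [← hw, ← Matrix.mulVec_mulVec, ← hv]
    exact Finset.sum_congr rfl fun i _ => mul_comm _ _
  rw [hψ, hq, h1]
  ring

end Substitution

/-! ### Rank, and monotonicity of the rank bound in the number of terms -/

section Rank

variable {F : Type*} [Field F]

/-- A maximal algebraically independent subset of `S`, cut off at size `r`. -/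
theorem exists_truncated_basis {R : Type*} [CommRing R] [IsDomain R] [Algebra F R] (S : Finset R)
    (r : ℕ) : ∃ T : Finset R, T ⊆ S ∧ T.card ≤ r ∧ AlgebraicIndepOn F id (T : Set R) ∧
      (T.card = r ∨ ∀ s ∈ S, IsAlgebraic (Algebra.adjoin F (T : Set R)) s) := by
  classical
  have hne : (S.powerset.filter fun T : Finset R =>
      T.card ≤ r ∧ AlgebraicIndepOn F id (T : Set R)).Nonempty := by
    refine ⟨∅, ?_⟩
    have hempty : IsEmpty ((∅ : Finset R) : Set R) := by simp
    rw [Finset.mem_filter, AlgebraicIndepOn, algebraicIndependent_empty_type_iff]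
    exact ⟨by simp, by simp, FaithfulSMul.algebraMap_injective _ _⟩
  obtain ⟨T, hT, hmax⟩ := Finset.exists_max_image _ Finset.card hne
  rw [Finset.mem_filter, Finset.mem_powerset] at hT
  refine ⟨T, hT.1, hT.2.1, hT.2.2, ?_⟩
  by_contra! hc
  obtain ⟨hr, s, hs, hsT⟩ := hc
  have hnot : s ∉ T := by
    intro h
    exact hsT (isAlgebraic_algebraMap (⟨s, Algebra.subset_adjoin h⟩ : Algebra.adjoin F (T : Set R)))
  have hins : AlgebraicIndepOn F id ((insert s T : Finset R) : Set R) := by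
    rw [Finset.coe_insert]
    refine hT.2.2.insert ?_
    rw [Set.image_id]
    exact hsT
  have hle := hmax (insert s T) (by
    rw [Finset.mem_filter, Finset.mem_powerset]
    refine ⟨Finset.insert_subset hs hT.1, ?_, hins⟩
    rw [Finset.card_insert_of_notMem hnot]
    have := hT.2.1
    omega)
  rw [Finset.card_insert_of_notMem hnot] at hle
  omega

variable {δ k s n : ℕ}

theorem Circuit.le_rank (C : Circuit F δ k s n) {m : ℕ} {τ : Fin m → MvPolynomial (Fin n) F}
    (hτ : AlgebraicIndependent F τ) (hC : ∀ a, τ a ∈ C.sparsePolys) : m ≤ C.rank := by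
  classical
  have hinj := hτ.injective
  refine le_csSup ⟨k * s, ?_⟩ ⟨Finset.univ.image τ, ?_, ?_, ?_⟩
  · rintro m ⟨T, hT, rfl, -⟩
    have h : T ⊆ (Finset.univ : Finset (Fin k × Fin s)).image (fun x => C.f x.1 x.2) := by
      intro g hg
      obtain ⟨i, j, hij⟩ := hT hg
      exact Finset.mem_image.2 ⟨(i, j), Finset.mem_univ _, hij⟩
    calc T.card ≤ _ := Finset.card_le_card h
      _ ≤ _ := Finset.card_image_le
      _ = k * s := by simp
  · intro g hg
    obtain ⟨a, -, rfl⟩ := Finset.mem_image.1 (Finset.mem_coe.1 hg)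
    exact hC a
  · rw [Finset.card_image_of_injective _ hinj]
    simp
  · rw [Finset.coe_image, Finset.coe_univ, Set.image_univ]
    exact hτ.to_subtype_range

theorem algebraicIndependent_const_mul {R : Type*} [CommRing R] [Algebra F R] {ι : Type*}
    {τ : ι → R} (hτ : AlgebraicIndependent F τ) {c : ι → F} (hc : ∀ a, c a ≠ 0) :
    AlgebraicIndependent F fun a => algebraMap F R (c a) * τ a := by
  rw [algebraicIndependent_iff] at *
  intro P hP
  have h1 : aeval τ (aeval (fun a => (C (c a) * X a : MvPolynomial ι F)) P) = 0 := by
    rw [← hP, ← AlgHom.comp_apply]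
    congr 1
    ext a
    simp [← algebraMap_eq]
  have h2 := hτ _ h1
  have h3 : (aeval (R := F) (fun a => (C (c a)⁻¹ * X a : MvPolynomial ι F))).comp
      (aeval (fun a => (C (c a) * X a : MvPolynomial ι F))) = AlgHom.id F _ := by
    refine algHom_ext fun a => ?_
    rw [AlgHom.comp_apply, aeval_X, map_mul, aeval_X, ← algebraMap_eq, AlgHom.commutes,
      algebraMap_eq, ← mul_assoc, ← C_mul, mul_inv_cancel₀ (hc a), C_1, one_mul, AlgHom.id_apply]
  have h4 := DFunLike.congr_fun h3 P
  rw [AlgHom.comp_apply, h2, map_zero] at h4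
  exact h4.symm

/-- A simple and minimal circuit that computes zero can be lengthened by splitting its first
term. -/
theorem Circuit.exists_split [Infinite F] (hs : 1 ≤ s) (C : Circuit F δ (k + 1) s n)
    (h₁ : C.IsSimple) (h₂ : C.IsMinimal) (h₃ : C.poly = 0) :
    ∃ C' : Circuit F δ (k + 2) s n, C'.IsSimple ∧ C'.IsMinimal ∧ C'.poly = 0 ∧
      ∀ g ∈ C.sparsePolys, ∃ c : F, c ≠ 0 ∧ MvPolynomial.C c * g ∈ C'.sparsePolys := by
  classical
  have hT0 : C.term 0 ≠ 0 := by
    intro h0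
    rcases Nat.eq_zero_or_pos k with rfl | hk
    · have : ¬ IsUnit (0 : MvPolynomial (Fin n) F) := not_isUnit_zero
      refine this (h₁ 0 fun i => ?_)
      rw [show i = 0 from Fin.ext (by have := i.2; simp only [Fin.val_zero]; omega), h0]
    · refine h₂ {0} (Finset.singleton_nonempty _) ?_ (by rw [Finset.sum_singleton, h0])
      intro h
      have : (1 : Fin (k + 1)) ∈ ({0} : Finset (Fin (k + 1))) := h ▸ Finset.mem_univ _
      rw [Finset.mem_singleton] at this
      have h2 := congrArg Fin.val this
      rw [Fin.val_one', Nat.mod_eq_of_lt (by omega)] at h2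
      simp at h2
  have hsub : ∀ P : MvPolynomial (Fin n) F, {α : F | MvPolynomial.C α * C.term 0 = P}.Subsingleton :=
    fun P α hα β hβ => C_injective (Fin n) F (mul_right_cancel₀ hT0 (hα.trans hβ.symm))
  -- Minimality can be lost only if `α T_0` or `(1 - α) T_0` cancels against a sum of other terms.
  -- Since `T_0 ≠ 0`, each such sum excludes at most one `α` in each case; the empty sum excludes 0
  -- and 1.
  have hbad : (⋃ J : Finset (Fin (k + 1)),
      ({α : F | MvPolynomial.C α * C.term 0 = - ∑ i ∈ J, C.term i} ∪
      {α : F | MvPolynomial.C α * C.term 0 = C.term 0 + ∑ i ∈ J, C.term i})).Finite :=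
    Set.finite_iUnion fun J => (hsub _).finite.union (hsub _).finite
  obtain ⟨α, hα⟩ := hbad.infinite_compl.nonempty
  simp only [Set.mem_compl_iff, Set.mem_iUnion, Set.mem_union, Set.mem_ofPred_eq, not_exists,
    not_or] at hα
  have hα0 : α ≠ 0 := by
    rintro rfl
    exact (hα ∅).1 (by simp)
  have hα1 : 1 - α ≠ 0 := by
    intro h
    refine (hα ∅).2 ?_
    rw [← sub_eq_zero.1 h]
    simp
  have hunit : ∀ {a : F}, a ≠ 0 → IsUnit (MvPolynomial.C a : MvPolynomial (Fin n) F) := fun ha =>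
    IsUnit.map MvPolynomial.C (IsUnit.mk0 _ ha)
  let j₀ : Fin s := ⟨0, hs⟩
  let f' : F → Fin s → MvPolynomial (Fin n) F := fun a j =>
    if j = j₀ then MvPolynomial.C a * C.f 0 j else C.f 0 j
  have hf' : ∀ a, ∏ j, f' a j = MvPolynomial.C a * C.term 0 := by
    intro a
    have : ∀ j, f' a j = (if j = j₀ then MvPolynomial.C a else 1) * C.f 0 j := by
      intro j
      simp only [f']
      split_ifs <;> simp
    simp only [this, Finset.prod_mul_distrib, Finset.prod_ite_eq', Finset.mem_univ, if_true,
      Circuit.term]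
  have hdeg : ∀ a j, (f' a j).totalDegree ≤ δ := by
    intro a j
    simp only [f']
    split_ifs
    · refine (totalDegree_mul _ _).trans ?_
      rw [totalDegree_C, zero_add]
      exact C.degree_le _ _
    · exact C.degree_le _ _
  let C' : Circuit F δ (k + 2) s n :=
    { f := Fin.cons (f' (1 - α)) (Fin.cons (f' α) fun i => C.f i.succ)
      degree_le := by
        intro i j
        refine Fin.cases ?_ (fun i => Fin.cases ?_ (fun i => ?_) i) i
        · exact hdeg _ _
        · exact hdeg _ _
        · exact C.degree_le _ _ }
  have ht0 : C'.term 0 = MvPolynomial.C (1 - α) * C.term 0 := hf' _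
  have ht1 : C'.term (Fin.succ 0) = MvPolynomial.C α * C.term 0 := hf' _
  have ht2 : ∀ i : Fin k, C'.term i.succ.succ = C.term i.succ := fun i => rfl
  have hsumC : C.term 0 + ∑ i : Fin k, C.term i.succ = 0 := by
    rw [← Fin.sum_univ_succ]
    exact h₃
  refine ⟨C', fun d hd => h₁ d fun i => ?_, fun J hJ hJu hsum => ?_, ?_, ?_⟩
  · refine Fin.cases ?_ (fun i => ?_) i
    · have := hd 0
      rw [ht0] at this
      exact (hunit hα1).dvd_mul_left.1 this
    · exact hd i.succ.succ
  · let J₂ : Finset (Fin k) := Finset.univ.filter fun i => i.succ.succ ∈ J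
    have hsplit : (if (0 : Fin (k + 2)) ∈ J then MvPolynomial.C (1 - α) * C.term 0 else 0) +
        ((if (Fin.succ 0 : Fin (k + 2)) ∈ J then MvPolynomial.C α * C.term 0 else 0) +
        ∑ i ∈ J₂, C.term i.succ) = 0 := by
      have h5 : ∑ i ∈ J, C'.term i = ∑ i, if i ∈ J then C'.term i else 0 :=
        (Finset.sum_ite_mem_eq J _).symm
      refine Eq.trans ?_ hsum
      rw [h5, Fin.sum_univ_succ, Fin.sum_univ_succ, ht0, ht1]
      simp only [J₂, Finset.sum_filter, ht2]
    have hmap : ∑ i ∈ J₂, C.term i.succ = ∑ i ∈ J₂.map (Fin.succEmb k), C.term i := by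
      rw [Finset.sum_map]
      rfl
    have h0map : (0 : Fin (k + 1)) ∉ J₂.map (Fin.succEmb k) := by
      simp [Fin.succ_ne_zero]
    by_cases hj0 : (0 : Fin (k + 2)) ∈ J <;> by_cases hj1 : (Fin.succ 0 : Fin (k + 2)) ∈ J
    · rw [if_pos hj0, if_pos hj1, ← add_assoc, ← add_mul, ← C_add, sub_add_cancel, C_1, one_mul,
        hmap, ← Finset.sum_insert h0map] at hsplit
      refine h₂ _ ⟨0, Finset.mem_insert_self _ _⟩ (fun hu => hJu ?_) hsplit
      rw [Finset.eq_univ_iff_forall] at hu ⊢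
      intro i
      refine Fin.cases hj0 (fun i => Fin.cases hj1 (fun i => ?_) i) i
      have := hu i.succ
      rw [Finset.mem_insert, or_iff_right (Fin.succ_ne_zero i), Finset.mem_map] at this
      obtain ⟨i', hi', hii'⟩ := this
      rw [Fin.coe_succEmb, Fin.succ_inj] at hii'
      rw [← hii']
      exact (Finset.mem_filter.1 hi').2
    · rw [if_pos hj0, if_neg hj1, zero_add, hmap, C_sub, C_1] at hsplit
      exact (hα (J₂.map (Fin.succEmb k))).2 (by linear_combination -hsplit)
    · rw [if_neg hj0, if_pos hj1, zero_add, hmap] at hsplit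
      exact (hα (J₂.map (Fin.succEmb k))).1 (by linear_combination hsplit)
    · rw [if_neg hj0, if_neg hj1, zero_add, zero_add, hmap] at hsplit
      refine h₂ _ ?_ (fun h => h0map (by rw [h]; exact Finset.mem_univ _)) hsplit
      obtain ⟨i, hi⟩ := hJ
      revert hi
      refine Fin.cases (fun h => absurd h hj0)
        (fun i => Fin.cases (fun h => absurd h hj1) (fun i hi => ?_) i) i
      exact ⟨i.succ, Finset.mem_map_of_mem _ (Finset.mem_filter.2 ⟨Finset.mem_univ _, hi⟩)⟩
  · rw [Circuit.poly, Fin.sum_univ_succ, Fin.sum_univ_succ, ht0, ht1]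
    simp only [ht2, C_sub, C_1]
    linear_combination hsumC
  · rintro g ⟨i, j, rfl⟩
    revert i
    refine Fin.cases ?_ fun i => ?_
    · by_cases hj : j = j₀
      · refine ⟨α, hα0, Fin.succ 0, j, ?_⟩
        change f' α j = _
        simp only [f', if_pos hj]
      · refine ⟨1, one_ne_zero, Fin.succ 0, j, ?_⟩
        change f' α j = _
        simp only [f', if_neg hj, C_1, one_mul]
    · refine ⟨1, one_ne_zero, i.succ.succ, j, ?_⟩
      rw [C_1, one_mul]
      rfl

/-- The rank bound for `k` terms also holds for circuits with fewer terms. -/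
theorem Circuit.lt_rankBound [Infinite F] (hs : 1 ≤ s) {k' : ℕ} (hk' : 1 ≤ k') (hk : k' ≤ k)
    (C : Circuit F δ k' s n) (h₁ : C.IsSimple) (h₂ : C.IsMinimal) (h₃ : C.poly = 0) {m : ℕ}
    {τ : Fin m → MvPolynomial (Fin n) F} (hτ : AlgebraicIndependent F τ)
    (hC : ∀ a, τ a ∈ C.sparsePolys) : m < rankBound F δ k s := by
  obtain ⟨d, rfl⟩ := Nat.exists_eq_add_of_le' hk
  clear hk
  induction d generalizing k' τ with
  | zero =>
    rw [Nat.zero_add]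
    exact (C.le_rank hτ hC).trans_lt ((rankBound_spec F δ k' s).2 n C h₁ h₂ h₃)
  | succ d ih =>
    obtain ⟨k'', rfl⟩ := Nat.exists_eq_add_of_le' hk'
    -- `rankBound` speaks of exactly `k` terms, and each split supplies one missing term. The
    -- independent polynomials persist up to nonzero constant factors.
    obtain ⟨C', h₁', h₂', h₃', hC'⟩ := C.exists_split hs h₁ h₂ h₃
    choose c hc0 hc using fun a => hC' _ (hC a)
    have := ih (by omega) C' h₁' h₂' h₃' (algebraicIndependent_const_mul hτ hc0) hc
    rwa [show d + 1 + (k'' + 1) = d + (k'' + 2) by omega]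

end Rank

/-! ### When a homomorphism preserves nonzero circuits -/

section Preservation

variable {F : Type*} [Field F] {δ k s n N : ℕ}

/-- The products over the rows in `I` of the matrix `f'` are coprime, and differ from those of `f`
by the common factor `g`. -/
def IsSimplePart (f f' : Fin k → Fin s → MvPolynomial (Fin n) F) (I : Finset (Fin k))
    (g : MvPolynomial (Fin n) F) : Prop :=
  (∀ i ∈ I, ∏ j, f i j = g * ∏ j, f' i j) ∧ (∀ i ∈ I, ∀ j, f' i j ∣ f i j) ∧
    ∀ d, (∀ i ∈ I, d ∣ ∏ j, f' i j) → IsUnit d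

/-- Remove a common prime factor from one entry of each row and repeat; the degree of the product in
row `i₀` drops each time. Working inside the entries keeps `s` factors per row, each a divisor of
the original one, so the simple part still consists of polynomials of degree at most `δ`. -/
theorem exists_isSimplePart (f : Fin k → Fin s → MvPolynomial (Fin n) F) {I : Finset (Fin k)}
    (hI : I.Nonempty) (hf : ∀ i ∈ I, ∏ j, f i j ≠ 0) : ∃ f' g, IsSimplePart f f' I g := by
  classical
  obtain ⟨i₀, hi₀⟩ := hI
  generalize hD : (∏ j, f i₀ j).totalDegree = D
  induction D using Nat.strong_induction_on generalizing f with
  | _ D ih =>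
    by_cases hu : ∀ d, (∀ i ∈ I, d ∣ ∏ j, f i j) → IsUnit d
    · exact ⟨f, 1, fun i _ => (one_mul _).symm, fun i _ j => dvd_rfl, hu⟩
    push Not at hu
    obtain ⟨d, hd, hdu⟩ := hu
    have hd0 : d ≠ 0 := by
      rintro rfl
      exact hf i₀ hi₀ (zero_dvd_iff.1 (hd i₀ hi₀))
    obtain ⟨q, hq, hqd⟩ := WfDvdMonoid.exists_irreducible_factor hdu hd0
    have hqp : Prime q := hq.prime
    have hex : ∀ i, ∃ j, i ∈ I → q ∣ f i j := by
      intro i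
      by_cases hi : i ∈ I
      · obtain ⟨j, -, hj⟩ := (Prime.dvd_finsetProd_iff hqp _).1 (hqd.trans (hd i hi))
        exact ⟨j, fun _ => hj⟩
      · by_cases hs : Nonempty (Fin s)
        · exact ⟨hs.some, fun h => absurd h hi⟩
        · rw [not_nonempty_iff] at hs
          have := hqd.trans (hd i₀ hi₀)
          rw [Finset.univ_eq_empty, Finset.prod_empty] at this
          exact absurd (isUnit_of_dvd_one this) hq.not_isUnit
    choose J hJ using hex
    have hex' : ∀ i, ∃ h, i ∈ I → f i (J i) = q * h := by
      intro i
      by_cases hi : i ∈ I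
      · obtain ⟨h, hh⟩ := hJ i hi
        exact ⟨h, fun _ => hh⟩
      · exact ⟨0, fun h => absurd h hi⟩
    choose h hh using hex'
    let f₁ : Fin k → Fin s → MvPolynomial (Fin n) F := fun i => Function.update (f i) (J i) (h i)
    have hf₁ : ∀ i ∈ I, ∏ j, f i j = q * ∏ j, f₁ i j := by
      intro i hi
      rw [← Finset.mul_prod_erase _ _ (Finset.mem_univ (J i)),
        ← Finset.mul_prod_erase _ (f₁ i) (Finset.mem_univ (J i)), hh i hi, mul_assoc]
      congr 1
      simp only [f₁, Function.update_self]
      congr 1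
      refine Finset.prod_congr rfl fun j hj => ?_
      rw [Function.update_of_ne (Finset.ne_of_mem_erase hj)]
    have hf₁0 : ∀ i ∈ I, ∏ j, f₁ i j ≠ 0 := fun i hi h0 => hf i hi (by rw [hf₁ i hi, h0, mul_zero])
    obtain ⟨f', g, h1, h2, h3⟩ := ih _ (by
      rw [← hD, hf₁ i₀ hi₀, totalDegree_mul_of_isDomain hq.ne_zero (hf₁0 i₀ hi₀)]
      have := totalDegree_ne_zero_of_irreducible hq
      omega) f₁ hf₁0 rfl
    refine ⟨f', q * g, fun i hi => ?_, fun i hi j => (h2 i hi j).trans ?_, h3⟩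
    · rw [hf₁ i hi, h1 i hi, mul_assoc]
    · simp only [f₁]
      by_cases hj : j = J i
      · rw [hj, Function.update_self, hh i hi]
        exact dvd_mul_left _ _
      · rw [Function.update_of_ne hj]

/-- `T` is a maximal algebraically independent set among the polynomials in the rows in `I` of a
simple part, cut off at size `r`. -/
def IsRankWitness (f : Fin k → Fin s → MvPolynomial (Fin n) F) (r : ℕ) (I : Finset (Fin k))
    (T : Finset (MvPolynomial (Fin n) F)) : Prop :=
  ∃ f' g, IsSimplePart f f' I g ∧ (∀ t ∈ T, ∃ i ∈ I, ∃ j, f' i j = t) ∧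
    (T.card = r ∨ ∀ i ∈ I, ∀ j, IsAlgebraic
      (Algebra.adjoin F (T : Set (MvPolynomial (Fin n) F))) (f' i j))

theorem Circuit.ne_zero_of_term_ne_zero (C : Circuit F δ k s n) {i : Fin k} (hi : C.term i ≠ 0)
    (j : Fin s) : C.f i j ≠ 0 := fun h => hi (Finset.prod_eq_zero (Finset.mem_univ j) h)

theorem Circuit.exists_isRankWitness (C : Circuit F δ k s n) (r : ℕ) (I : Finset (Fin k)) :
    ∃ T : Finset (MvPolynomial (Fin n) F), T.card ≤ r ∧
      AlgebraicIndepOn F id (T : Set (MvPolynomial (Fin n) F)) ∧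
      (∀ t ∈ T, t.totalDegree ≤ δ) ∧
      (I.Nonempty → (∀ i ∈ I, C.term i ≠ 0) → IsRankWitness C.f r I T) := by
  classical
  by_cases h : I.Nonempty ∧ ∀ i ∈ I, C.term i ≠ 0
  · obtain ⟨f', g, hfg⟩ := exists_isSimplePart C.f h.1 h.2
    obtain ⟨T, hT, hTr, hTi, hTm⟩ := exists_truncated_basis (F := F)
      ((I ×ˢ Finset.univ).image fun x : Fin k × Fin s => f' x.1 x.2) r
    have hmem : ∀ t ∈ T, ∃ i ∈ I, ∃ j, f' i j = t := by
      intro t ht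
      obtain ⟨⟨i, j⟩, hij, rfl⟩ := Finset.mem_image.1 (hT ht)
      exact ⟨i, (Finset.mem_product.1 hij).1, j, rfl⟩
    refine ⟨T, hTr, hTi, fun t ht => ?_, fun _ _ => ⟨f', g, hfg, hmem, hTm.imp id fun h' i hi j => ?_⟩⟩
    · obtain ⟨i, hi, j, rfl⟩ := hmem t ht
      exact (totalDegree_le_of_dvd_of_isDomain (hfg.2.1 i hi j)
        (C.ne_zero_of_term_ne_zero (h.2 i hi) j)).trans (C.degree_le i j)
    · exact h' _ (Finset.mem_image.2 ⟨(i, j), Finset.mem_product.2 ⟨hi, Finset.mem_univ _⟩, rfl⟩)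
  -- Here `T` is empty. It only makes the choice of `T` total in `I`.
  · obtain ⟨T, hT, hTr, hTi, -⟩ := exists_truncated_basis (F := F)
      (∅ : Finset (MvPolynomial (Fin n) F)) r
    refine ⟨T, hTr, hTi, fun t ht => ?_, fun h1 h2 => absurd ⟨h1, h2⟩ h⟩
    have := hT ht
    simp at this

section Map

variable {φ : MvPolynomial (Fin n) F →ₐ[F] MvPolynomial (Fin N) F}

theorem map_ne_zero_of_irreducible {h : MvPolynomial (Fin n) F} (h0 : h ≠ 0)
    (H : ∀ u, Irreducible u → u ∣ h → φ u ≠ 0) : φ h ≠ 0 := by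
  induction h using WfDvdMonoid.induction_on_irreducible with
  | zero => exact absurd rfl h0
  | unit a ha => exact (ha.map φ).ne_zero
  | mul a i ha hi ih =>
    rw [map_mul]
    exact mul_ne_zero (H i hi (dvd_mul_right _ _)) (ih ha fun u hu hd => H u hu (hd.mul_left _))

theorem exists_irreducible_dvd_map {h : MvPolynomial (Fin n) F} (h0 : h ≠ 0)
    {q : MvPolynomial (Fin N) F} (hq : Prime q) (hqh : q ∣ φ h) :
    ∃ u, Irreducible u ∧ u ∣ h ∧ q ∣ φ u := by
  induction h using WfDvdMonoid.induction_on_irreducible with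
  | zero => exact absurd rfl h0
  | unit a ha => exact absurd (isUnit_of_dvd_unit hqh (ha.map φ)) hq.not_isUnit
  | mul a i ha hi ih =>
    rw [map_mul] at hqh
    rcases hq.dvd_or_dvd hqh with h | h
    · exact ⟨i, hi, dvd_mul_right _ _, h⟩
    · obtain ⟨u, hu, hua, hqu⟩ := ih ha h
      exact ⟨u, hu, hua.mul_left _, hqu⟩

/-- A homomorphism that keeps the factors of a circuit coprime, and enough of them algebraically
independent, does not kill the polynomial computed by the circuit. -/
theorem Circuit.map_poly_ne_zero [Infinite F] (hs : 1 ≤ s) (C : Circuit F δ k s n)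
    (hφ : ∀ u, (φ u).totalDegree ≤ u.totalDegree)
    (hA : ∀ u, Irreducible u → (∃ i j, C.f i j ≠ 0 ∧ u ∣ C.f i j) → φ u ≠ 0)
    (hB : ∀ u u', Irreducible u → Irreducible u' → (∃ i j, C.f i j ≠ 0 ∧ u ∣ C.f i j) →
      (∃ i j, C.f i j ≠ 0 ∧ u' ∣ C.f i j) → ¬ u ∣ u' → IsRelPrime (φ u) (φ u'))
    (hC : ∀ I : Finset (Fin k), I.Nonempty → (∀ i ∈ I, C.term i ≠ 0) →
      ∃ T : Finset (MvPolynomial (Fin n) F), IsRankWitness C.f (rankBound F δ k s) I T ∧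
        AlgebraicIndependent F fun t : T => φ t.1)
    (hpoly : C.poly ≠ 0) : φ C.poly ≠ 0 := by
  classical
  intro hzero
  have hne : (Finset.univ.filter fun I : Finset (Fin k) =>
      ∑ i ∈ I, C.term i ≠ 0 ∧ ∑ i ∈ I, φ (C.term i) = 0).Nonempty := by
    refine ⟨Finset.univ, Finset.mem_filter.2 ⟨Finset.mem_univ _, hpoly, ?_⟩⟩
    rw [← map_sum]
    exact hzero
  -- A smallest set of terms whose sum is nonzero but killed by `φ`.
  obtain ⟨I, hI, hmin⟩ := Finset.exists_min_image _ Finset.card hne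
  simp only [Finset.mem_filter, Finset.mem_univ, true_and] at hI hmin
  obtain ⟨hI1, hI2⟩ := hI
  have hInon : I.Nonempty := by
    rw [Finset.nonempty_iff_ne_empty]
    rintro rfl
    exact hI1 Finset.sum_empty
  have hT : ∀ i ∈ I, C.term i ≠ 0 := by
    intro i hi h0
    have h1 := Finset.add_sum_erase _ C.term hi
    have h2 := Finset.add_sum_erase _ (fun i => φ (C.term i)) hi
    simp only [h0, map_zero, zero_add] at h1 h2
    have := hmin (I.erase i) ⟨by rwa [h1], by rw [h2, hI2]⟩
    rw [Finset.card_erase_of_mem hi] at this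
    have := Finset.card_pos.2 hInon
    omega
  obtain ⟨T, ⟨f', g, ⟨hg, hdvd, hunit⟩, hTmem, hTalg⟩, hTφ⟩ := hC I hInon hT
  have hf0 : ∀ i ∈ I, ∀ j, C.f i j ≠ 0 := fun i hi j => C.ne_zero_of_term_ne_zero (hT i hi) j
  have hφf : ∀ i ∈ I, ∀ j, φ (C.f i j) ≠ 0 := fun i hi j =>
    map_ne_zero_of_irreducible (hf0 i hi j) fun u hu hd => hA u hu ⟨i, j, hf0 i hi j, hd⟩
  have hprod0 : ∀ i ∈ I, ∏ j, f' i j ≠ 0 := fun i hi h0 => hT i hi (by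
    rw [Circuit.term, hg i hi, h0, mul_zero])
  have hφg : φ g ≠ 0 := by
    obtain ⟨i, hi⟩ := hInon
    intro h0
    have h1 : φ (C.term i) = 0 := by rw [Circuit.term, hg i hi, map_mul, h0, zero_mul]
    rw [Circuit.term, map_prod] at h1
    obtain ⟨j, -, hj⟩ := Finset.prod_eq_zero_iff.1 h1
    exact hφf i hi j hj
  have hsumg : ∀ J ⊆ I, ∑ i ∈ J, C.term i = g * ∑ i ∈ J, ∏ j, f' i j := by
    intro J hJ
    rw [Finset.mul_sum]
    exact Finset.sum_congr rfl fun i hi => hg i (hJ hi)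
  let e : Fin I.card ≃ I := I.equivFin.symm
  -- The image of the simple part of the terms in `I`. It will be a simple and minimal circuit
  -- computing zero.
  let C' : Circuit F δ I.card s N :=
    { f := fun a j => φ (f' (e a).1 j)
      degree_le := fun a j => (hφ _).trans ((totalDegree_le_of_dvd_of_isDomain
        (hdvd _ (e a).2 j) (hf0 _ (e a).2 j)).trans (C.degree_le _ _)) }
  have hterm : ∀ a, C'.term a = φ (∏ j, f' (e a).1 j) := fun a => by
    rw [map_prod]
    rfl
  have hmapsum : ∀ J : Finset (Fin I.card), ∑ a ∈ J, C'.term a =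
      φ (∑ i ∈ J.map (e.toEmbedding.trans (Function.Embedding.subtype _)), ∏ j, f' i j) := by
    intro J
    rw [Finset.sum_map, map_sum]
    exact Finset.sum_congr rfl fun a _ => hterm a
  have hmapI : ∀ J : Finset (Fin I.card),
      J.map (e.toEmbedding.trans (Function.Embedding.subtype _)) ⊆ I := by
    intro J i hi
    obtain ⟨a, -, rfl⟩ := Finset.mem_map.1 hi
    exact (e a).2
  have huniv : (Finset.univ : Finset (Fin I.card)).map
      (e.toEmbedding.trans (Function.Embedding.subtype _)) = I :=
    Finset.eq_of_subset_of_card_le (hmapI _) (by simp)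
  have hC'zero : C'.poly = 0 := by
    have h1 := hmapsum Finset.univ
    rw [huniv] at h1
    have h2 : φ g * φ (∑ i ∈ I, ∏ j, f' i j) = 0 := by
      rw [← map_mul, ← hsumg I subset_rfl, map_sum]
      exact hI2
    exact h1.trans ((mul_eq_zero.1 h2).resolve_left hφg)
  have hC'min : C'.IsMinimal := by
    intro J hJ hJu h0
    rw [hmapsum] at h0
    set J' := J.map (e.toEmbedding.trans (Function.Embedding.subtype _)) with hJ'
    have h1 : ∑ i ∈ J', φ (C.term i) = 0 := by
      rw [← map_sum, hsumg J' (hmapI J), map_mul, h0, mul_zero]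
    have hcard : J'.card < I.card := by
      rw [hJ', Finset.card_map]
      calc J.card < (Finset.univ : Finset (Fin I.card)).card :=
            Finset.card_lt_card (Finset.ssubset_univ_iff.2 hJu)
        _ = I.card := by simp
    -- `J'` is smaller than `I`, so a sum over `J'` that is killed must already be zero. Then `I \
    -- J'` has the same sum as `I` and contradicts minimality.
    have h2 : ∑ i ∈ J', C.term i = 0 := by
      by_contra h2
      have := hmin J' ⟨h2, h1⟩
      omega
    have h3 := Finset.sum_sdiff (f := C.term) (hmapI J)
    have h4 := Finset.sum_sdiff (f := fun i => φ (C.term i)) (hmapI J)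
    rw [h2, add_zero] at h3
    rw [h1, add_zero, hI2] at h4
    have h5 := hmin (I \ J') ⟨by rw [h3]; exact hI1, h4⟩
    rw [Finset.card_sdiff_of_subset (hmapI J), ← hJ'] at h5
    have h6 : 0 < J'.card := by
      rw [hJ', Finset.card_map]
      exact hJ.card_pos
    omega
  have hC'simple : C'.IsSimple := by
    intro d hd
    by_contra hdu
    have hdφ : ∀ i ∈ I, d ∣ φ (∏ j, f' i j) := by
      intro i hi
      have := hd (e.symm ⟨i, hi⟩)
      rwa [hterm, Equiv.apply_symm_apply] at this
    have hφprod : ∀ i ∈ I, φ (∏ j, f' i j) ≠ 0 := by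
      intro i hi
      rw [map_prod, Finset.prod_ne_zero_iff]
      intro j _ h0
      obtain ⟨w, hw⟩ := hdvd i hi j
      exact hφf i hi j (by rw [hw, map_mul, h0, zero_mul])
    obtain ⟨i₁, hi₁⟩ := hInon
    have hd0 : d ≠ 0 := by
      rintro rfl
      exact hφprod i₁ hi₁ (zero_dvd_iff.1 (hdφ i₁ hi₁))
    obtain ⟨q, hq, hqd⟩ := WfDvdMonoid.exists_irreducible_factor hdu hd0
    have hex : ∀ i ∈ I, ∃ u, Irreducible u ∧ (∃ i j, C.f i j ≠ 0 ∧ u ∣ C.f i j) ∧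
        u ∣ ∏ j, f' i j ∧ q ∣ φ u := by
      intro i hi
      obtain ⟨u, hu, hud, hqu⟩ := exists_irreducible_dvd_map (hprod0 i hi) hq.prime
        (hqd.trans (hdφ i hi))
      obtain ⟨j, -, hj⟩ := (Prime.dvd_finsetProd_iff hu.prime _).1 hud
      exact ⟨u, hu, ⟨i, j, hf0 i hi j, hj.trans (hdvd i hi j)⟩, hud, hqu⟩
    -- Every row contains an irreducible factor whose image is divisible by `q`. By `hB` the factor
    -- `u₁` divides each of these, hence every row, against the simplicity of `f'`.
    obtain ⟨u₁, hu₁, hu₁C, -, hqu₁⟩ := hex i₁ hi₁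
    refine hu₁.not_isUnit (hunit u₁ fun i hi => ?_)
    obtain ⟨u, hu, huC, hud, hqu⟩ := hex i hi
    by_contra hnot
    exact hq.not_isUnit (hB u₁ u hu₁ hu hu₁C huC (fun h => hnot (h.trans hud)) hqu₁ hqu)
  have hcardT : T.card < rankBound F δ k s := by
    refine C'.lt_rankBound hs (Finset.card_pos.2 hInon) (by simpa using I.card_le_univ) hC'simple
      hC'min hC'zero (τ := fun a => φ (T.equivFin.symm a).1)
      (hTφ.comp _ T.equivFin.symm.injective) fun a => ?_
    obtain ⟨i, hi, j, hij⟩ := hTmem _ (T.equivFin.symm a).2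
    refine ⟨e.symm ⟨i, hi⟩, j, ?_⟩
    change φ (f' (e (e.symm ⟨i, hi⟩)).1 j) = _
    rw [Equiv.apply_symm_apply, hij]
  -- The rank bound rules out the cut-off, so `S` is algebraic over `F[T]` and divides a nonzero
  -- element `ρ` of `F[T]`. Then `φ ρ = 0`, although `φ` is injective on `F[T]`.
  have halg := hTalg.resolve_left hcardT.ne
  set S := ∑ i ∈ I, ∏ j, f' i j with hS
  have hS0 : S ≠ 0 := by
    intro h0
    apply hI1
    rw [hsumg I subset_rfl, ← hS, h0, mul_zero]
  have hφS : φ S = 0 := by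
    have := hmapsum Finset.univ
    rw [huniv] at this
    rw [← this]
    exact hC'zero
  have hSalg : IsAlgebraic (Algebra.adjoin F (T : Set (MvPolynomial (Fin n) F))) S := by
    have : S ∈ Subalgebra.algebraicClosure
        (Algebra.adjoin F (T : Set (MvPolynomial (Fin n) F))) (MvPolynomial (Fin n) F) :=
      sum_mem fun i hi => prod_mem fun j _ => halg i hi j
    exact this
  obtain ⟨ρ, hρ0, hρ⟩ := hSalg.exists_nonzero_dvd (mem_nonZeroDivisors_of_ne_zero hS0)
  obtain ⟨P, hP⟩ : ∃ P : MvPolynomial T F, aeval (fun t : T => t.1) P = ρ.1 := by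
    have h1 : ρ.1 ∈ Algebra.adjoin F (Set.range fun t : T => t.1) := by
      have : Set.range (fun t : T => t.1) = (T : Set (MvPolynomial (Fin n) F)) :=
        Subtype.range_coe
      rw [this]
      exact ρ.2
    rw [Algebra.adjoin_range_eq_range_aeval] at h1
    exact h1
  have hφρ : φ ρ.1 = 0 := by
    obtain ⟨w, hw⟩ := hρ
    have hw' : ρ.1 = S * w := hw
    rw [hw', map_mul, hφS, zero_mul]
  rw [← hP, ← AlgHom.comp_apply, comp_aeval] at hφρ
  have hP0 := (algebraicIndependent_iff.1 hTφ) P hφρ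
  rw [hP0, map_zero] at hP
  exact hρ0 (Subtype.ext hP.symm)

end Map

end Preservation

/-! ### Linear substitutions that preserve coprimality -/

section SubstProperties

variable {F : Type*} [Field F] {n r : ℕ}

theorem totalDegree_subst_le (Θ : Param n r → F) (u : MvPolynomial (Fin n) F) :
    (subst Θ u).totalDegree ≤ u.totalDegree := by
  have h : ∀ i : Fin n, (C (Θ (Sum.inl i)) + C (Θ (Sum.inr (Sum.inl i))) * X 0 +
      ∑ j : Fin r, C (Θ (Sum.inr (Sum.inr (i, j)))) * X j.succ :
        MvPolynomial (Fin (r + 1)) F).totalDegree ≤ 1 := by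
    intro i
    have hX : ∀ (a : F) (j : Fin (r + 1)), (C a * X j : MvPolynomial _ F).totalDegree ≤ 1 := by
      intro a j
      refine (totalDegree_mul _ _).trans ?_
      rw [totalDegree_C, totalDegree_X]
    refine (totalDegree_add _ _).trans (max_le ((totalDegree_add _ _).trans (max_le ?_ (hX _ _)))
      (totalDegree_finsetSum_le fun j _ => hX _ _))
    rw [totalDegree_C]
    exact Nat.zero_le _
  have := totalDegree_aeval_le h (P := u) le_rfl
  rwa [mul_one] at this

theorem line_subst (Θ : Param n r → F) (u : MvPolynomial (Fin n) F) :
    line (0 : Fin (r + 1) → F) (Pi.single 0 1) (subst Θ u) =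
      line (fun i => Θ (Sum.inl i)) (fun i => Θ (Sum.inr (Sum.inl i))) u := by
  have : (aeval (R := F) fun i : Fin (r + 1) => (Polynomial.C ((0 : Fin (r + 1) → F) i) +
      Polynomial.C ((Pi.single 0 1 : Fin (r + 1) → F) i) * Polynomial.X : Polynomial F)).comp
        (subst Θ) = aeval (fun i => Polynomial.C (Θ (Sum.inl i)) +
        Polynomial.C (Θ (Sum.inr (Sum.inl i))) * Polynomial.X) := by
    refine algHom_ext fun i => ?_
    simp only [AlgHom.comp_apply, subst, aeval_X, map_add, map_mul, map_sum, ← algebraMap_eq,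
      AlgHom.commutes]
    simp [Fin.succ_ne_zero]
  exact DFunLike.congr_fun this u

theorem natDegree_line_subst {Θ : Param n r → F} {u : MvPolynomial (Fin n) F}
    (h : aeval (fun i => Θ (Sum.inr (Sum.inl i))) (topForm u) ≠ 0) :
    (line (0 : Fin (r + 1) → F) (Pi.single 0 1) (subst Θ u)).natDegree = u.totalDegree ∧ subst Θ u ≠ 0 := by
  rw [← coeff_line (fun i => Θ (Sum.inl i)), ← line_subst] at h
  refine ⟨le_antisymm ((natDegree_line_le _ _ _).trans (totalDegree_subst_le _ _))
    (Polynomial.le_natDegree_of_ne_zero h), fun h0 => h ?_⟩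
  rw [h0, line, map_zero, Polynomial.coeff_zero]

/-- On the `z_0`-axis the images become the restrictions of `u` and `u'` to the line given by `Θ`,
which are coprime; so a common divisor `q` restricts to a unit. The restriction of `u` keeps the
full degree of `u`, so the cofactor of `q` carries all of it and `q` is constant. -/
theorem isRelPrime_subst {Θ : Param n r → F} {u u' : MvPolynomial (Fin n) F}
    (h : aeval (fun i => Θ (Sum.inr (Sum.inl i))) (topForm u) ≠ 0)
    (hres : lineRes u u' (fun i => Θ (Sum.inl i)) (fun i => Θ (Sum.inr (Sum.inl i))) ≠ 0) :
    IsRelPrime (subst Θ u) (subst Θ u') := by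
  intro q hq hq'
  have hcop : IsCoprime (line (fun i => Θ (Sum.inl i)) (fun i => Θ (Sum.inr (Sum.inl i))) u)
      (line (fun i => Θ (Sum.inl i)) (fun i => Θ (Sum.inr (Sum.inl i))) u') := by
    by_contra hc
    exact hres ((lineRes_eq_zero_iff h).2 hc)
  obtain ⟨hdeg, hne⟩ := natDegree_line_subst h
  have hqu : IsUnit (line (0 : Fin (r + 1) → F) (Pi.single 0 1) q) := by
    refine hcop.isUnit_of_dvd' ?_ ?_
    · rw [← line_subst]
      exact map_dvd _ hq
    · rw [← line_subst]
      exact map_dvd _ hq'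
  obtain ⟨w, hw⟩ := hq
  rw [hw] at hne hdeg
  have hq0 := left_ne_zero_of_mul hne
  have hw0 := right_ne_zero_of_mul hne
  have h1 : (subst Θ u).totalDegree ≤ u.totalDegree := totalDegree_subst_le Θ u
  rw [hw, totalDegree_mul_of_isDomain hq0 hw0] at h1
  have h2 := natDegree_line_le (F := F) (0 : Fin (r + 1) → F) (Pi.single 0 1) w
  have h3 : (line (0 : Fin (r + 1) → F) (Pi.single 0 1) (q * w)).natDegree ≤
      (line (0 : Fin (r + 1) → F) (Pi.single 0 1) q).natDegree + (line (0 : Fin (r + 1) → F) (Pi.single 0 1) w).natDegree := by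
    rw [line, map_mul]
    exact Polynomial.natDegree_mul_le
  rw [Polynomial.natDegree_eq_zero_of_isUnit hqu] at h3
  have h4 : q.totalDegree = 0 := by omega
  rw [totalDegree_eq_zero_iff_eq_C] at h4
  rw [h4] at hq0 ⊢
  exact IsUnit.map C (IsUnit.mk0 _ fun h0 => hq0 (by rw [h0, C_0]))

end SubstProperties

/-! ### The irreducible factors of a circuit -/

section Factors

variable {F : Type*} [Field F] {δ k s n : ℕ}

theorem card_factors_le (f : MvPolynomial (Fin n) F) :
    Multiset.card (UniqueFactorizationMonoid.factors f) ≤ f.totalDegree := by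
  rcases eq_or_ne f 0 with rfl | hf
  · simp
  have key : ∀ S : Multiset (MvPolynomial (Fin n) F), (∀ u ∈ S, Irreducible u) →
      Multiset.card S ≤ S.prod.totalDegree := by
    intro S
    induction S using Multiset.induction_on with
    | empty => simp
    | cons a S ih =>
      intro hS
      have ha := hS a (Multiset.mem_cons_self _ _)
      have hS' : ∀ u ∈ S, Irreducible u := fun u hu => hS u (Multiset.mem_cons_of_mem hu)
      rw [Multiset.card_cons, Multiset.prod_cons, totalDegree_mul_of_isDomain ha.ne_zero
        (Multiset.prod_ne_zero fun h => (hS' 0 h).ne_zero rfl)]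
      have := ih hS'
      have := totalDegree_ne_zero_of_irreducible ha
      omega
  refine (key _ fun u hu => UniqueFactorizationMonoid.irreducible_of_factor u hu).trans ?_
  exact totalDegree_le_of_dvd_of_isDomain (UniqueFactorizationMonoid.factors_prod hf).dvd hf

open Classical in
/-- The irreducible factors of the polynomials of a circuit, up to associates. -/
noncomputable def Circuit.irreducibles (C : Circuit F δ k s n) :
    Finset (MvPolynomial (Fin n) F) :=
  Finset.univ.biUnion fun x : Fin k × Fin s =>
    (UniqueFactorizationMonoid.factors (C.f x.1 x.2)).toFinset

theorem Circuit.card_irreducibles_le (C : Circuit F δ k s n) :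
    C.irreducibles.card ≤ k * s * δ := by
  classical
  refine Finset.card_biUnion_le.trans ?_
  refine (Finset.sum_le_card_nsmul _ _ δ fun x _ => ?_).trans ?_
  · exact (Multiset.toFinset_card_le _).trans ((card_factors_le _).trans (C.degree_le _ _))
  · simp

theorem Circuit.mem_irreducibles (C : Circuit F δ k s n) {u : MvPolynomial (Fin n) F}
    (hu : u ∈ C.irreducibles) : Irreducible u ∧ u.totalDegree ≤ δ := by
  classical
  obtain ⟨x, -, hx⟩ := Finset.mem_biUnion.1 hu
  rw [Multiset.mem_toFinset] at hx
  refine ⟨UniqueFactorizationMonoid.irreducible_of_factor u hx, ?_⟩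
  have h0 : C.f x.1 x.2 ≠ 0 := by
    intro h0
    rw [h0, UniqueFactorizationMonoid.factors_zero] at hx
    simp at hx
  exact (totalDegree_le_of_dvd_of_isDomain (UniqueFactorizationMonoid.dvd_of_mem_factors hx)
    h0).trans (C.degree_le _ _)

theorem Circuit.exists_mem_irreducibles (C : Circuit F δ k s n) {u : MvPolynomial (Fin n) F}
    (hu : Irreducible u) (h : ∃ i j, C.f i j ≠ 0 ∧ u ∣ C.f i j) :
    ∃ u' ∈ C.irreducibles, Associated u u' := by
  classical
  obtain ⟨i, j, h0, hd⟩ := h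
  obtain ⟨u', hu', hass⟩ := UniqueFactorizationMonoid.exists_mem_factors_of_dvd h0 hu hd
  exact ⟨u', Finset.mem_biUnion.2 ⟨(i, j), Finset.mem_univ _, Multiset.mem_toFinset.2 hu'⟩, hass⟩

/-- A sufficient condition for a substitution not to kill the polynomial computed by a circuit. -/
theorem Circuit.subst_poly_ne_zero [Infinite F] (hs : 1 ≤ s) (C : Circuit F δ k s n) {r : ℕ}
    (hr : r = rankBound F δ k s) {Θ : Param n r → F}
    (T : Finset (Fin k) → Finset (MvPolynomial (Fin n) F)) (hTr : ∀ I, (T I).card ≤ r)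
    (hTw : ∀ I : Finset (Fin k), I.Nonempty → (∀ i ∈ I, C.term i ≠ 0) →
      IsRankWitness C.f r I (T I))
    (hA : ∀ u ∈ C.irreducibles, aeval (fun i => Θ (Sum.inr (Sum.inl i))) (topForm u) ≠ 0)
    (hB : ∀ u ∈ C.irreducibles, ∀ u' ∈ C.irreducibles, ¬ u ∣ u' →
      lineRes u u' (fun i => Θ (Sum.inl i)) (fun i => Θ (Sum.inr (Sum.inl i))) ≠ 0)
    (hC : ∀ I, aeval Θ (genericJac (hTr I) fun a => ((T I).equivFin.symm a).1) ≠ 0)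
    (hpoly : C.poly ≠ 0) : subst Θ C.poly ≠ 0 := by
  refine C.map_poly_ne_zero hs (totalDegree_subst_le Θ) (fun u hu hud => ?_)
    (fun u u' hu hu' hud hud' hne => ?_) (fun I hI hI' => ⟨T I, hr ▸ hTw I hI hI', ?_⟩) hpoly
  · obtain ⟨v, hv, hass⟩ := C.exists_mem_irreducibles hu hud
    exact (hass.map (subst Θ)).ne_zero_iff.2 (natDegree_line_subst (hA v hv)).2
  · obtain ⟨v, hv, hass⟩ := C.exists_mem_irreducibles hu hud
    obtain ⟨v', hv', hass'⟩ := C.exists_mem_irreducibles hu' hud'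
    have h1 := isRelPrime_subst (hA v hv) (hB v hv v' hv' fun h =>
      hne ((hass.dvd.trans h).trans hass'.symm.dvd))
    intro q hq hq'
    exact h1 (hq.trans (hass.map (subst Θ)).dvd) (hq'.trans (hass'.map (subst Θ)).dvd)
  · have := (algebraicIndependent_subst (hTr I) (hC I)).comp _ (T I).equivFin.injective
    simpa [Function.comp_def] using this

end Factors

/-! ### Numerical estimates for `D₁` and `p_max` -/

section Counting

variable {δ k s n r : ℕ}

theorem four_mul_sq_le_D1 (hn : 1 ≤ n) (hδ : 1 ≤ δ) (hr : 1 ≤ r) :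
    4 * (δ ^ 2 * n ^ 2) ≤ D1 δ n r := by
  have h1 : 1 ≤ δ * n := Nat.mul_pos hδ hn
  calc 4 * (δ ^ 2 * n ^ 2) = (2 * δ * n) ^ 2 := by ring
    _ ≤ (2 * δ * n) ^ (2 * r) := Nat.pow_le_pow_right (by nlinarith) (by omega)

theorem succ_pow_le_D1 (hn : 1 ≤ n) (hδ : 1 ≤ δ) (hr : 1 ≤ r) :
    (n + 1) ^ (r + 1) ≤ D1 δ n r := by
  have h1 : n + 1 ≤ 2 * δ * n := by nlinarith
  calc (n + 1) ^ (r + 1) ≤ (2 * δ * n) ^ (r + 1) := Nat.pow_le_pow_left h1 _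
    _ ≤ (2 * δ * n) ^ (2 * r) := Nat.pow_le_pow_right (by omega) (by omega)

theorem two_mul_sq_add_le_D1 (hn : 1 ≤ n) (hδ : 1 ≤ δ) (hr : 1 ≤ r) :
    2 * δ ^ 2 + r * δ ≤ D1 δ n r := by
  have h2 : 2 + r ≤ 4 ^ r := by
    have := Nat.lt_pow_self (n := r) (a := 2) (by norm_num)
    have h3 : 2 ^ 1 ≤ 2 ^ r := Nat.pow_le_pow_right (by norm_num) hr
    have h4 : (4 : ℕ) ^ r = 2 ^ r * 2 ^ r := by
      rw [← mul_pow]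
      norm_num
    rw [h4]
    nlinarith
  have h5 : δ ^ 2 ≤ δ ^ (2 * r) := Nat.pow_le_pow_right hδ (by omega)
  have h6 : 1 ≤ n ^ (2 * r) := Nat.one_le_pow _ _ hn
  have h7 : D1 δ n r = 4 ^ r * δ ^ (2 * r) * n ^ (2 * r) := by
    rw [D1, mul_pow, mul_pow, pow_mul 2 2 r]
    norm_num
  calc 2 * δ ^ 2 + r * δ ≤ 2 * δ ^ 2 + r * δ ^ 2 :=
        Nat.add_le_add_left (Nat.mul_le_mul_left _ (Nat.le_self_pow (by omega) _)) _
    _ = (2 + r) * δ ^ 2 := by ring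
    _ ≤ 4 ^ r * δ ^ (2 * r) := Nat.mul_le_mul h2 h5
    _ ≤ D1 δ n r := by rw [h7]; exact Nat.le_mul_of_pos_right _ h6

/-- Here `n ≥ 2`, so `8δ(δ + 1) ≤ 16δ² ≤ D₁`, and the factor `(8δ) ^ (i + 1)` absorbs `2δ²`. -/
theorem two_mul_sq_mul_lt_D1_pow (hδ : 1 ≤ δ) (hr : 1 ≤ r) {i : ℕ} (hi : 1 ≤ i) (hin : i < n) :
    2 * δ ^ 2 * D2 δ ^ (i + 1) < D1 δ n r ^ (i + 1) := by
  have h1 : 8 * δ * D2 δ ≤ D1 δ n r := by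
    have h2 := four_mul_sq_le_D1 (n := n) (by omega) hδ hr
    have h3 : 2 ^ 2 ≤ n ^ 2 := Nat.pow_le_pow_left (by omega) 2
    rw [D2]
    nlinarith
  have h4 : 2 * δ ^ 2 < (8 * δ) ^ (i + 1) := by
    calc 2 * δ ^ 2 < (8 * δ) ^ 2 := by nlinarith
      _ ≤ (8 * δ) ^ (i + 1) := Nat.pow_le_pow_right (by omega) (by omega)
  calc 2 * δ ^ 2 * D2 δ ^ (i + 1) < (8 * δ) ^ (i + 1) * D2 δ ^ (i + 1) :=
        Nat.mul_lt_mul_of_pos_right h4 (Nat.pow_pos (by rw [D2]; omega))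
    _ = (8 * δ * D2 δ) ^ (i + 1) := (mul_pow _ _ _).symm
    _ ≤ _ := Nat.pow_le_pow_left h1 _

theorem paramWeight_le (hn : 1 ≤ n) (hδ : 1 ≤ δ) (hr : 1 ≤ r) (v : Param n r) :
    paramWeight n r (D1 δ n r) (D2 δ) v ≤ D1 δ n r ^ n := by
  have h0 := four_mul_sq_le_D1 hn hδ hr
  have hn2 : 1 ≤ n ^ 2 := Nat.one_le_pow _ _ hn
  have hD2 : D2 δ ≤ D1 δ n r := by
    rw [D2]
    nlinarith
  have hD : 1 ≤ D1 δ n r := (by rw [D2]; omega : 1 ≤ D2 δ).trans hD2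
  rcases v with i | i | ⟨i, j⟩
  · exact Nat.pow_le_pow_right hD i.2
  · exact (Nat.pow_le_pow_left hD2 _).trans (Nat.pow_le_pow_right hD i.2)
  · have hi := i.2
    have hj := j.2
    calc (i.val + 1) * (n + 1) ^ (j.val + 1) ≤ (n + 1) * (n + 1) ^ r :=
          Nat.mul_le_mul (by omega) (Nat.pow_le_pow_right (by omega) (by omega))
      _ = (n + 1) ^ (r + 1) := by ring
      _ ≤ D1 δ n r := succ_pow_le_D1 hn hδ hr
      _ ≤ D1 δ n r ^ n := Nat.le_self_pow (by omega) _

/-- `2 n L` bounds the binary length of the weights, and the bracket counts the monomials of all top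
forms, resultants and Jacobian determinants; `4 n r` bounds the number of parameters plus one. The
right-hand side is the square root of `p_max - 1` when `L = ⌈log₂ D₁⌉`. -/
theorem count_le (hn : 1 ≤ n) (hδ : 1 ≤ δ) (hk : 1 ≤ k) (hs : 1 ≤ s) (hr : 1 ≤ r) (L : ℕ) :
    2 * n * L * (k * s * δ * (4 * n * r) ^ (2 * δ ^ 2) +
      (k * s * δ * (k * s * δ) * (4 * n * r) ^ (2 * δ ^ 2) + 2 ^ k * (4 * n * r) ^ (r * δ))) ≤
    2 ^ (k + 1) * (2 * k * r * s * n * δ ^ 2) ^ (4 * δ ^ 2 + 2 * δ * r) * L := by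
  set x := 2 * k * r * s * n * δ ^ 2 with hx
  have hks : 1 ≤ k * s := Nat.mul_pos hk hs
  have hδ2 : 1 ≤ δ ^ 2 := Nat.one_le_pow _ _ hδ
  have hnr : 1 ≤ n * r := Nat.mul_pos hn hr
  have hx1 : 2 * (n * r) ≤ x := by
    calc 2 * (n * r) ≤ 2 * (n * r) * (k * s * δ ^ 2) :=
          Nat.le_mul_of_pos_right _ (Nat.mul_pos hks hδ2)
      _ = x := by rw [hx]; ring
  have hx0 : 1 ≤ x := by omega
  have h4 : 4 * n * r ≤ x ^ 2 := by nlinarith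
  have ha : (4 * n * r) ^ (2 * δ ^ 2) ≤ x ^ (4 * δ ^ 2) := by
    refine (Nat.pow_le_pow_left h4 _).trans_eq ?_
    rw [← pow_mul]
    ring_nf
  have hb : (4 * n * r) ^ (r * δ) ≤ x ^ (2 * δ * r) := by
    refine (Nat.pow_le_pow_left h4 _).trans_eq ?_
    rw [← pow_mul]
    ring_nf
  have hxx : x ^ 2 ≤ x ^ (2 * δ * r) := by
    refine Nat.pow_le_pow_right hx0 ?_
    have : 1 ≤ δ * r := Nat.mul_pos hδ hr
    nlinarith
  have hksδ : k * s * δ ≤ k * s * δ * (k * s * δ) := Nat.le_mul_of_pos_right _ (by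
    exact Nat.mul_pos hks hδ)
  have h5 : 2 * n * (2 * (k * s * δ * (k * s * δ))) ≤ x ^ 2 := by
    have : x ^ 2 = 2 * n * (2 * (k * s * δ * (k * s * δ))) * (n * r ^ 2 * δ ^ 2) := by
      rw [hx]
      ring
    rw [this]
    exact Nat.le_mul_of_pos_right _ (by positivity)
  have h6 : 2 * n ≤ x := by nlinarith
  have hfirst : 2 * n * (k * s * δ * (4 * n * r) ^ (2 * δ ^ 2) +
      k * s * δ * (k * s * δ) * (4 * n * r) ^ (2 * δ ^ 2)) ≤ x ^ (4 * δ ^ 2 + 2 * δ * r) := by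
    calc _ = 2 * n * (k * s * δ + k * s * δ * (k * s * δ)) * (4 * n * r) ^ (2 * δ ^ 2) := by ring
      _ ≤ 2 * n * (2 * (k * s * δ * (k * s * δ))) * x ^ (4 * δ ^ 2) :=
        Nat.mul_le_mul (Nat.mul_le_mul_left _ (by omega)) ha
      _ ≤ x ^ (2 * δ * r) * x ^ (4 * δ ^ 2) := Nat.mul_le_mul_right _ (h5.trans hxx)
      _ = _ := by rw [← pow_add, add_comm]
  have hsecond : 2 * n * (2 ^ k * (4 * n * r) ^ (r * δ)) ≤
      2 ^ k * x ^ (4 * δ ^ 2 + 2 * δ * r) := by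
    calc _ = 2 ^ k * (2 * n * (4 * n * r) ^ (r * δ)) := by ring
      _ ≤ 2 ^ k * (x ^ (4 * δ ^ 2) * x ^ (2 * δ * r)) := by
        refine Nat.mul_le_mul_left _ (Nat.mul_le_mul (h6.trans ?_) hb)
        exact Nat.le_self_pow (by positivity) _
      _ = _ := by rw [← pow_add]
  have hone : 1 ≤ 2 ^ k := Nat.one_le_two_pow
  calc _ = (2 * n * (k * s * δ * (4 * n * r) ^ (2 * δ ^ 2) +
      k * s * δ * (k * s * δ) * (4 * n * r) ^ (2 * δ ^ 2)) +
      2 * n * (2 ^ k * (4 * n * r) ^ (r * δ))) * L := by ring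
    _ ≤ (2 ^ k * x ^ (4 * δ ^ 2 + 2 * δ * r) + 2 ^ k * x ^ (4 * δ ^ 2 + 2 * δ * r)) * L :=
      Nat.mul_le_mul_right _ (add_le_add (hfirst.trans (Nat.le_mul_of_pos_left _ hone)) hsecond)
    _ = _ := by ring

end Counting

/-! ### Choice of `p` and `c` -/

section Assembly

variable {F : Type*} [Field F] {δ k s n r : ℕ}

/-- Some substitution of the prescribed form does not kill the polynomial computed by a circuit. -/
theorem Circuit.exists_subst_ne_zero [Infinite F] (hn : 1 ≤ n) (hδ : 1 ≤ δ) (hk : 1 ≤ k)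
    (hs : 1 ≤ s) (C : Circuit F δ k s n) (hr : r = rankBound F δ k s)
    (hchar : ringChar F = 0 ∨ δ ^ r < ringChar F) (hpoly : C.poly ≠ 0) :
    ∃ p, 1 ≤ p ∧ p ≤ pMax δ k s n r ∧ ∃ c : F,
      subst (fun v => c ^ (paramWeight n r (D1 δ n r) (D2 δ) v % p)) C.poly ≠ 0 := by
  classical
  have hr1 : 1 ≤ r := hr ▸ (rankBound_spec F δ k s).1
  choose T hTr hTi hTd hTw using C.exists_isRankWitness r
  let w := paramWeight n r (D1 δ n r) (D2 δ)
  let U := C.irreducibles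
  let G : U ⊕ (U × U) ⊕ Finset (Fin k) → MvPolynomial (Param n r) F :=
    Sum.elim (fun u => rename (fun i => Sum.inr (Sum.inl i)) (topForm u.1))
      (Sum.elim (fun x => if x.1.1 ∣ x.2.1 then 1 else
          rename (Sum.map id Sum.inl) (genericRes x.1.1 x.2.1))
        fun I => genericJac (hTr I) fun a => ((T I).equivFin.symm a).1)
  let Δ : U ⊕ (U × U) ⊕ Finset (Fin k) → ℕ :=
    Sum.elim (fun _ => 2 * δ ^ 2) (Sum.elim (fun _ => 2 * δ ^ 2) fun _ => r * δ)
  have h4D := four_mul_sq_le_D1 hn hδ hr1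
  have hδ2 : δ ≤ δ ^ 2 := Nat.le_self_pow (by omega) _
  have hδD : 2 * δ ^ 2 < D1 δ n r := by
    have : 1 ≤ n ^ 2 := Nat.one_le_pow _ _ hn
    nlinarith
  have hΔ : ∀ l, (G l).totalDegree ≤ Δ l := by
    rintro (u | ⟨u, u'⟩ | I)
    · refine (totalDegree_rename_le _ _).trans ((totalDegree_topForm_le _).trans ?_)
      have := (C.mem_irreducibles u.2).2
      change _ ≤ 2 * δ ^ 2
      omega
    · change (if u.1 ∣ u'.1 then 1 else rename (Sum.map id Sum.inl) (genericRes u.1 u'.1) :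
        MvPolynomial (Param n r) F).totalDegree ≤ 2 * δ ^ 2
      split_ifs
      · rw [totalDegree_one]
        exact Nat.zero_le _
      · refine (totalDegree_rename_le _ _).trans ((totalDegree_genericRes_le _ _).trans ?_)
        rw [pow_two]
        exact Nat.mul_le_mul_left _
          (Nat.mul_le_mul (C.mem_irreducibles u.2).2 (C.mem_irreducibles u'.2).2)
    · refine (totalDegree_genericJac_le (hTr I) hδ fun a => hTd I _ (Subtype.coe_prop _)).trans ?_
      exact Nat.mul_le_mul_right _ (hTr I)
  have hG : ∀ l, kron w (G l) ≠ 0 := by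
    rintro (u | ⟨u, u'⟩ | I)
    · change kron w (rename (fun i => Sum.inr (Sum.inl i)) (topForm u.1)) ≠ 0
      rw [kron_rename]
      refine kron_pow_ne_zero (topForm_ne_zero (C.mem_irreducibles u.2).1.ne_zero) ?_
      rw [D2, Nat.lt_succ_iff]
      exact (totalDegree_topForm_le _).trans (C.mem_irreducibles u.2).2
    · change kron w (if u.1 ∣ u'.1 then 1 else
        rename (Sum.map id Sum.inl) (genericRes u.1 u'.1)) ≠ 0
      split_ifs with h
      · rw [map_one]
        exact one_ne_zero
      · rw [kron_rename]
        have hw : w ∘ Sum.map id Sum.inl = lineWeight n (D1 δ n r) (D2 δ) := by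
          funext v
          rcases v with i | i <;> rfl
        have hdd : u.1.totalDegree * u'.1.totalDegree ≤ δ ^ 2 := by
          rw [pow_two]
          exact Nat.mul_le_mul (C.mem_irreducibles u.2).2 (C.mem_irreducibles u'.2).2
        rw [hw]
        refine kron_genericRes_ne_zero (C.mem_irreducibles u.2).1 h ?_ ?_ fun i hi hin => ?_
        · rw [D2, Nat.lt_succ_iff]
          exact (C.mem_irreducibles u.2).2
        · omega
        · refine lt_of_le_of_lt ?_ (two_mul_sq_mul_lt_D1_pow hδ hr1 hi hin)
          exact Nat.mul_le_mul_right _ (Nat.mul_le_mul_left _ hdd)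
    · refine kron_genericJac_ne_zero (hTr I) ((hTi I).comp _ (T I).equivFin.symm.injective) hδ
        (fun a => hTd I _ (Subtype.coe_prop _)) (hchar.imp id fun h => ?_) ?_ ?_
      · exact (Nat.pow_le_pow_right hδ (hTr I)).trans_lt h
      · have h1 := two_mul_sq_add_le_D1 hn hδ hr1
        have h2 : (T I).card * δ ≤ r * δ := Nat.mul_le_mul_right _ (hTr I)
        have h3 : 1 ≤ δ ^ 2 := Nat.one_le_pow _ _ hδ
        omega
      · exact (Nat.pow_le_pow_right (by omega) (Nat.succ_le_succ (hTr I))).trans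
          (succ_pow_le_D1 hn hδ hr1)
  let L := Nat.clog 2 (D1 δ n r)
  have hL : 1 ≤ L := by
    refine Nat.clog_pos (by norm_num) ?_
    have : 1 ≤ n ^ 2 := Nat.one_le_pow _ _ hn
    nlinarith
  have hDL : D1 δ n r ≤ 2 ^ L := Nat.le_pow_clog (by norm_num) _
  have hB : ∀ l, ∀ m ∈ (G l).support, Finsupp.weight w m ≤ 2 ^ (2 * n * L) := by
    intro l m hm
    have h1 := weight_le (paramWeight_le hn hδ hr1) (hΔ l) hm
    have h2 : Δ l ≤ D1 δ n r := by
      have h1 := two_mul_sq_add_le_D1 hn hδ hr1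
      rcases l with u | x | I
      · change 2 * δ ^ 2 ≤ _
        omega
      · change 2 * δ ^ 2 ≤ _
        omega
      · change r * δ ≤ _
        omega
    calc Finsupp.weight w m ≤ D1 δ n r * D1 δ n r ^ n := h1.trans (Nat.mul_le_mul_right _ h2)
      _ = D1 δ n r ^ (n + 1) := by ring
      _ ≤ (2 ^ L) ^ (n + 1) := Nat.pow_le_pow_left hDL _
      _ = 2 ^ (L * (n + 1)) := (pow_mul _ _ _).symm
      _ ≤ 2 ^ (2 * n * L) := Nat.pow_le_pow_right (by norm_num) (by nlinarith)
  let N : U ⊕ (U × U) ⊕ Finset (Fin k) → ℕ := fun l => (4 * n * r) ^ Δ l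
  have hN : ∀ l, (G l).support.card ≤ N l := by
    intro l
    refine (card_support_le (hΔ l)).trans (Nat.pow_le_pow_left ?_ _)
    simp only [Fintype.card_sum, Fintype.card_prod, Fintype.card_fin]
    nlinarith [Nat.mul_le_mul hn hr1, Nat.mul_le_mul_left n hr1]
  let x := 2 * k * r * s * n * δ ^ 2
  let M := 2 ^ (k + 1) * x ^ (4 * δ ^ 2 + 2 * δ * r) * L
  have hsumN : ∑ l, N l ≤ k * s * δ * (4 * n * r) ^ (2 * δ ^ 2) +
      (k * s * δ * (k * s * δ) * (4 * n * r) ^ (2 * δ ^ 2) + 2 ^ k * (4 * n * r) ^ (r * δ)) := by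
    rw [Fintype.sum_sum_type, Fintype.sum_sum_type]
    have hU : Fintype.card U ≤ k * s * δ := by
      rw [Fintype.card_coe]
      exact C.card_irreducibles_le
    have e1 : ∑ u, N (Sum.inl u) = Fintype.card U * (4 * n * r) ^ (2 * δ ^ 2) := by
      simp only [N, Δ, Sum.elim_inl, Finset.sum_const, Finset.card_univ, smul_eq_mul]
    have e2 : ∑ u, N (Sum.inr (Sum.inl u)) =
        Fintype.card U * Fintype.card U * (4 * n * r) ^ (2 * δ ^ 2) := by
      simp only [N, Δ, Sum.elim_inl, Sum.elim_inr, Finset.sum_const, Finset.card_univ, smul_eq_mul,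
        Fintype.card_prod]
    have e3 : ∑ u, N (Sum.inr (Sum.inr u)) = 2 ^ k * (4 * n * r) ^ (r * δ) := by
      simp only [N, Δ, Sum.elim_inr, Finset.sum_const, Finset.card_univ, smul_eq_mul,
        Fintype.card_finset, Fintype.card_fin]
    rw [e1, e2, e3]
    exact add_le_add (Nat.mul_le_mul_right _ hU)
      (add_le_add (Nat.mul_le_mul_right _ (Nat.mul_le_mul hU hU)) le_rfl)
  have hx0 : 1 ≤ x := by
    simp only [x]
    have : 0 < 2 * k * r * s * n * δ ^ 2 := by positivity
    omega
  have hM4 : 4 ≤ M := by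
    have h1 : 2 ^ 2 ≤ 2 ^ (k + 1) := Nat.pow_le_pow_right (by norm_num) (by omega)
    have h2 : 1 ≤ x ^ (4 * δ ^ 2 + 2 * δ * r) := Nat.one_le_pow _ _ hx0
    calc 4 = 2 ^ 2 * 1 * 1 := by norm_num
      _ ≤ M := Nat.mul_le_mul (Nat.mul_le_mul h1 h2) hL
  obtain ⟨p, hp1, hpM, hp⟩ := exists_mod_kron_ne_zero G hG N hM4 hB hN
    ((Nat.mul_le_mul_left _ hsumN).trans (count_le hn hδ hk hs hr1 L))
  -- `p_max` is `M ^ 2 + 1`, while the argument gives `p ≤ 2 M`.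
  have hpmax : p ≤ pMax δ k s n r := by
    have h1 : pMax δ k s n r = M ^ 2 + 1 := by
      rw [pMax, show 8 * δ ^ 2 + 4 * δ * r = (4 * δ ^ 2 + 2 * δ * r) * 2 by ring, mul_comm 2 (k + 1),
        pow_mul, pow_mul, ← mul_pow, ← mul_pow]
    rw [h1]
    nlinarith
  refine ⟨p, hp1, hpmax, ?_⟩
  obtain ⟨c, hc⟩ : ∃ c : F, (∏ l, kron (fun v => w v % p) (G l)).eval c ≠ 0 := by
    by_contra! h
    exact Finset.prod_ne_zero_iff.2 (fun l _ => hp l) (Polynomial.funext fun c => by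
      rw [h c, Polynomial.eval_zero])
  rw [Polynomial.eval_prod, Finset.prod_ne_zero_iff] at hc
  refine ⟨c, ?_⟩
  set Θ : Param n r → F := fun v => c ^ (w v % p) with hΘ
  have hev : ∀ l, aeval Θ (G l) ≠ 0 := by
    intro l
    have := hc l (Finset.mem_univ _)
    rw [eval_kron] at this
    exact this
  refine C.subst_poly_ne_zero hs hr T hTr hTw (fun u hu => ?_) (fun u hu u' hu' hd => ?_)
    (fun I => hev (Sum.inr (Sum.inr I))) hpoly
  · have := hev (Sum.inl ⟨u, hu⟩)
    simp only [G, Sum.elim_inl] at this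
    rwa [aeval_rename] at this
  · have := hev (Sum.inr (Sum.inl (⟨u, hu⟩, ⟨u', hu'⟩)))
    simp only [G, Sum.elim_inl, Sum.elim_inr, if_neg hd] at this
    rw [aeval_rename, aeval_genericRes] at this
    exact this

end Assembly

/-! ### Extension of scalars, and passage to points of the hitting set -/

theorem natDegree_aeval_le {F σ : Type*} [Field F] {s : σ → Polynomial F} {W : ℕ}
    (hs : ∀ v, (s v).natDegree ≤ W) {P : MvPolynomial σ F} {Δ : ℕ} (hP : P.totalDegree ≤ Δ) :
    (aeval s P).natDegree ≤ Δ * W := by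
  have key : aeval s P ∈ (fun k : ℕ => Polynomial.degreeLE F k) (Δ * W) := by
    refine aeval_mem_filtration (fun k : ℕ => Polynomial.degreeLE F k) ?_ ?_ ?_ ?_ hP
    · intro i j hij
      exact Polynomial.degreeLE_mono (by exact_mod_cast hij)
    · rw [Polynomial.mem_degreeLE]
      exact Polynomial.degree_one_le
    · intro i j a b ha hb
      rw [Polynomial.mem_degreeLE, ← Polynomial.natDegree_le_iff_degree_le] at *
      exact Polynomial.natDegree_mul_le.trans (Nat.add_le_add ha hb)
    · intro v
      rw [Polynomial.mem_degreeLE, ← Polynomial.natDegree_le_iff_degree_le]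
      exact hs v
  exact Polynomial.natDegree_le_iff_degree_le.2 (Polynomial.mem_degreeLE.1 key)

/-- The circuit obtained by extension of scalars. -/
noncomputable def Circuit.map {K : Type*} (F : Type*) [Field K] [Field F] [Algebra K F]
    {δ k s n : ℕ} (C : Circuit K δ k s n) : Circuit F δ k s n where
  f i j := MvPolynomial.map (algebraMap K F) (C.f i j)
  degree_le i j := (Finset.sup_mono (support_map_subset _ _)).trans (C.degree_le i j)

theorem Circuit.poly_map {K : Type*} (F : Type*) [Field K] [Field F] [Algebra K F]
    {δ k s n : ℕ} (C : Circuit K δ k s n) :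
    (C.map F).poly = MvPolynomial.map (algebraMap K F) C.poly := by
  simp [Circuit.poly, Circuit.term, Circuit.map]

theorem Circuit.totalDegree_poly_le {F : Type*} [Field F] {δ k s n : ℕ} (C : Circuit F δ k s n) :
    C.poly.totalDegree ≤ δ * s := by
  refine totalDegree_finsetSum_le fun i _ => (totalDegree_finsetProd _ _).trans ?_
  refine (Finset.sum_le_sum fun j _ => C.degree_le i j).trans ?_
  simp [mul_comm]

theorem map_subst {F L : Type*} [Field F] [Field L] [Algebra F L] {n r D₁ D₂ p : ℕ} (c : F)
    (u : MvPolynomial (Fin n) F) :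
    MvPolynomial.map (algebraMap F L) (subst (fun v => c ^ (paramWeight n r D₁ D₂ v % p)) u) =
      aeval (psi n r D₁ D₂ p (algebraMap F L c)) u := by
  have : (MvPolynomial.mapAlgHom (Algebra.ofId F L)).comp
      (subst (fun v => c ^ (paramWeight n r D₁ D₂ v % p))) =
      aeval (psi n r D₁ D₂ p (algebraMap F L c)) := by
    refine algHom_ext fun i => ?_
    rw [AlgHom.comp_apply, subst, aeval_X, aeval_X]
    simp [psi, paramWeight, Algebra.ofId]
  exact DFunLike.congr_fun this u

/-- The points of the hitting set do not all annihilate a circuit. -/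
theorem isHittingSet_hittingSet {K F L : Type*} [Field K] [Field F] [Field L] [Algebra K F]
    [Algebra F L] [Algebra K L] [IsScalarTower K F L] [Infinite F] {n δ k s r : ℕ} (hn : 1 ≤ n)
    (hδ : 1 ≤ δ) (hk : 1 ≤ k) (hs : 1 ≤ s) (hr : r = rankBound F δ k s)
    (hchar : ringChar K = 0 ∨ δ ^ r < ringChar K) (h₁ : Fin (size1 δ k s n r) ↪ L)
    (h₂ : Fin (size2 δ s) ↪ L) :
    IsHittingSet K δ k s n (hittingSet δ k s n r (Set.range h₁) (Set.range h₂)) := by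
  classical
  intro C hC
  rw [Algebra.ringChar_eq K F] at hchar
  have hCF : (C.map F).poly ≠ 0 := by
    rw [Circuit.poly_map]
    exact (map_ne_zero_iff _ (map_injective _ (algebraMap K F).injective)).2 hC
  -- The rank bound refers to `F`, so the substitution is found over `F`. Its `c₀` need not lie in
  -- `H₁`; it only witnesses that a polynomial in `c` is nonzero.
  obtain ⟨p, hp1, hpmax, c₀, hc₀⟩ := (C.map F).exists_subst_ne_zero hn hδ hk hs hr hchar hCF
  let G : MvPolynomial (Fin n) L := (C.map L).poly
  let Ψ : L → Fin n → MvPolynomial (Fin (r + 1)) L := psi n r (D1 δ n r) (D2 δ) p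
  have hG : G.totalDegree ≤ δ * s := (C.map L).totalDegree_poly_le
  have hGK : G = MvPolynomial.map (algebraMap K L) C.poly := C.poly_map L
  have hGF : G = MvPolynomial.map (algebraMap F L) (C.map F).poly := by
    rw [hGK, Circuit.poly_map, map_map, IsScalarTower.algebraMap_eq K F L]
  have hS : aeval (Ψ (algebraMap F L c₀)) G = MvPolynomial.map (algebraMap F L)
      (subst (fun v => c₀ ^ (paramWeight n r (D1 δ n r) (D2 δ) v % p)) (C.map F).poly) := by
    rw [map_subst, hGF, aeval_map_algebraMap]
  have hS0 : aeval (Ψ (algebraMap F L c₀)) G ≠ 0 := by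
    rw [hS]
    exact (map_ne_zero_iff _ (map_injective _ (algebraMap F L).injective)).2 hc₀
  have hSdeg : (aeval (Ψ (algebraMap F L c₀)) G).totalDegree ≤ δ * s := by
    rw [hS]
    exact (Finset.sup_mono (support_map_subset _ _)).trans ((totalDegree_subst_le _ _).trans
      (Circuit.totalDegree_poly_le _))
  obtain ⟨a, ha, hSa⟩ : ∃ a : Fin (r + 1) → L, (∀ j, a j ∈ Set.range h₂) ∧
      eval a (aeval (Ψ (algebraMap F L c₀)) G) ≠ 0 := by
    by_contra! hcon
    refine hS0 (eq_zero_of_eval_zero_at_prod_finset _ (fun _ => Finset.univ.map h₂)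
      (fun i => ?_) fun x hx => hcon x fun j => ?_)
    · rw [Finset.card_map, Finset.card_univ, Fintype.card_fin, size2, Nat.lt_succ_iff]
      exact (degreeOf_le_totalDegree _ _).trans hSdeg
    · simpa using hx j
  -- With `p` and `a` fixed, the point moves on a curve of degree at most `p` in `c`. On it the
  -- circuit has degree at most `δ s p_max`, which is less than the size of `H₁`.
  let e : Fin n → Polynomial L := fun i =>
    Polynomial.X ^ (D1 δ n r ^ (i.val + 1) % p) +
      Polynomial.X ^ (D2 δ ^ (i.val + 1) % p) * Polynomial.C (a 0) +
      ∑ j : Fin r, Polynomial.X ^ (((i.val + 1) * (n + 1) ^ (j.val + 1)) % p) *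
        Polynomial.C (a j.succ)
  have heval : ∀ c i, (e i).eval c = eval a (Ψ c i) := by
    intro c i
    simp only [e, Ψ, psi, Polynomial.eval_finsetSum, Polynomial.eval_add, Polynomial.eval_mul,
      Polynomial.eval_pow, Polynomial.eval_X, Polynomial.eval_C, map_add, map_mul, map_sum, eval_C,
      eval_X]
  have hevalG : ∀ c, (aeval e G).eval c = aeval (fun i => eval a (Ψ c i)) G := by
    intro c
    rw [← Polynomial.coe_aeval_eq_eval, ← AlgHom.comp_apply, comp_aeval]
    simp only [Polynomial.coe_aeval_eq_eval, heval]
  have hne : aeval e G ≠ 0 := by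
    intro h0
    apply hSa
    have h1 := hevalG (algebraMap F L c₀)
    rw [h0, Polynomial.eval_zero] at h1
    have h2 : (aeval (R := L) a).comp (aeval (Ψ (algebraMap F L c₀))) =
        aeval fun i => eval a (Ψ (algebraMap F L c₀) i) := by
      rw [comp_aeval]
      rfl
    have h3 := DFunLike.congr_fun h2 G
    rw [← h1] at h3
    exact h3
  have hedeg : ∀ i, (e i).natDegree ≤ p := by
    intro i
    have hX : ∀ (x : ℕ) (y : L), (Polynomial.X ^ (x % p) * Polynomial.C y).natDegree ≤ p :=
      fun x y => (Polynomial.natDegree_mul_C_le _ _).trans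
        ((Polynomial.natDegree_X_pow_le _).trans (Nat.mod_lt _ hp1).le)
    refine Polynomial.natDegree_add_le_of_degree_le (Polynomial.natDegree_add_le_of_degree_le
      ?_ (hX _ _)) (Polynomial.natDegree_sum_le_of_forall_le _ _ fun j _ => hX _ _)
    exact (Polynomial.natDegree_X_pow_le _).trans (Nat.mod_lt _ hp1).le
  obtain ⟨c, hc⟩ : ∃ x, (aeval e G).eval (h₁ x) ≠ 0 := by
    by_contra! hcon
    refine hne (Polynomial.eq_zero_of_natDegree_lt_card_of_eval_eq_zero _ h₁.injective hcon ?_)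
    rw [Fintype.card_fin]
    have hr1 : 1 ≤ r := hr ▸ (rankBound_spec F δ k s).1
    have hpm : 1 ≤ pMax δ k s n r := hp1.trans hpmax
    have h4 : 1 < 2 ^ (k + 2) * k ^ 2 * r * s * δ ^ 3 := by
      have h5 : 2 ^ 1 ≤ 2 ^ (k + 2) := Nat.pow_le_pow_right (by norm_num) (by omega)
      have h6 : 0 < k ^ 2 * r * s * δ ^ 3 := by positivity
      calc 1 < 2 ^ (k + 2) := by omega
        _ ≤ 2 ^ (k + 2) * (k ^ 2 * r * s * δ ^ 3) := Nat.le_mul_of_pos_right _ h6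
        _ = _ := by ring
    have h7 : 0 < δ * s * pMax δ k s n r := by positivity
    calc (aeval e G).natDegree ≤ δ * s * p := natDegree_aeval_le hedeg hG
      _ ≤ δ * s * pMax δ k s n r := Nat.mul_le_mul_left _ hpmax
      _ < δ * s * pMax δ k s n r * (2 ^ (k + 2) * k ^ 2 * r * s * δ ^ 3) :=
        (Nat.lt_mul_iff_one_lt_right h7).2 h4
      _ = size1 δ k s n r := by
        rw [size1]
        ring
  refine ⟨fun i => eval a (Ψ (h₁ c) i), ⟨p, hp1, hpmax, h₁ c, ⟨c, rfl⟩, a, ha, rfl⟩, ?_⟩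
  rw [hevalG, hGK, aeval_map_algebraMap] at hc
  exact hc

/-! ### Compiling expressions and loops into register programs -/

section Machine

variable {L : Type*} [Field L]

/-- A straight-line program. -/
def block : List Instr → Program
  | [] => .skip
  | i :: is => .seq (.instr i) (block is)

theorem run_block (is : List Instr) (σ : State L) :
    Run (block is) σ (is.length + 1) (is.foldl (fun τ i => i.exec τ) σ) := by
  induction is generalizing σ with
  | nil => exact Run.skip σ
  | cons i is ih =>
    have := Run.seq (Run.instr i σ) (ih (i.exec σ))
    rwa [Nat.add_comm 1] at this

/-- The memory for field elements is `fm`, and the registers start with `l`. -/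
def Env (fm : ℕ → L) (l : List ℕ) (σ : State L) : Prop :=
  σ.fmem = fm ∧ ∀ (i v : ℕ), l[i]? = some v → σ.reg i = v

variable {fm : ℕ → L} {l l' : List ℕ} {σ τ : State L}

theorem Env.of_prefix (h : Env fm l' σ) (hl : l <+: l') : Env fm l σ := by
  refine ⟨h.1, fun i v hv => h.2 i v ?_⟩
  obtain ⟨m, rfl⟩ := hl
  have hi : i < l.length := by
    by_contra hc
    rw [List.getElem?_eq_none (by omega)] at hv
    exact absurd hv (by simp)
  rw [List.getElem?_append_left hi, hv]

theorem Env.congr (h : Env fm l σ) (hfm : τ.fmem = σ.fmem)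
    (hreg : ∀ i < l.length, τ.reg i = σ.reg i) : Env fm l τ := by
  refine ⟨hfm.trans h.1, fun i v hv => ?_⟩
  have hi : i < l.length := by
    by_contra hc
    rw [List.getElem?_eq_none (by omega)] at hv
    exact absurd hv (by simp)
  rw [hreg i hi]
  exact h.2 i v hv

/-- The registers serve as a stack. An expression compiled at height `b` leaves its value in
register `b`, preserves the registers below, and may overwrite those above. -/
theorem env_snoc {v : ℕ} : Env fm (l ++ [v]) σ ↔ Env fm l σ ∧ σ.reg l.length = v := by
  constructor
  · exact fun h => ⟨h.of_prefix (List.prefix_append _ _), h.2 _ _ (by simp)⟩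
  · rintro ⟨h, hv⟩
    refine ⟨h.1, fun i w hw => ?_⟩
    rcases lt_trichotomy i l.length with hi | hi | hi
    · rw [List.getElem?_append_left hi] at hw
      exact h.2 i w hw
    · subst hi
      rw [List.getElem?_append_right le_rfl] at hw
      simp only [Nat.sub_self, List.getElem?_cons_zero, Option.some.injEq] at hw
      rw [hv, hw]
    · rw [List.getElem?_eq_none (by simp; omega)] at hw
      exact absurd hw (by simp)

/-- `e l.length` computes `v` in register `l.length` within `T` steps, whenever the registers start
with `l`. -/
def EvalsAt (fm : ℕ → L) (e : ℕ → Program) (l : List ℕ) (v T : ℕ) : Prop :=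
  ∀ σ : State L, Env fm l σ → ∃ t ≤ T, ∃ τ, Run (e l.length) σ t τ ∧ Env fm (l ++ [v]) τ ∧
    τ.freg = σ.freg ∧ τ.out = σ.out

/-- `e` computes `v` within `W ^ j` steps, whenever the registers start with an extension of
`l`. -/
def Evals (fm : ℕ → L) (W j : ℕ) (e : ℕ → Program) (l : List ℕ) (v : ℕ) : Prop :=
  ∀ l', l <+: l' → EvalsAt fm e l' v (W ^ j)

theorem Evals.extend {W j : ℕ} {e : ℕ → Program} {v : ℕ} (h : Evals fm W j e l v)
    (hl : l <+: l') : Evals fm W j e l' v := fun l'' h' => h l'' (hl.trans h')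

theorem Evals.mono {W j j' : ℕ} {e : ℕ → Program} {v : ℕ} (h : Evals fm W j e l v) (hW : 64 ≤ W)
    (hj : j ≤ j') : Evals fm W j' e l v := by
  intro l' hl σ hσ
  obtain ⟨t, ht, h'⟩ := h l' hl σ hσ
  exact ⟨t, ht.trans (Nat.pow_le_pow_right (by omega) hj), h'⟩

/-- The constant `c`. -/
def constE (c : ℕ) : ℕ → Program := fun b => .instr (.const b c)

/-- The content of register `i`. -/
def varE (i : ℕ) : ℕ → Program := fun b => block [.const b 0, .add b i b]

/-- The sum of two expressions. -/
def addE (e₁ e₂ : ℕ → Program) : ℕ → Program := fun b =>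
  .seq (e₁ b) (.seq (e₂ (b + 1)) (.instr (.add b b (b + 1))))

/-- The truncated difference of two expressions. -/
def subE (e₁ e₂ : ℕ → Program) : ℕ → Program := fun b =>
  .seq (e₁ b) (.seq (e₂ (b + 1)) (.instr (.sub b b (b + 1))))

/-- Case distinction. -/
def iteE (e₁ e₂ e₃ : ℕ → Program) : ℕ → Program := fun b =>
  .seq (e₁ b) (.ite b (e₂ b) (e₃ b))

/-- Iteration: the accumulator (register `b`) starts with the value of `e₀` and is replaced as often
as `eN` says by the value of `body b (b + 2)`, where register `b + 2` counts the repetitions. -/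
def iterE (eN e₀ : ℕ → Program) (body : ℕ → ℕ → ℕ → Program) : ℕ → Program := fun b =>
  .seq (e₀ b) (.seq (eN (b + 1)) (.seq (.instr (.const (b + 2) 0))
    (.loop (b + 1) (.seq (body b (b + 2) (b + 3))
      (block [.const b 0, .add b b (b + 3), .const (b + 3) 1, .add (b + 2) (b + 2) (b + 3),
        .sub (b + 1) (b + 1) (b + 3)])))))

variable {W : ℕ}

theorem evals_const (hW : 64 ≤ W) (c : ℕ) : Evals fm W 1 (constE c) l c := by
  intro l' _ σ hσ
  refine ⟨1, by rw [pow_one]; omega, _, Run.instr _ _, env_snoc.2 ⟨hσ.congr rfl fun i hi => ?_, ?_⟩,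
    rfl, rfl⟩
  · simp [Instr.exec, Function.update_of_ne (Nat.ne_of_lt hi)]
  · simp [Instr.exec]

theorem evals_var (hW : 64 ≤ W) {i v : ℕ} (h : l[i]? = some v) : Evals fm W 1 (varE i) l v := by
  intro l' hl σ hσ
  have hi : i < l.length := by
    by_contra hc
    rw [List.getElem?_eq_none (by omega)] at h
    exact absurd h (by simp)
  have hi' : i ≠ l'.length := (hi.trans_le hl.length_le).ne
  have hv := (hσ.of_prefix hl).2 i v h
  refine ⟨3, by rw [pow_one]; omega, _, run_block _ _,
    env_snoc.2 ⟨hσ.congr rfl fun i hi => ?_, ?_⟩, rfl, rfl⟩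
  · simp [Instr.exec, Function.update_of_ne (Nat.ne_of_lt hi)]
  · simp [Instr.exec, Function.update_of_ne hi', hv]

/-- Costs are recorded as powers of `W`. One further factor `W ≥ 64` absorbs both the sum of two
costs and the constant overhead of a construct. -/
theorem pow_bound (hW : 64 ≤ W) {j t₁ t₂ : ℕ} (h₁ : t₁ ≤ W ^ j) (h₂ : t₂ ≤ W ^ j) :
    t₁ + t₂ + 10 ≤ W ^ (j + 1) := by
  have h : 1 ≤ W ^ j := Nat.one_le_pow _ _ (by omega)
  rw [pow_succ]
  nlinarith

theorem evals_add (hW : 64 ≤ W) {j v₁ v₂ : ℕ} {e₁ e₂ : ℕ → Program} (h₁ : Evals fm W j e₁ l v₁)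
    (h₂ : Evals fm W j e₂ l v₂) : Evals fm W (j + 1) (addE e₁ e₂) l (v₁ + v₂) := by
  intro l' hl σ hσ
  obtain ⟨t₁, ht₁, σ₁, r₁, hσ₁, hf₁, ho₁⟩ := h₁ l' hl σ hσ
  obtain ⟨t₂, ht₂, σ₂, r₂, hσ₂, hf₂, ho₂⟩ := h₂ _ (hl.trans (List.prefix_append _ _)) σ₁ hσ₁
  rw [List.length_append, List.length_singleton] at r₂
  have := pow_bound hW ht₁ ht₂
  rw [env_snoc, env_snoc, List.length_append, List.length_singleton] at hσ₂
  refine ⟨_, ?_, _, Run.seq r₁ (Run.seq r₂ (Run.instr _ _)),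
    env_snoc.2 ⟨hσ₂.1.1.congr rfl fun i hi => ?_, ?_⟩, hf₂.trans hf₁, ho₂.trans ho₁⟩
  · omega
  · simp [Instr.exec, Function.update_of_ne (Nat.ne_of_lt hi)]
  · simp [Instr.exec, hσ₂.1.2, hσ₂.2]

theorem evals_sub (hW : 64 ≤ W) {j v₁ v₂ : ℕ} {e₁ e₂ : ℕ → Program} (h₁ : Evals fm W j e₁ l v₁)
    (h₂ : Evals fm W j e₂ l v₂) : Evals fm W (j + 1) (subE e₁ e₂) l (v₁ - v₂) := by
  intro l' hl σ hσ
  obtain ⟨t₁, ht₁, σ₁, r₁, hσ₁, hf₁, ho₁⟩ := h₁ l' hl σ hσ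
  obtain ⟨t₂, ht₂, σ₂, r₂, hσ₂, hf₂, ho₂⟩ := h₂ _ (hl.trans (List.prefix_append _ _)) σ₁ hσ₁
  rw [List.length_append, List.length_singleton] at r₂
  have := pow_bound hW ht₁ ht₂
  rw [env_snoc, env_snoc, List.length_append, List.length_singleton] at hσ₂
  refine ⟨_, ?_, _, Run.seq r₁ (Run.seq r₂ (Run.instr _ _)),
    env_snoc.2 ⟨hσ₂.1.1.congr rfl fun i hi => ?_, ?_⟩, hf₂.trans hf₁, ho₂.trans ho₁⟩
  · omega
  · simp [Instr.exec, Function.update_of_ne (Nat.ne_of_lt hi)]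
  · simp [Instr.exec, hσ₂.1.2, hσ₂.2]

theorem evals_ite (hW : 64 ≤ W) {j v₁ v₂ v₃ : ℕ} {e₁ e₂ e₃ : ℕ → Program}
    (h₁ : Evals fm W j e₁ l v₁) (h₂ : Evals fm W j e₂ l v₂) (h₃ : Evals fm W j e₃ l v₃) :
    Evals fm W (j + 1) (iteE e₁ e₂ e₃) l (if v₁ ≠ 0 then v₂ else v₃) := by
  intro l' hl σ hσ
  obtain ⟨t₁, ht₁, σ₁, r₁, hσ₁, hf₁, ho₁⟩ := h₁ l' hl σ hσ
  rw [env_snoc] at hσ₁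
  split_ifs with h
  · obtain ⟨t₂, ht₂, σ₂, r₂, hσ₂, hf₂, ho₂⟩ := h₂ l' hl σ₁ hσ₁.1
    have := pow_bound hW ht₁ ht₂
    exact ⟨_, by omega, _, Run.seq r₁ (Run.ite_true (by rwa [hσ₁.2]) r₂), hσ₂, hf₂.trans hf₁,
      ho₂.trans ho₁⟩
  · rw [not_not] at h
    obtain ⟨t₂, ht₂, σ₂, r₂, hσ₂, hf₂, ho₂⟩ := h₃ l' hl σ₁ hσ₁.1
    have := pow_bound hW ht₁ ht₂
    exact ⟨_, by omega, _, Run.seq r₁ (Run.ite_false (by rwa [hσ₁.2]) r₂), hσ₂, hf₂.trans hf₁,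
      ho₂.trans ho₁⟩

/-- A loop of at most `W ^ a` rounds raises the exponent of the cost by `a + 1`. -/
theorem iter_bound (hW : 64 ≤ W) {j a N t₁ t₂ : ℕ} (h₁ : t₁ ≤ W ^ j) (h₂ : t₂ ≤ W ^ j)
    (hN : N ≤ W ^ a) : t₁ + t₂ + N * (W ^ j + 10) + 10 ≤ W ^ (j + a + 1) := by
  have h : 1 ≤ W ^ j := Nat.one_le_pow _ _ (by omega)
  have h' : 1 ≤ W ^ a := Nat.one_le_pow _ _ (by omega)
  have h3 : N * (W ^ j + 10) ≤ W ^ a * (11 * W ^ j) := Nat.mul_le_mul hN (by omega)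
  have h4 : W ^ j ≤ W ^ j * W ^ a := Nat.le_mul_of_pos_right _ h'
  rw [pow_succ, pow_add]
  nlinarith

theorem evals_iter (hW : 64 ≤ W) {j a N : ℕ} {eN e₀ : ℕ → Program} {body : ℕ → ℕ → ℕ → Program}
    (f : ℕ → ℕ) (hN : Evals fm W j eN l N) (h₀ : Evals fm W j e₀ l (f 0)) (ha : N ≤ W ^ a)
    (hbody : ∀ l', l <+: l' → ∀ c i, i < N →
      Evals fm W j (body l'.length (l'.length + 2)) (l' ++ [f i] ++ [c] ++ [i]) (f (i + 1))) :
    Evals fm W (j + a + 1) (iterE eN e₀ body) l (f N) := by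
  intro l' hl σ hσ
  obtain ⟨t₁, ht₁, σ₁, r₁, hσ₁, hf₁, ho₁⟩ := h₀ l' hl σ hσ
  obtain ⟨t₂, ht₂, σ₂, r₂, hσ₂, hf₂, ho₂⟩ := hN _ (hl.trans (List.prefix_append _ _)) σ₁ hσ₁
  rw [List.length_append, List.length_singleton] at r₂
  -- Loop invariant: above `l'` stand the accumulator `f i`, the number `c` of rounds left and the
  -- number `i` of rounds done, with `i + c = N`.
  have hloop : ∀ c i, i + c = N → ∀ ρ : State L, Env fm (l' ++ [f i] ++ [c] ++ [i]) ρ →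
      ∃ t ≤ c * (W ^ j + 10) + 1, ∃ τ,
        Run (.loop (l'.length + 1) (.seq (body l'.length (l'.length + 2) (l'.length + 3))
          (block [.const l'.length 0, .add l'.length l'.length (l'.length + 3),
            .const (l'.length + 3) 1, .add (l'.length + 2) (l'.length + 2) (l'.length + 3),
            .sub (l'.length + 1) (l'.length + 1) (l'.length + 3)]))) ρ t τ ∧
        Env fm (l' ++ [f N]) τ ∧ τ.freg = ρ.freg ∧ τ.out = ρ.out := by
    intro c
    induction c with
    | zero =>
      intro i hi ρ hρ
      rw [Nat.add_zero] at hi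
      subst hi
      have h1 := env_snoc.1 (hρ.of_prefix (List.prefix_append _ _))
      rw [List.length_append, List.length_singleton] at h1
      exact ⟨1, by omega, ρ, Run.loop_false h1.2, h1.1, rfl, rfl⟩
    | succ c ih =>
      intro i hi ρ hρ
      have h1 := env_snoc.1 (hρ.of_prefix (List.prefix_append _ _))
      rw [List.length_append, List.length_singleton] at h1
      obtain ⟨t, ht, ρ', r, hρ', hf, ho⟩ := hbody l' hl (c + 1) i (by omega) _ List.prefix_rfl ρ hρ
      simp only [List.length_append, List.length_singleton, Nat.add_assoc, Nat.reduceAdd] at r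
      rw [env_snoc, env_snoc, env_snoc, env_snoc] at hρ'
      simp only [List.length_append, List.length_singleton, Nat.add_assoc, Nat.reduceAdd] at hρ'
      obtain ⟨⟨⟨⟨e0, e1⟩, e2⟩, e3⟩, e4⟩ := hρ'
      obtain ⟨t', ht', τ, r', hτ, hf', ho'⟩ := ih (i + 1) (by omega)
        (([.const l'.length 0, .add l'.length l'.length (l'.length + 3),
            .const (l'.length + 3) 1, .add (l'.length + 2) (l'.length + 2) (l'.length + 3),
            .sub (l'.length + 1) (l'.length + 1) (l'.length + 3)] : List Instr).foldl
          (fun τ i => i.exec τ) ρ') (by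
          rw [env_snoc, env_snoc, env_snoc]
          simp only [List.length_append, List.length_singleton, Nat.add_assoc, Nat.reduceAdd]
          refine ⟨⟨⟨e0.congr rfl fun x hx => ?_, ?_⟩, ?_⟩, ?_⟩
          · simp [Instr.exec, hx.ne,
              show x ≠ l'.length + 1 by omega, show x ≠ l'.length + 2 by omega,
              show x ≠ l'.length + 3 by omega]
          · simp [Instr.exec, e4]
          · simp [Instr.exec, e2]
          · simp [Instr.exec, e3])
      refine ⟨_, ?_, τ, Run.loop_true (by rw [h1.2]; omega) (Run.seq r (run_block _ _)) r', hτ,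
        hf'.trans hf, ho'.trans ho⟩
      simp only [List.length_cons, List.length_nil]
      rw [Nat.succ_mul]
      omega
  rw [env_snoc, env_snoc, List.length_append, List.length_singleton] at hσ₂
  obtain ⟨t₃, ht₃, τ, r₃, hτ, hf₃, ho₃⟩ := hloop N 0 (by omega)
    ((Instr.const (l'.length + 2) 0).exec σ₂) (by
      rw [env_snoc, env_snoc, env_snoc]
      simp only [List.length_append, List.length_singleton, Nat.add_assoc, Nat.reduceAdd]
      refine ⟨⟨⟨hσ₂.1.1.congr rfl fun x hx => ?_, ?_⟩, ?_⟩, ?_⟩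
      · simp [Instr.exec, show x ≠ l'.length + 2 by omega]
      · simp [Instr.exec, hσ₂.1.2]
      · simp [Instr.exec, hσ₂.2]
      · simp [Instr.exec])
  refine ⟨_, ?_, τ, Run.seq r₁ (Run.seq r₂ (Run.seq (Run.instr _ _) r₃)), hτ,
    hf₃.trans (hf₂.trans hf₁), ho₃.trans (ho₂.trans ho₁)⟩
  have := iter_bound hW ht₁ ht₂ ha
  omega

end Machine

section Machine

variable {L : Type*} [Field L] {fm : ℕ → L} {W : ℕ} {l : List ℕ}

/-! ### Expressions for field elements -/

/-- `e b f` computes `v` in the register `f` for field elements within `W ^ j` steps, whenever the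
registers for numbers start with an extension of `l` of length `b`. -/
def FEvals (fm : ℕ → L) (W j : ℕ) (e : ℕ → ℕ → Program) (l : List ℕ) (v : L) : Prop :=
  ∀ l', l <+: l' → ∀ (f : ℕ) (σ : State L), Env fm l' σ →
    ∃ t ≤ W ^ j, ∃ τ, Run (e l'.length f) σ t τ ∧ Env fm l' τ ∧
      (∀ i < f, τ.freg i = σ.freg i) ∧ τ.freg f = v ∧ τ.out = σ.out

theorem FEvals.mono {j j' : ℕ} {e : ℕ → ℕ → Program} {v : L} (h : FEvals fm W j e l v)
    (hW : 64 ≤ W) (hj : j ≤ j') : FEvals fm W j' e l v := by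
  intro l' hl f σ hσ
  obtain ⟨t, ht, h'⟩ := h l' hl f σ hσ
  exact ⟨t, ht.trans (Nat.pow_le_pow_right (by omega) hj), h'⟩

theorem FEvals.extend {j : ℕ} {e : ℕ → ℕ → Program} {l' : List ℕ} {v : L} (h : FEvals fm W j e l v)
    (hl : l <+: l') : FEvals fm W j e l' v := fun l'' h' => h l'' (hl.trans h')

/-- The field element `1`. -/
def foneE : ℕ → ℕ → Program := fun _ f => .instr (.fone f)

/-- The memory cell whose address is given by an expression. -/
def floadE (e : ℕ → Program) : ℕ → ℕ → Program := fun b f => .seq (e b) (.instr (.fload f b))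

/-- A binary operation. -/
def fopE (op : ℕ → ℕ → ℕ → Instr) (e₁ e₂ : ℕ → ℕ → Program) : ℕ → ℕ → Program := fun b f =>
  .seq (e₁ b f) (.seq (e₂ b (f + 1)) (.instr (op f f (f + 1))))

/-- An iterated binary operation. -/
def fiterE (op : ℕ → ℕ → ℕ → Instr) (eN : ℕ → Program) (e₀ : ℕ → ℕ → Program)
    (body : ℕ → ℕ → ℕ → Program) : ℕ → ℕ → Program := fun b f =>
  .seq (e₀ b f) (.seq (eN b) (.seq (.instr (.const (b + 1) 0))
    (.loop b (.seq (body (b + 1) (b + 2) (f + 1))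
      (block [op f f (f + 1), .const (b + 2) 1, .add (b + 1) (b + 1) (b + 2),
        .sub b b (b + 2)])))))

/-- The instruction `op` performs the operation `g`. -/
abbrev Performs (op : ℕ → ℕ → ℕ → Instr) (g : L → L → L) : Prop :=
  ∀ x y z (σ : State L),
    (op x y z).exec σ = { σ with freg := Function.update σ.freg x (g (σ.freg y) (σ.freg z)) }

theorem performs_fadd : Performs (L := L) .fadd (· + ·) := fun _ _ _ _ => rfl

theorem performs_fmul : Performs (L := L) .fmul (· * ·) := fun _ _ _ _ => rfl

theorem fevals_fone (hW : 64 ≤ W) : FEvals fm W 1 foneE l 1 := by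
  intro l' _ f σ hσ
  refine ⟨1, by rw [pow_one]; omega, _, Run.instr _ _, hσ.congr rfl fun i hi => rfl,
    fun i hi => ?_, ?_, rfl⟩
  · simp [Instr.exec, hi.ne]
  · simp [Instr.exec]

theorem fevals_fload (hW : 64 ≤ W) {j v : ℕ} {e : ℕ → Program} (h : Evals fm W j e l v) :
    FEvals fm W (j + 1) (floadE e) l (fm v) := by
  intro l' hl f σ hσ
  obtain ⟨t, ht, σ₁, r, hσ₁, hf, ho⟩ := h l' hl σ hσ
  have := pow_bound hW ht ht
  rw [env_snoc] at hσ₁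
  refine ⟨_, ?_, _, Run.seq r (Run.instr _ _), hσ₁.1.congr rfl fun i hi => rfl,
    fun i hi => ?_, ?_, ho⟩
  · omega
  · simp [Instr.exec, hi.ne, hf]
  · simp [Instr.exec, hσ₁.2, hσ₁.1.1]

theorem fevals_fop (hW : 64 ≤ W) {op : ℕ → ℕ → ℕ → Instr} {g : L → L → L} (hop : Performs op g)
    {j : ℕ} {v₁ v₂ : L} {e₁ e₂ : ℕ → ℕ → Program} (h₁ : FEvals fm W j e₁ l v₁)
    (h₂ : FEvals fm W j e₂ l v₂) : FEvals fm W (j + 1) (fopE op e₁ e₂) l (g v₁ v₂) := by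
  intro l' hl f σ hσ
  obtain ⟨t₁, ht₁, σ₁, r₁, hσ₁, hf₁, hv₁, ho₁⟩ := h₁ l' hl f σ hσ
  obtain ⟨t₂, ht₂, σ₂, r₂, hσ₂, hf₂, hv₂, ho₂⟩ := h₂ l' hl (f + 1) σ₁ hσ₁
  have := pow_bound hW ht₁ ht₂
  refine ⟨_, ?_, _, Run.seq r₁ (Run.seq r₂ (Run.instr _ _)), ?_, fun i hi => ?_, ?_, ?_⟩
  · omega
  · rw [hop]
    exact hσ₂.congr rfl fun i hi => rfl
  · rw [hop]
    simp [hi.ne, hf₂ i (by omega), hf₁ i hi]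
  · rw [hop]
    simp [hv₂, hf₂ f (by omega), hv₁]
  · rw [hop]
    exact ho₂.trans ho₁

theorem fevals_fiter (hW : 64 ≤ W) {op : ℕ → ℕ → ℕ → Instr} {g : L → L → L} (hop : Performs op g)
    {j a N : ℕ} {eN : ℕ → Program} {e₀ : ℕ → ℕ → Program} {body : ℕ → ℕ → ℕ → Program}
    (F u : ℕ → L) (hN : Evals fm W j eN l N) (h₀ : FEvals fm W j e₀ l (F 0)) (ha : N ≤ W ^ a)
    (hbody : ∀ l', l <+: l' → ∀ c i, i < N →
      FEvals fm W j (body (l'.length + 1)) (l' ++ [c] ++ [i]) (u i))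
    (hF : ∀ i, F (i + 1) = g (F i) (u i)) :
    FEvals fm W (j + a + 1) (fiterE op eN e₀ body) l (F N) := by
  intro l' hl f σ hσ
  obtain ⟨t₁, ht₁, σ₁, r₁, hσ₁, hf₁, hv₁, ho₁⟩ := h₀ l' hl f σ hσ
  obtain ⟨t₂, ht₂, σ₂, r₂, hσ₂, hf₂, ho₂⟩ := hN l' hl σ₁ hσ₁
  -- Loop invariant: `c` rounds are left, `i` are done, and the accumulator, now a field register,
  -- holds `F i`.
  have hloop : ∀ c i, i + c = N → ∀ ρ : State L, Env fm (l' ++ [c] ++ [i]) ρ → ρ.freg f = F i →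
      ∃ t ≤ c * (W ^ j + 10) + 1, ∃ τ,
        Run (.loop l'.length (.seq (body (l'.length + 1) (l'.length + 2) (f + 1))
          (block [op f f (f + 1), .const (l'.length + 2) 1,
            .add (l'.length + 1) (l'.length + 1) (l'.length + 2),
            .sub l'.length l'.length (l'.length + 2)]))) ρ t τ ∧
        Env fm l' τ ∧ (∀ i < f, τ.freg i = ρ.freg i) ∧ τ.freg f = F N ∧ τ.out = ρ.out := by
    intro c
    induction c with
    | zero =>
      intro i hi ρ hρ hfi
      rw [Nat.add_zero] at hi
      subst hi
      have h1 := env_snoc.1 (hρ.of_prefix (List.prefix_append _ _))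
      exact ⟨1, by omega, ρ, Run.loop_false h1.2, h1.1, fun _ _ => rfl, hfi, rfl⟩
    | succ c ih =>
      intro i hi ρ hρ hfi
      have h1 := env_snoc.1 (hρ.of_prefix (List.prefix_append _ _))
      obtain ⟨t, ht, ρ', r, hρ', hf, hv, ho⟩ :=
        hbody l' hl (c + 1) i (by omega) _ List.prefix_rfl (f + 1) ρ hρ
      simp only [List.length_append, List.length_singleton, Nat.add_assoc, Nat.reduceAdd] at r
      rw [env_snoc, env_snoc, List.length_append, List.length_singleton] at hρ'
      obtain ⟨⟨e0, e1⟩, e2⟩ := hρ'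
      obtain ⟨t', ht', τ, r', hτ, hf', hv', ho'⟩ := ih (i + 1) (by omega)
        (([op f f (f + 1), .const (l'.length + 2) 1,
            .add (l'.length + 1) (l'.length + 1) (l'.length + 2),
            .sub l'.length l'.length (l'.length + 2)] : List Instr).foldl
          (fun τ i => i.exec τ) ρ') (by
          rw [env_snoc, env_snoc, List.length_append, List.length_singleton]
          simp only [List.foldl_cons, List.foldl_nil, hop]
          refine ⟨⟨e0.congr rfl fun x hx => ?_, ?_⟩, ?_⟩
          · simp [Instr.exec, hx.ne, show x ≠ l'.length + 1 by omega,
              show x ≠ l'.length + 2 by omega]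
          · simp [Instr.exec, e1]
          · simp [Instr.exec, e2]) (by
          simp only [List.foldl_cons, List.foldl_nil, hop]
          simp [Instr.exec, hv, hf f (by omega), hfi, hF])
      refine ⟨_, ?_, τ, Run.loop_true (by rw [h1.2]; omega) (Run.seq r (run_block _ _)) r', hτ,
        fun x hx => ?_, hv', ?_⟩
      · simp only [List.length_cons, List.length_nil]
        rw [Nat.succ_mul]
        omega
      · rw [hf' x hx, ← hf x (by omega)]
        simp only [List.foldl_cons, List.foldl_nil, hop]
        simp [Instr.exec, hx.ne]
      · rw [ho', ← ho]
        simp only [List.foldl_cons, List.foldl_nil, hop]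
        simp [Instr.exec]
  rw [env_snoc] at hσ₂
  obtain ⟨t₃, ht₃, τ, r₃, hτ, hf₃, hv₃, ho₃⟩ := hloop N 0 (by omega)
    ((Instr.const (l'.length + 1) 0).exec σ₂) (by
      rw [env_snoc, env_snoc, List.length_append, List.length_singleton]
      refine ⟨⟨hσ₂.1.congr rfl fun x hx => ?_, ?_⟩, ?_⟩
      · simp [Instr.exec, show x ≠ l'.length + 1 by omega]
      · simp [Instr.exec, hσ₂.2]
      · simp [Instr.exec]) (by
      change σ₂.freg f = F 0
      rw [hf₂, hv₁])
  refine ⟨_, ?_, τ, Run.seq r₁ (Run.seq r₂ (Run.seq (Run.instr _ _) r₃)), hτ,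
    fun x hx => (hf₃ x hx).trans ?_, hv₃, ho₃.trans (ho₂.trans ho₁)⟩
  · have := iter_bound hW ht₁ ht₂ ha
    omega
  · change σ₂.freg x = _
    rw [hf₂, hf₁ x hx]

/-! ### Commands -/

/-- `c b` appends `xs` to the output within `W ^ j` steps, whenever the registers start with an
extension of `l` of length `b`. -/
def Emits (fm : ℕ → L) (W j : ℕ) (c : ℕ → Program) (l : List ℕ) (xs : List L) : Prop :=
  ∀ l', l <+: l' → ∀ σ : State L, Env fm l' σ →
    ∃ t ≤ W ^ j, ∃ τ, Run (c l'.length) σ t τ ∧ Env fm l' τ ∧ τ.out = σ.out ++ xs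

theorem Emits.mono {j j' : ℕ} {c : ℕ → Program} {xs : List L} (h : Emits fm W j c l xs)
    (hW : 64 ≤ W) (hj : j ≤ j') : Emits fm W j' c l xs := by
  intro l' hl σ hσ
  obtain ⟨t, ht, h'⟩ := h l' hl σ hσ
  exact ⟨t, ht.trans (Nat.pow_le_pow_right (by omega) hj), h'⟩

/-- Output of a field element. -/
def emitC (e : ℕ → ℕ → Program) : ℕ → Program := fun b => .seq (e b 0) (.instr (.emit 0))

/-- A command that uses the value of an expression. -/
def letC (e : ℕ → Program) (c : ℕ → ℕ → Program) : ℕ → Program := fun b =>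
  .seq (e b) (c b (b + 1))

/-- Repetition of a command. -/
def forC (eN : ℕ → Program) (c : ℕ → ℕ → Program) : ℕ → Program := fun b =>
  .seq (eN b) (.seq (.instr (.const (b + 1) 0)) (.loop b (.seq (c (b + 1) (b + 2))
    (block [.const (b + 2) 1, .add (b + 1) (b + 1) (b + 2), .sub b b (b + 2)]))))

theorem emits_emit (hW : 64 ≤ W) {j : ℕ} {v : L} {e : ℕ → ℕ → Program} (h : FEvals fm W j e l v) :
    Emits fm W (j + 1) (emitC e) l [v] := by
  intro l' hl σ hσ
  obtain ⟨t, ht, σ₁, r, hσ₁, hf, hv, ho⟩ := h l' hl 0 σ hσ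
  have := pow_bound hW ht ht
  refine ⟨_, ?_, _, Run.seq r (Run.instr _ _), hσ₁.congr rfl fun i hi => rfl, ?_⟩
  · omega
  · simp [Instr.exec, hv, ho]

theorem emits_let (hW : 64 ≤ W) {j v : ℕ} {xs : List L} {e : ℕ → Program} {c : ℕ → ℕ → Program}
    (h : Evals fm W j e l v)
    (hc : ∀ l', l <+: l' → Emits fm W j (c l'.length) (l' ++ [v]) xs) :
    Emits fm W (j + 1) (letC e c) l xs := by
  intro l' hl σ hσ
  obtain ⟨t₁, ht₁, σ₁, r₁, hσ₁, hf₁, ho₁⟩ := h l' hl σ hσ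
  obtain ⟨t₂, ht₂, σ₂, r₂, hσ₂, ho₂⟩ := hc l' hl _ List.prefix_rfl σ₁ hσ₁
  rw [List.length_append, List.length_singleton] at r₂
  have := pow_bound hW ht₁ ht₂
  exact ⟨_, by omega, _, Run.seq r₁ r₂, hσ₂.of_prefix (List.prefix_append _ _), by rw [ho₂, ho₁]⟩

theorem emits_for (hW : 64 ≤ W) {j a N : ℕ} {xs : ℕ → List L} {eN : ℕ → Program}
    {c : ℕ → ℕ → Program} (hN : Evals fm W j eN l N) (ha : N ≤ W ^ a)
    (hc : ∀ l', l <+: l' → ∀ d i, i < N →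
      Emits fm W j (c (l'.length + 1)) (l' ++ [d] ++ [i]) (xs i)) :
    Emits fm W (j + a + 1) (forC eN c) l ((List.range N).flatMap xs) := by
  intro l' hl σ hσ
  obtain ⟨t₂, ht₂, σ₂, r₂, hσ₂, hf₂, ho₂⟩ := hN l' hl σ hσ
  have hloop : ∀ d i, i + d = N → ∀ ρ : State L, Env fm (l' ++ [d] ++ [i]) ρ →
      ∃ t ≤ d * (W ^ j + 10) + 1, ∃ τ,
        Run (.loop l'.length (.seq (c (l'.length + 1) (l'.length + 2))
          (block [.const (l'.length + 2) 1,
            .add (l'.length + 1) (l'.length + 1) (l'.length + 2),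
            .sub l'.length l'.length (l'.length + 2)]))) ρ t τ ∧
        Env fm l' τ ∧ τ.out = ρ.out ++ (List.range' i d).flatMap xs := by
    intro d
    induction d with
    | zero =>
      intro i hi ρ hρ
      have h1 := env_snoc.1 (hρ.of_prefix (List.prefix_append _ _))
      exact ⟨1, by omega, ρ, Run.loop_false h1.2, h1.1, by simp⟩
    | succ d ih =>
      intro i hi ρ hρ
      have h1 := env_snoc.1 (hρ.of_prefix (List.prefix_append _ _))
      obtain ⟨t, ht, ρ', r, hρ', ho⟩ := hc l' hl (d + 1) i (by omega) _ List.prefix_rfl ρ hρ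
      simp only [List.length_append, List.length_singleton, Nat.add_assoc, Nat.reduceAdd] at r
      rw [env_snoc, env_snoc, List.length_append, List.length_singleton] at hρ'
      obtain ⟨⟨e0, e1⟩, e2⟩ := hρ'
      obtain ⟨t', ht', τ, r', hτ, ho'⟩ := ih (i + 1) (by omega)
        (([.const (l'.length + 2) 1,
            .add (l'.length + 1) (l'.length + 1) (l'.length + 2),
            .sub l'.length l'.length (l'.length + 2)] : List Instr).foldl
          (fun τ i => i.exec τ) ρ') (by
          rw [env_snoc, env_snoc, List.length_append, List.length_singleton]
          refine ⟨⟨e0.congr rfl fun x hx => ?_, ?_⟩, ?_⟩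
          · simp [Instr.exec, hx.ne, show x ≠ l'.length + 1 by omega,
              show x ≠ l'.length + 2 by omega]
          · simp [Instr.exec, e1]
          · simp [Instr.exec, e2])
      refine ⟨_, ?_, τ, Run.loop_true (by rw [h1.2]; omega) (Run.seq r (run_block _ _)) r', hτ, ?_⟩
      · simp only [List.length_cons, List.length_nil]
        rw [Nat.succ_mul]
        omega
      · rw [ho', List.range'_succ, List.flatMap_cons, ← List.append_assoc, ← ho]
        simp [Instr.exec]
  rw [env_snoc] at hσ₂
  obtain ⟨t₃, ht₃, τ, r₃, hτ, ho₃⟩ := hloop N 0 (by omega)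
    ((Instr.const (l'.length + 1) 0).exec σ₂) (by
      rw [env_snoc, env_snoc, List.length_append, List.length_singleton]
      refine ⟨⟨hσ₂.1.congr rfl fun x hx => ?_, ?_⟩, ?_⟩
      · simp [Instr.exec, show x ≠ l'.length + 1 by omega]
      · simp [Instr.exec, hσ₂.2]
      · simp [Instr.exec])
  refine ⟨_, ?_, τ, Run.seq r₂ (Run.seq (Run.instr _ _) r₃), hτ, ?_⟩
  · have := iter_bound hW ht₂ ht₂ ha
    omega
  · rw [ho₃, List.range_eq_range', ← ho₂]
    rfl

end Machine

/-! ### Arithmetic of natural numbers by iteration -/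

section Arithmetic

variable {L : Type*} [Field L] {fm : ℕ → L} {W : ℕ} {l l' : List ℕ}

/-- Multiplication. -/
def mulE (e₁ e₂ : ℕ → Program) : ℕ → Program :=
  iterE e₁ (constE 0) fun acc _ => addE (varE acc) e₂

/-- Exponentiation. -/
def powE (e₁ e₂ : ℕ → Program) : ℕ → Program :=
  iterE e₂ (constE 1) fun acc _ => mulE (varE acc) e₁

/-- The remainder. -/
def modE (e₁ e₂ : ℕ → Program) : ℕ → Program :=
  iterE e₁ (constE 0) fun acc _ =>
    iteE (subE e₂ (addE (varE acc) (constE 1))) (addE (varE acc) (constE 1)) (constE 0)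

/-- The quotient. -/
def divE (e₁ e₂ : ℕ → Program) : ℕ → Program :=
  iterE e₁ (constE 0) fun acc i =>
    addE (varE acc) (iteE (modE (addE (varE i) (constE 1)) e₂) (constE 0) (constE 1))

/-- The binary logarithm, rounded up. -/
def clogE (e : ℕ → Program) : ℕ → Program :=
  iterE e (constE 0) fun acc _ =>
    iteE (subE e (powE (constE 2) (varE acc))) (addE (varE acc) (constE 1)) (varE acc)

/-- Modular exponentiation. -/
def powModE (e₁ e₂ e₃ : ℕ → Program) : ℕ → Program :=
  iterE e₂ (modE (constE 1) e₃) fun acc _ => modE (mulE (varE acc) e₁) e₃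

theorem getElem?_first (v c i : ℕ) : (l ++ [v] ++ [c] ++ [i])[l.length]? = some v := by
  simp

theorem getElem?_third (v c i : ℕ) : (l ++ [v] ++ [c] ++ [i])[l.length + 2]? = some i := by
  simp

theorem prefix_append_three {v c i : ℕ} (h : l <+: l') : l <+: l' ++ [v] ++ [c] ++ [i] := by
  rw [List.append_assoc, List.append_assoc]
  exact h.trans (List.prefix_append _ _)

theorem evals_mul (hW : 64 ≤ W) {j a v₁ v₂ : ℕ} {e₁ e₂ : ℕ → Program} (hj : 1 ≤ j)
    (h₁ : Evals fm W j e₁ l v₁) (h₂ : Evals fm W j e₂ l v₂) (ha : v₁ ≤ W ^ a) :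
    Evals fm W (j + a + 2) (mulE e₁ e₂) l (v₁ * v₂) := by
  refine (evals_iter hW (j := j + 1) (fun i => i * v₂) (h₁.mono hW (by omega)) ?_ ha
    fun l' hl c i _ => ?_).mono hW (by omega)
  · simp only [Nat.zero_mul]
    exact (evals_const hW 0).mono hW (by omega)
  · rw [Nat.succ_mul]
    exact evals_add hW ((evals_var hW (getElem?_first _ _ _)).mono hW hj)
      (h₂.extend (prefix_append_three hl))

theorem evals_pow (hW : 64 ≤ W) {j a b v₁ v₂ : ℕ} {e₁ e₂ : ℕ → Program} (hj : 1 ≤ j)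
    (h₁ : Evals fm W j e₁ l v₁) (h₂ : Evals fm W j e₂ l v₂) (ha : v₂ ≤ W ^ a)
    (hb : ∀ i < v₂, v₁ ^ i ≤ W ^ b) : Evals fm W (j + a + b + 3) (powE e₁ e₂) l (v₁ ^ v₂) := by
  refine (evals_iter hW (j := j + b + 2) (fun i => v₁ ^ i) (h₂.mono hW (by omega)) ?_ ha
    fun l' hl c i hi => ?_).mono hW (by omega)
  · simp only [pow_zero]
    exact (evals_const hW 1).mono hW (by omega)
  · rw [pow_succ]
    exact evals_mul hW hj ((evals_var hW (getElem?_first _ _ _)).mono hW hj)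
      (h₁.extend (prefix_append_three hl)) (hb i hi)

theorem evals_mod (hW : 64 ≤ W) {j a v₁ v₂ : ℕ} {e₁ e₂ : ℕ → Program} (hj : 1 ≤ j)
    (h₁ : Evals fm W j e₁ l v₁) (h₂ : Evals fm W j e₂ l v₂) (hv : 1 ≤ v₂) (ha : v₁ ≤ W ^ a) :
    Evals fm W (j + a + 4) (modE e₁ e₂) l (v₁ % v₂) := by
  refine (evals_iter hW (j := j + 3) (fun i => i % v₂) (h₁.mono hW (by omega)) ?_ ha
    fun l' hl c i hi => ?_).mono hW (by omega)
  · simp only [Nat.zero_mod]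
    exact (evals_const hW 0).mono hW (by omega)
  -- Counting modulo `v₂`: the truncated difference is nonzero exactly when the incremented
  -- remainder is still below `v₂`.
  · have hstep : (i + 1) % v₂ = if v₂ - (i % v₂ + 1) ≠ 0 then i % v₂ + 1 else 0 := by
      have hlt := Nat.mod_lt i hv
      rw [← Nat.mod_add_mod]
      split_ifs with h
      · exact Nat.mod_eq_of_lt (by omega)
      · rw [show i % v₂ + 1 = v₂ by omega, Nat.mod_self]
    have hacc := (evals_var (fm := fm) hW (getElem?_first (l := l') (i % v₂) c i)).mono hW hj
    have hone := (evals_const (fm := fm) (l := l' ++ [i % v₂] ++ [c] ++ [i]) hW 1).mono hW hj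
    rw [hstep]
    exact evals_ite hW (evals_sub hW ((h₂.extend (prefix_append_three hl)).mono hW (by omega))
      (evals_add hW hacc hone)) ((evals_add hW hacc hone).mono hW (by omega))
      ((evals_const hW 0).mono hW (by omega))

theorem evals_div (hW : 64 ≤ W) {j a v₁ v₂ : ℕ} {e₁ e₂ : ℕ → Program} (hj : 1 ≤ j)
    (h₁ : Evals fm W j e₁ l v₁) (h₂ : Evals fm W j e₂ l v₂) (hv : 1 ≤ v₂) (ha : v₁ ≤ W ^ a) :
    Evals fm W (j + 2 * a + 8) (divE e₁ e₂) l (v₁ / v₂) := by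
  refine (evals_iter hW (j := j + a + 7) (fun i => i / v₂) (h₁.mono hW (by omega)) ?_ ha
    fun l' hl c i hi => ?_).mono hW (by omega)
  · simp only [Nat.zero_div]
    exact (evals_const hW 0).mono hW (by omega)
  -- The quotient increases exactly at the multiples of `v₂`.
  · have hstep : (i + 1) / v₂ = i / v₂ + if (i + 1) % v₂ ≠ 0 then 0 else 1 := by
      rw [Nat.succ_div]
      simp only [Nat.dvd_iff_mod_eq_zero]
      split_ifs with h1 h2 <;> simp_all
    have hacc := (evals_var (fm := fm) hW (getElem?_first (l := l') (i / v₂) c i)).mono hW hj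
    have hi' := (evals_var (fm := fm) hW (getElem?_third (l := l') (i / v₂) c i)).mono hW hj
    have hone := (evals_const (fm := fm) (l := l' ++ [i / v₂] ++ [c] ++ [i]) hW 1).mono hW hj
    rw [hstep]
    refine evals_add hW (hacc.mono hW (by omega)) (evals_ite hW (evals_mod hW (j := j + 1) (a := a)
      (by omega) (evals_add hW hi' hone) ((h₂.extend (prefix_append_three hl)).mono hW (by omega))
      hv (by omega) |>.mono hW (by omega)) ((evals_const hW 0).mono hW (by omega))
      (hone.mono hW (by omega)))

theorem evals_clog (hW : 64 ≤ W) {j a v : ℕ} {e : ℕ → Program} (hj : 1 ≤ j)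
    (h : Evals fm W j e l v) (ha : v ≤ W ^ a) :
    Evals fm W (j + 3 * a + 6) (clogE e) l (Nat.clog 2 v) := by
  have hclog : Nat.clog 2 v ≤ v := by
    rw [Nat.clog_le_iff_le_pow (by norm_num)]
    exact (Nat.lt_pow_self (by norm_num)).le
  -- The loop runs `v` rounds, which suffices, and its accumulator stops growing at the logarithm.
  -- So after `i` rounds it holds `min i (Nat.clog 2 v)`.
  have hres : Nat.clog 2 v = min v (Nat.clog 2 v) := (min_eq_right hclog).symm
  rw [hres]
  refine (evals_iter hW (j := j + 2 * a + 5) (fun i => min i (Nat.clog 2 v))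
    (h.mono hW (by omega)) ?_ ha fun l' hl c i hi => ?_).mono hW (by omega)
  · simp only [Nat.zero_min]
    exact (evals_const hW 0).mono hW (by omega)
  · have hstep : min (i + 1) (Nat.clog 2 v) =
        if v - 2 ^ min i (Nat.clog 2 v) ≠ 0 then min i (Nat.clog 2 v) + 1
          else min i (Nat.clog 2 v) := by
      by_cases hlt : i < Nat.clog 2 v
      · rw [min_eq_left hlt.le, min_eq_left (Nat.succ_le_of_lt hlt), if_pos]
        have := (Nat.lt_clog_iff_pow_lt (by norm_num)).1 hlt
        omega
      · rw [min_eq_right (not_lt.1 hlt), min_eq_right (by omega), if_neg]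
        have := Nat.le_pow_clog (b := 2) (by norm_num) v
        omega
    have hacc := (evals_var (fm := fm) hW
      (getElem?_first (l := l') (min i (Nat.clog 2 v)) c i)).mono hW hj
    rw [hstep]
    refine evals_ite hW ((evals_sub hW (j := j + 2 * a + 3)
      ((h.extend (prefix_append_three hl)).mono hW (by omega))
      ((evals_pow hW (a := a) (b := a) hj ((evals_const hW 2).mono hW hj) hacc ?_ ?_).mono hW
        (by omega))).mono hW (by omega))
      ((evals_add hW hacc ((evals_const hW 1).mono hW hj)).mono hW (by omega))
      (hacc.mono hW (by omega))
    · exact (min_le_right _ _).trans (hclog.trans ha)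
    · intro x hx
      have := (Nat.lt_clog_iff_pow_lt (b := 2) (by norm_num)).1 (hx.trans_le (min_le_right _ _))
      omega

/-- Reducing after every multiplication keeps all intermediate values below `W ^ (2 * a)`. This
matters because powers such as `D₁ ^ n` are not bounded by a fixed power of the time unit. -/
theorem evals_powMod (hW : 64 ≤ W) {j a v₁ v₂ v₃ : ℕ} {e₁ e₂ e₃ : ℕ → Program} (hj : 1 ≤ j)
    (h₁ : Evals fm W j e₁ l v₁) (h₂ : Evals fm W j e₂ l v₂) (h₃ : Evals fm W j e₃ l v₃)
    (hv : 1 ≤ v₃) (ha₁ : v₁ ≤ W ^ a) (ha₂ : v₂ ≤ W ^ a) (ha₃ : v₃ ≤ W ^ a) :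
    Evals fm W (j + 4 * a + 7) (powModE e₁ e₂ e₃) l (v₁ ^ v₂ % v₃) := by
  refine (evals_iter hW (j := j + 3 * a + 6) (fun i => v₁ ^ i % v₃) (h₂.mono hW (by omega)) ?_ ha₂
    fun l' hl c i hi => ?_).mono hW (by omega)
  · simp only [pow_zero]
    exact (evals_mod hW (a := a) hj ((evals_const hW 1).mono hW hj) h₃ hv
      (Nat.one_le_pow _ _ (by omega))).mono hW (by omega)
  · have hlt := Nat.mod_lt (v₁ ^ i) hv
    rw [pow_succ, ← Nat.mod_mul_mod]
    refine (evals_mod hW (j := j + a + 2) (a := 2 * a) (by omega) (evals_mul hW hj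
      ((evals_var hW (getElem?_first _ _ _)).mono hW hj) (h₁.extend (prefix_append_three hl))
      (hlt.le.trans ha₃)) ((h₃.extend (prefix_append_three hl)).mono hW (by omega)) hv ?_).mono hW
      (by omega)
    rw [two_mul, pow_add]
    exact Nat.mul_le_mul (hlt.le.trans ha₃) ha₁

end Arithmetic

section Construction

variable {L : Type*} [Field L] {fm : ℕ → L} {W : ℕ} {l : List ℕ}

/-! ### Expressions whose values are at most `W ^ 40` -/

section Bounded

variable {j₁ j₂ j₃ v₁ v₂ v₃ : ℕ} {e₁ e₂ e₃ : ℕ → Program}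

theorem Evals.add (hW : 64 ≤ W) (h₁ : Evals fm W j₁ e₁ l v₁) (h₂ : Evals fm W j₂ e₂ l v₂) :
    Evals fm W (j₁ + j₂ + 1) (addE e₁ e₂) l (v₁ + v₂) :=
  evals_add hW (h₁.mono hW (by omega)) (h₂.mono hW (by omega))

theorem Evals.mul (hW : 64 ≤ W) (h₁ : Evals fm W j₁ e₁ l v₁) (h₂ : Evals fm W j₂ e₂ l v₂)
    (ha : v₁ ≤ W ^ 40) : Evals fm W (j₁ + j₂ + 43) (mulE e₁ e₂) l (v₁ * v₂) :=
  (evals_mul hW (j := j₁ + j₂ + 1) (by omega) (h₁.mono hW (by omega)) (h₂.mono hW (by omega))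
    ha).mono hW (by omega)

theorem Evals.pow (hW : 64 ≤ W) (h₁ : Evals fm W j₁ e₁ l v₁) (h₂ : Evals fm W j₂ e₂ l v₂)
    (hv₁ : 1 ≤ v₁) (ha : v₂ ≤ W ^ 40) (hb : v₁ ^ v₂ ≤ W ^ 40) :
    Evals fm W (j₁ + j₂ + 84) (powE e₁ e₂) l (v₁ ^ v₂) :=
  (evals_pow hW (j := j₁ + j₂ + 1) (by omega) (h₁.mono hW (by omega)) (h₂.mono hW (by omega))
    ha fun _ hi => (Nat.pow_le_pow_right hv₁ hi.le).trans hb).mono hW (by omega)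

theorem Evals.mod (hW : 64 ≤ W) (h₁ : Evals fm W j₁ e₁ l v₁) (h₂ : Evals fm W j₂ e₂ l v₂)
    (hv : 1 ≤ v₂) (ha : v₁ ≤ W ^ 40) : Evals fm W (j₁ + j₂ + 45) (modE e₁ e₂) l (v₁ % v₂) :=
  (evals_mod hW (j := j₁ + j₂ + 1) (by omega) (h₁.mono hW (by omega)) (h₂.mono hW (by omega))
    hv ha).mono hW (by omega)

theorem Evals.div (hW : 64 ≤ W) (h₁ : Evals fm W j₁ e₁ l v₁) (h₂ : Evals fm W j₂ e₂ l v₂)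
    (hv : 1 ≤ v₂) (ha : v₁ ≤ W ^ 40) : Evals fm W (j₁ + j₂ + 89) (divE e₁ e₂) l (v₁ / v₂) :=
  (evals_div hW (j := j₁ + j₂ + 1) (by omega) (h₁.mono hW (by omega)) (h₂.mono hW (by omega))
    hv ha).mono hW (by omega)

theorem Evals.clog (hW : 64 ≤ W) (h₁ : Evals fm W j₁ e₁ l v₁) (ha : v₁ ≤ W ^ 40) :
    Evals fm W (j₁ + 127) (clogE e₁) l (Nat.clog 2 v₁) :=
  (evals_clog hW (j := j₁ + 1) (by omega) (h₁.mono hW (by omega)) ha).mono hW (by omega)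

theorem Evals.powMod (hW : 64 ≤ W) (h₁ : Evals fm W j₁ e₁ l v₁) (h₂ : Evals fm W j₂ e₂ l v₂)
    (h₃ : Evals fm W j₃ e₃ l v₃) (hv : 1 ≤ v₃) (ha₁ : v₁ ≤ W ^ 40) (ha₂ : v₂ ≤ W ^ 40)
    (ha₃ : v₃ ≤ W ^ 40) :
    Evals fm W (j₁ + j₂ + j₃ + 168) (powModE e₁ e₂ e₃) l (v₁ ^ v₂ % v₃) :=
  (evals_powMod hW (j := j₁ + j₂ + j₃ + 1) (by omega) (h₁.mono hW (by omega))
    (h₂.mono hW (by omega)) (h₃.mono hW (by omega)) hv ha₁ ha₂ ha₃).mono hW (by omega)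

theorem FEvals.op (hW : 64 ≤ W) {op : ℕ → ℕ → ℕ → Instr} {g : L → L → L} (hop : Performs op g)
    {v₁ v₂ : L} {e₁ e₂ : ℕ → ℕ → Program} (h₁ : FEvals fm W j₁ e₁ l v₁)
    (h₂ : FEvals fm W j₂ e₂ l v₂) : FEvals fm W (j₁ + j₂ + 1) (fopE op e₁ e₂) l (g v₁ v₂) :=
  fevals_fop hW hop (h₁.mono hW (by omega)) (h₂.mono hW (by omega))

/-- Powers of a field element. -/
def fpowE (e : ℕ → ℕ → Program) (eN : ℕ → Program) : ℕ → ℕ → Program :=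
  fiterE .fmul eN foneE fun _ => e

theorem FEvals.pow (hW : 64 ≤ W) {v : L} {e : ℕ → ℕ → Program} (h₁ : FEvals fm W j₁ e l v)
    (h₂ : Evals fm W j₂ e₂ l v₂) (ha : v₂ ≤ W ^ 40) :
    FEvals fm W (j₁ + j₂ + 42) (fpowE e e₂) l (v ^ v₂) := by
  refine (fevals_fiter hW (j := j₁ + j₂ + 1) performs_fmul (fun i => v ^ i) (fun _ => v)
    (h₂.mono hW (by omega)) ?_ ha (fun l' hl c i _ => ?_) fun i => pow_succ v i).mono hW (by omega)
  · simp only [pow_zero]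
    exact (fevals_fone hW).mono hW (by omega)
  · rw [List.append_assoc]
    exact (h₁.extend (hl.trans (List.prefix_append _ _))).mono hW (by omega)

end Bounded

/-! ### The coordinates of the points -/

/-- The `j`-th of the elements of `H₂` with number `m`. -/
def pointE (u v im : ℕ) (ej : ℕ → Program) : ℕ → ℕ → Program :=
  floadE (addE (varE u) (modE (divE (varE im) (powE (varE v) ej)) (varE v)))

/-- A coordinate; the arguments are the registers that hold `D₁`, the sizes of `H₁` and `H₂`, and
the loop variables. -/
def coordE (d u v ip ic im ii : ℕ) : ℕ → ℕ → Program :=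
  fiterE .fadd (varE 4)
    (fopE .fadd
      (fpowE (floadE (varE ic))
        (powModE (varE d) (addE (varE ii) (constE 1)) (addE (varE ip) (constE 1))))
      (fopE .fmul
        (fpowE (floadE (varE ic)) (powModE (addE (varE 1) (constE 1))
          (addE (varE ii) (constE 1)) (addE (varE ip) (constE 1))))
        (pointE u v im (constE 0))))
    fun j => fopE .fmul
      (fpowE (floadE (varE ic)) (modE (mulE (addE (varE ii) (constE 1))
        (powE (addE (varE 0) (constE 1)) (addE (varE j) (constE 1)))) (addE (varE ip) (constE 1))))
      (pointE u v im (addE (varE j) (constE 1)))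

/-- The value of a coordinate. -/
def coord (fm : ℕ → L) (n δ r D N₁ N₂ p c m i : ℕ) : L :=
  fm c ^ (D ^ (i + 1) % (p + 1)) +
    fm c ^ ((δ + 1) ^ (i + 1) % (p + 1)) * fm (N₁ + m / N₂ ^ 0 % N₂) +
    ∑ j ∈ Finset.range r, fm c ^ ((i + 1) * (n + 1) ^ (j + 1) % (p + 1)) *
      fm (N₁ + m / N₂ ^ (j + 1) % N₂)

theorem getElem?_of_prefix {l' : List ℕ} {i v : ℕ} (h : l[i]? = some v) (hl : l <+: l') :
    l'[i]? = some v := by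
  obtain ⟨m, rfl⟩ := hl
  have hi : i < l.length := by
    by_contra hc
    rw [List.getElem?_eq_none (by omega)] at h
    exact absurd h (by simp)
  rw [List.getElem?_append_left hi, h]

theorem fevals_point (hW : 64 ≤ W) {u v im j N₁ N₂ m x : ℕ} {ej : ℕ → Program}
    (hu : l[u]? = some N₁) (hv : l[v]? = some N₂) (hm : l[im]? = some m)
    (hj : Evals fm W j ej l x) (hN₂ : 1 ≤ N₂) (hmW : m ≤ W ^ 40) (hxW : x ≤ W ^ 40)
    (hpW : N₂ ^ x ≤ W ^ 40) :
    FEvals fm W (j + 300) (pointE u v im ej) l (fm (N₁ + m / N₂ ^ x % N₂)) := by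
  have hu' := evals_var (fm := fm) hW hu
  have hv' := evals_var (fm := fm) hW hv
  have hm' := evals_var (fm := fm) hW hm
  have hpow := hv'.pow hW hj hN₂ hxW hpW
  have hdiv := hm'.div hW hpow (Nat.one_le_pow _ _ hN₂) hmW
  have hmod := hdiv.mod hW hv' hN₂ ((Nat.div_le_self _ _).trans hmW)
  exact (fevals_fload hW (hu'.add hW hmod)).mono hW (by omega)

/-- Powers of `D` and `δ + 1` need modular exponentiation. The exponents `(i + 1) * (n + 1) ^ (j +
1)` can be computed before reduction, since `(n + 1) ^ (r + 1) ≤ D ≤ W ^ 2`. -/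
theorem fevals_coord (hW : 64 ≤ W) {n δ k s r D N₁ N₂ p c m i d u v ip ic im ii : ℕ}
    (hl : [n, δ, k, s, r] <+: l) (hd : l[d]? = some D) (hu : l[u]? = some N₁)
    (hv : l[v]? = some N₂) (hp : l[ip]? = some p) (hc : l[ic]? = some c) (hm : l[im]? = some m)
    (hi : l[ii]? = some i) (hin : i < n) (hN₂ : 1 ≤ N₂) (hnW : n ≤ W) (hδW : δ + 1 ≤ W)
    (hrW : r + 1 ≤ W) (hDW : D ≤ W ^ 2) (hnD : (n + 1) ^ (r + 1) ≤ D) (hpW : p + 1 ≤ W ^ 40)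
    (hmW : m ≤ W ^ 40) (hN₂W : N₂ ^ (r + 1) ≤ W ^ 40) :
    FEvals fm W 2000 (coordE d u v ip ic im ii) l (coord fm n δ r D N₁ N₂ p c m i) := by
  have hW1 : W ≤ W ^ 40 := Nat.le_self_pow (by norm_num) _
  have hW2 : W ^ 2 ≤ W ^ 40 := Nat.pow_le_pow_right (by omega) (by norm_num)
  have hi1 := (evals_var (fm := fm) hW hi).add hW (evals_const hW 1)
  have hp1 := (evals_var (fm := fm) hW hp).add hW (evals_const hW 1)
  have hmod : ∀ x, x % (p + 1) ≤ W ^ 40 := fun x =>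
    (Nat.mod_lt _ (Nat.succ_pos p)).le.trans hpW
  have hbase := fevals_fload (fm := fm) hW (evals_var hW hc)
  have hδ1 := (evals_var (fm := fm) hW (getElem?_of_prefix (v := δ) (i := 1) rfl hl)).add hW
    (evals_const hW 1)
  have hn1 := (evals_var (fm := fm) hW (getElem?_of_prefix (v := n) (i := 0) rfl hl)).add hW
    (evals_const hW 1)
  have hr := evals_var (fm := fm) hW (getElem?_of_prefix (v := r) (i := 4) rfl hl)
  have t0 := hbase.pow hW ((evals_var (fm := fm) hW hd).powMod hW hi1 hp1 (by omega) (hDW.trans hW2)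
    (by omega) hpW) (hmod _)
  have t1 := hbase.pow hW (hδ1.powMod hW hi1 hp1 (by omega) (by omega) (by omega) hpW) (hmod _)
  have a0 := fevals_point (fm := fm) (j := 1) hW hu hv hm (evals_const hW 0) hN₂ hmW (Nat.zero_le _)
    (by rw [pow_zero]; omega)
  have hinit := t0.op hW performs_fadd (t1.op hW performs_fmul a0)
  refine (fevals_fiter hW (j := 1900) (a := 40) performs_fadd
    (fun t => fm c ^ (D ^ (i + 1) % (p + 1)) +
      fm c ^ ((δ + 1) ^ (i + 1) % (p + 1)) * fm (N₁ + m / N₂ ^ 0 % N₂) +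
      ∑ j ∈ Finset.range t, fm c ^ ((i + 1) * (n + 1) ^ (j + 1) % (p + 1)) *
        fm (N₁ + m / N₂ ^ (j + 1) % N₂))
    (fun j => fm c ^ ((i + 1) * (n + 1) ^ (j + 1) % (p + 1)) *
        fm (N₁ + m / N₂ ^ (j + 1) % N₂))
    (hr.mono hW (by norm_num)) ?_ (by omega) (fun l' hl' x j hj => ?_) fun t => ?_).mono hW
    (by norm_num)
  · simp only [Finset.range_zero, Finset.sum_empty, add_zero]
    exact hinit.mono hW (by norm_num)
  · have hll : l <+: l' ++ [x] ++ [j] := by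
      rw [List.append_assoc]
      exact hl'.trans (List.prefix_append _ _)
    have hj1 := (evals_var (fm := fm) hW
      (show (l' ++ [x] ++ [j])[l'.length + 1]? = some j by simp)).add hW (evals_const hW 1)
    have hpow : (n + 1) ^ (j + 1) ≤ D :=
      (Nat.pow_le_pow_right (by omega) (by omega)).trans hnD
    have e1 := (hn1.extend hll).pow hW hj1 (by omega) (by omega) (by omega)
    have hprod : (i + 1) * (n + 1) ^ (j + 1) ≤ W ^ 40 := by
      calc (i + 1) * (n + 1) ^ (j + 1) ≤ W * W ^ 2 := Nat.mul_le_mul (by omega) (hpow.trans hDW)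
        _ = W ^ 3 := by ring
        _ ≤ W ^ 40 := Nat.pow_le_pow_right (by omega) (by norm_num)
    have e2 := ((hi1.extend hll).mul hW e1 (by omega)).mod hW (hp1.extend hll) (by omega) hprod
    have e3 := (hbase.extend hll).pow hW e2 (hmod _)
    have a1 := fevals_point (fm := fm) hW (getElem?_of_prefix hu hll) (getElem?_of_prefix hv hll)
      (getElem?_of_prefix hm hll) hj1 hN₂ hmW (by omega)
      ((Nat.pow_le_pow_right hN₂ (by omega)).trans hN₂W)
    exact (e3.op hW performs_fmul a1).mono hW (by norm_num)
  · simp only [Finset.sum_range_succ, add_assoc]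

end Construction

/-! ### All sizes are bounded by fixed powers of the time unit -/

section Size

variable {δ k s n r : ℕ}

/-- The quantity in whose powers the running time is measured. -/
def timeUnit (δ k s n r : ℕ) : ℕ := (64 * (δ * r * s * n)) ^ (r * k * δ ^ 2)

theorem base_pow_le_timeUnit (hn : 1 ≤ n) (hδ : 1 ≤ δ) (hs : 1 ≤ s) (hr : 1 ≤ r) {e m : ℕ}
    (he : e ≤ r * k * δ ^ 2 * m) : (64 * (δ * r * s * n)) ^ e ≤ timeUnit δ k s n r ^ m := by
  have : 1 ≤ δ * r * s * n := Nat.mul_pos (Nat.mul_pos (Nat.mul_pos hδ hr) hs) hn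
  rw [timeUnit, ← pow_mul]
  exact Nat.pow_le_pow_right (by omega) he

theorem base_le_timeUnit (hn : 1 ≤ n) (hδ : 1 ≤ δ) (hk : 1 ≤ k) (hs : 1 ≤ s) (hr : 1 ≤ r) :
    64 * (δ * r * s * n) ≤ timeUnit δ k s n r := by
  have h : 1 ≤ r * k * δ ^ 2 := Nat.mul_pos (Nat.mul_pos hr hk) (Nat.pow_pos hδ)
  simpa using base_pow_le_timeUnit (e := 1) (m := 1) (k := k) hn hδ hs hr (by omega)

/-- The number `k` occurs only in the exponent of the time unit, and the constant 64 in the base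
makes room for exponentials in `k`. This bound takes care of `2 ^ (2 * (k + 1))`, of `2 ^ (k + 2)`
and of `k` itself. -/
theorem two_pow_six_mul_le_timeUnit (hn : 1 ≤ n) (hδ : 1 ≤ δ) (hs : 1 ≤ s)
    (hr : 1 ≤ r) : 2 ^ (6 * k) ≤ timeUnit δ k s n r := by
  have hy : 1 ≤ δ * r * s * n := Nat.mul_pos (Nat.mul_pos (Nat.mul_pos hδ hr) hs) hn
  have h : k ≤ r * k * δ ^ 2 := by
    calc k = 1 * k * 1 := by ring
      _ ≤ r * k * δ ^ 2 := Nat.mul_le_mul (Nat.mul_le_mul_right _ hr) (Nat.one_le_pow _ _ hδ)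
  calc 2 ^ (6 * k) = 64 ^ k := by rw [pow_mul]; norm_num
    _ ≤ (64 * (δ * r * s * n)) ^ k := Nat.pow_le_pow_left (by omega) k
    _ ≤ timeUnit δ k s n r ^ 1 := base_pow_le_timeUnit hn hδ hs hr (by omega)
    _ = _ := pow_one _

theorem D1_le_timeUnit (hn : 1 ≤ n) (hδ : 1 ≤ δ) (hk : 1 ≤ k) (hs : 1 ≤ s) (hr : 1 ≤ r) :
    D1 δ n r ≤ timeUnit δ k s n r ^ 2 := by
  have h : 1 ≤ r * s := Nat.mul_pos hr hs
  have h2 : 1 ≤ k * δ ^ 2 := Nat.mul_pos hk (Nat.pow_pos hδ)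
  refine le_trans (Nat.pow_le_pow_left ?_ _) (base_pow_le_timeUnit hn hδ hs hr ?_)
  · calc 2 * δ * n = 2 * (δ * n) * 1 := by ring
      _ ≤ 64 * (δ * n) * (r * s) := Nat.mul_le_mul (Nat.mul_le_mul_right _ (by norm_num)) h
      _ = _ := by ring
  · calc 2 * r = r * 1 * 2 := by ring
      _ ≤ r * (k * δ ^ 2) * 2 := by gcongr
      _ = _ := by ring

theorem size2_pow_le_timeUnit (hn : 1 ≤ n) (hδ : 1 ≤ δ) (hk : 1 ≤ k) (hs : 1 ≤ s) (hr : 1 ≤ r) :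
    size2 δ s ^ (r + 1) ≤ timeUnit δ k s n r ^ 2 := by
  have h : 1 ≤ r * n := Nat.mul_pos hr hn
  have h' : 1 ≤ δ * s := Nat.mul_pos hδ hs
  have h2 : 1 ≤ k * δ ^ 2 := Nat.mul_pos hk (Nat.pow_pos hδ)
  refine le_trans (Nat.pow_le_pow_left ?_ _) (base_pow_le_timeUnit hn hδ hs hr ?_)
  · calc size2 δ s ≤ 64 * (δ * s) * 1 := by unfold size2; omega
      _ ≤ 64 * (δ * s) * (r * n) := Nat.mul_le_mul_left _ h
      _ = _ := by ring
  · calc r + 1 ≤ r * 1 * 2 := by omega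
      _ ≤ r * (k * δ ^ 2) * 2 := by gcongr
      _ = _ := by ring

/-- From `2 k ≤ 64 ^ (2 k)` the base is at most `(64 δ r s n) ^ (2 k)`, and `2 k (8 δ² + 4 δ r) ≤ 24
r k δ²`. -/
theorem pow_exponent_le_timeUnit (hn : 1 ≤ n) (hδ : 1 ≤ δ) (hk : 1 ≤ k) (hs : 1 ≤ s)
    (hr : 1 ≤ r) :
    (2 * k * r * s * n * δ ^ 2) ^ (8 * δ ^ 2 + 4 * δ * r) ≤ timeUnit δ k s n r ^ 24 := by
  have hy : 1 ≤ r * s * n := Nat.mul_pos (Nat.mul_pos hr hs) hn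
  have hY : 1 ≤ δ * r * s * n := Nat.mul_pos (Nat.mul_pos (Nat.mul_pos hδ hr) hs) hn
  have hk2 : 2 * k ≤ 64 ^ (2 * k) := by
    calc 2 * k ≤ 2 ^ (2 * k) := Nat.lt_two_pow_self.le
      _ ≤ 64 ^ (2 * k) := Nat.pow_le_pow_left (by norm_num) _
  have hX : 2 * k * r * s * n * δ ^ 2 ≤ (64 * (δ * r * s * n)) ^ (2 * k) := by
    calc 2 * k * r * s * n * δ ^ 2 = 2 * k * ((δ ^ 2 * (r * s * n)) * 1) := by ring
      _ ≤ 64 ^ (2 * k) * ((δ ^ 2 * (r * s * n)) * (r * s * n)) := by gcongr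
      _ = 64 ^ (2 * k) * (δ * r * s * n) ^ 2 := by ring
      _ ≤ 64 ^ (2 * k) * (δ * r * s * n) ^ (2 * k) := by gcongr; omega
      _ = _ := (mul_pow _ _ _).symm
  refine (Nat.pow_le_pow_left hX _).trans ?_
  rw [← pow_mul]
  refine base_pow_le_timeUnit hn hδ hs hr ?_
  have h1 : δ ^ 2 ≤ r * δ ^ 2 := Nat.le_mul_of_pos_left _ hr
  have h2 : δ * r ≤ r * δ ^ 2 := by
    calc δ * r = r * δ := Nat.mul_comm _ _
      _ ≤ r * δ ^ 2 := Nat.mul_le_mul_left _ (Nat.le_self_pow (by norm_num) _)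
  calc 2 * k * (8 * δ ^ 2 + 4 * δ * r) = 2 * k * (8 * δ ^ 2 + 4 * (δ * r)) := by ring
    _ ≤ 2 * k * (8 * (r * δ ^ 2) + 4 * (r * δ ^ 2)) := by gcongr
    _ = _ := by ring

theorem clog_le_self (v : ℕ) : Nat.clog 2 v ≤ v := by
  rw [Nat.clog_le_iff_le_pow (by norm_num)]
  exact Nat.lt_two_pow_self.le

end Size

/-! ### The program for the hitting set -/

section Construction

variable {L : Type*} [Field L] {fm : ℕ → L} {W : ℕ} {l : List ℕ}

/-- `e` computes `v` within `W ^ j` steps, and `v` is at most `W ^ a`. -/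
def EvalsLe (fm : ℕ → L) (W j a : ℕ) (e : ℕ → Program) (l : List ℕ) (v : ℕ) : Prop :=
  Evals fm W j e l v ∧ v ≤ W ^ a

variable {j₁ j₂ a₁ a₂ v₁ v₂ : ℕ} {e₁ e₂ : ℕ → Program}

theorem EvalsLe.mul (h₁ : EvalsLe fm W j₁ a₁ e₁ l v₁) (h₂ : EvalsLe fm W j₂ a₂ e₂ l v₂)
    (hW : 64 ≤ W) (ha : a₁ ≤ 40) :
    EvalsLe fm W (j₁ + j₂ + 43) (a₁ + a₂) (mulE e₁ e₂) l (v₁ * v₂) :=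
  ⟨h₁.1.mul hW h₂.1 (h₁.2.trans (Nat.pow_le_pow_right (by omega) ha)), by
    rw [pow_add]
    exact Nat.mul_le_mul h₁.2 h₂.2⟩

theorem EvalsLe.add (h₁ : EvalsLe fm W j₁ a₁ e₁ l v₁) (h₂ : EvalsLe fm W j₂ a₂ e₂ l v₂)
    (hW : 64 ≤ W) :
    EvalsLe fm W (j₁ + j₂ + 1) (a₁ + a₂ + 1) (addE e₁ e₂) l (v₁ + v₂) :=
  ⟨h₁.1.add hW h₂.1, by
    have h1 := h₁.2.trans (Nat.pow_le_pow_right (by omega : 0 < W) (Nat.le_add_right a₁ a₂))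
    have h2 := h₂.2.trans (Nat.pow_le_pow_right (by omega : 0 < W) (Nat.le_add_left a₂ a₁))
    rw [pow_succ]
    nlinarith [Nat.zero_le (W ^ (a₁ + a₂))]⟩

theorem evalsLe_const (hW : 64 ≤ W) {c : ℕ} (hc : c ≤ 64) : EvalsLe fm W 1 1 (constE c) l c :=
  ⟨evals_const hW c, by rw [pow_one]; omega⟩

theorem evalsLe_var (hW : 64 ≤ W) {i v : ℕ} (h : l[i]? = some v) (hv : v ≤ W) :
    EvalsLe fm W 1 1 (varE i) l v :=
  ⟨evals_var hW h, by rwa [pow_one]⟩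

/-- `D₁`. -/
def d1E : ℕ → Program :=
  powE (mulE (mulE (constE 2) (varE 1)) (varE 0)) (mulE (constE 2) (varE 4))

/-- `p_max`, if register `d` holds `D₁`. -/
def pMaxE (d : ℕ) : ℕ → Program :=
  addE (mulE (mulE (powE (constE 2) (mulE (constE 2) (addE (varE 2) (constE 1))))
    (powE
      (mulE (mulE (mulE (mulE (mulE (constE 2) (varE 2)) (varE 4)) (varE 3)) (varE 0))
        (mulE (varE 1) (varE 1)))
      (addE (mulE (constE 8) (mulE (varE 1) (varE 1)))
        (mulE (mulE (constE 4) (varE 1)) (varE 4)))))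
    (mulE (clogE (varE d)) (clogE (varE d)))) (constE 1)

/-- The size of `H₁`, if register `q` holds `p_max`. -/
def size1E (q : ℕ) : ℕ → Program :=
  mulE (mulE (mulE (mulE (mulE (powE (constE 2) (addE (varE 2) (constE 2)))
    (mulE (varE 2) (varE 2))) (varE 4)) (mulE (varE 3) (varE 3)))
    (mulE (mulE (varE 1) (varE 1)) (mulE (varE 1) (varE 1)))) (varE q)

/-- The size of `H₂`. -/
def size2E : ℕ → Program := addE (mulE (varE 1) (varE 3)) (constE 1)

section Parameters

variable {n δ k s r : ℕ}

theorem evalsLe_d1 (hn : 1 ≤ n) (hδ : 1 ≤ δ) (hW : 64 ≤ W) (hnW : n ≤ W) (hδW : δ ≤ W)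
    (hrW : r ≤ W) (hDW : D1 δ n r ≤ W ^ 2) (hl : [n, δ, k, s, r] <+: l) :
    EvalsLe fm W 1000 2 d1E l (D1 δ n r) := by
  have vn := evalsLe_var (fm := fm) hW (getElem?_of_prefix (i := 0) rfl hl) hnW
  have vδ := evalsLe_var (fm := fm) hW (getElem?_of_prefix (i := 1) rfl hl) hδW
  have vr := evalsLe_var (fm := fm) hW (getElem?_of_prefix (i := 4) rfl hl) hrW
  have two := evalsLe_const (fm := fm) (l := l) (c := 2) hW (by norm_num)
  have b := (two.mul vδ hW (by norm_num)).mul vn hW (by norm_num)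
  have e := two.mul vr hW (by norm_num)
  exact ⟨(b.1.pow hW e.1 (Nat.mul_pos (by omega) hn)
    (e.2.trans (Nat.pow_le_pow_right (by omega) (by norm_num)))
    (hDW.trans (Nat.pow_le_pow_right (by omega) (by norm_num)))).mono hW (by norm_num), hDW⟩

theorem evalsLe_pMax (hn : 1 ≤ n) (hδ : 1 ≤ δ) (hk : 1 ≤ k) (hs : 1 ≤ s) (hr : 1 ≤ r)
    (hW : 64 ≤ W) (hnW : n ≤ W) (hδW : δ ≤ W) (hrW : r ≤ W) (hsW : s ≤ W)
    (hkW : 2 ^ (6 * k) ≤ W) (hDW : D1 δ n r ≤ W ^ 2)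
    (hX : (2 * k * r * s * n * δ ^ 2) ^ (8 * δ ^ 2 + 4 * δ * r) ≤ W ^ 24)
    (hl : [n, δ, k, s, r] <+: l) {d : ℕ} (hd : l[d]? = some (D1 δ n r)) :
    EvalsLe fm W 2000 30 (pMaxE d) l (pMax δ k s n r) := by
  have hkW' : k ≤ W :=
    (Nat.lt_two_pow_self.le.trans (Nat.pow_le_pow_right (by norm_num) (by omega))).trans hkW
  have hpow : 2 ^ (2 * (k + 1)) ≤ W := (Nat.pow_le_pow_right (by norm_num) (by omega)).trans hkW
  have h40 : ∀ {a v : ℕ}, v ≤ W ^ a → a ≤ 40 → v ≤ W ^ 40 := fun h ha =>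
    h.trans (Nat.pow_le_pow_right (by omega) ha)
  have vn := evalsLe_var (fm := fm) hW (getElem?_of_prefix (i := 0) rfl hl) hnW
  have vδ := evalsLe_var (fm := fm) hW (getElem?_of_prefix (i := 1) rfl hl) hδW
  have vk := evalsLe_var (fm := fm) hW (getElem?_of_prefix (i := 2) rfl hl) hkW'
  have vs := evalsLe_var (fm := fm) hW (getElem?_of_prefix (i := 3) rfl hl) hsW
  have vr := evalsLe_var (fm := fm) hW (getElem?_of_prefix (i := 4) rfl hl) hrW
  have one := evalsLe_const (fm := fm) (l := l) (c := 1) hW (by norm_num)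
  have two := evalsLe_const (fm := fm) (l := l) (c := 2) hW (by norm_num)
  have four := evalsLe_const (fm := fm) (l := l) (c := 4) hW (by norm_num)
  have eight := evalsLe_const (fm := fm) (l := l) (c := 8) hW (by norm_num)
  have x1 := two.mul (vk.add one hW) hW (by norm_num)
  have A : EvalsLe fm W _ 1 _ l (2 ^ (2 * (k + 1))) :=
    ⟨two.1.pow hW x1.1 (by norm_num) (h40 x1.2 (by norm_num))
      (h40 (a := 1) (by rwa [pow_one]) (by norm_num)), by rwa [pow_one]⟩
  have x2 := ((((two.mul vk hW (by norm_num)).mul vr hW (by norm_num)).mul vs hW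
    (by norm_num)).mul vn hW (by norm_num)).mul (vδ.mul vδ hW (by norm_num)) hW (by norm_num)
  have x3 := (eight.mul (vδ.mul vδ hW (by norm_num)) hW (by norm_num)).add
    ((four.mul vδ hW (by norm_num)).mul vr hW (by norm_num)) hW
  rw [← pow_two] at x2 x3
  have hpos : 1 ≤ 2 * k * r * s * n * δ ^ 2 := Nat.succ_le_of_lt (by positivity)
  have B : EvalsLe fm W _ 24 _ l _ :=
    ⟨x2.1.pow hW x3.1 hpos (h40 x3.2 (by norm_num)) (h40 hX (by norm_num)), hX⟩
  have C : EvalsLe fm W _ 2 (clogE (varE d)) l (Nat.clog 2 (D1 δ n r)) :=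
    ⟨(evals_var hW hd).clog hW (h40 hDW (by norm_num)), (clog_le_self _).trans hDW⟩
  have M := (A.mul B hW (by norm_num)).mul (C.mul C hW (by norm_num)) hW (by norm_num)
  rw [← pow_two] at M
  refine ⟨(M.1.add hW one.1).mono hW (by norm_num), ?_⟩
  -- The exponents of the factors add up to `1 + 24 + 2 + 2 = 29`; one more factor `W` absorbs the
  -- final `+ 1`.
  have h1 : pMax δ k s n r ≤ W ^ 29 + 1 := Nat.succ_le_succ M.2
  have h2 : 1 ≤ W ^ 29 := Nat.one_le_pow _ _ (by omega)
  rw [pow_succ]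
  nlinarith

/-- The exponents of the factors add up to `1 + 2 + 1 + 2 + 4 + 30 = 40`, whence the uniform value
bound `W ^ 40`. -/
theorem evalsLe_size1 (hW : 64 ≤ W) (hδW : δ ≤ W) (hrW : r ≤ W) (hsW : s ≤ W) (hk : 1 ≤ k)
    (hkW : 2 ^ (6 * k) ≤ W) (hl : [n, δ, k, s, r] <+: l) (hP : pMax δ k s n r ≤ W ^ 30) {q : ℕ}
    (hq : l[q]? = some (pMax δ k s n r)) :
    EvalsLe fm W 2000 40 (size1E q) l (size1 δ k s n r) := by
  have hkW' : k ≤ W :=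
    (Nat.lt_two_pow_self.le.trans (Nat.pow_le_pow_right (by norm_num) (by omega))).trans hkW
  have hpow : 2 ^ (k + 2) ≤ W := (Nat.pow_le_pow_right (by norm_num) (by omega)).trans hkW
  have h40 : ∀ {a v : ℕ}, v ≤ W ^ a → a ≤ 40 → v ≤ W ^ 40 := fun h ha =>
    h.trans (Nat.pow_le_pow_right (by omega) ha)
  have vδ := evalsLe_var (fm := fm) hW (getElem?_of_prefix (i := 1) rfl hl) hδW
  have vk := evalsLe_var (fm := fm) hW (getElem?_of_prefix (i := 2) rfl hl) hkW'
  have vs := evalsLe_var (fm := fm) hW (getElem?_of_prefix (i := 3) rfl hl) hsW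
  have vr := evalsLe_var (fm := fm) hW (getElem?_of_prefix (i := 4) rfl hl) hrW
  have two := evalsLe_const (fm := fm) (l := l) (c := 2) hW (by norm_num)
  have x1 := vk.add two hW
  have A : EvalsLe fm W _ 1 _ l (2 ^ (k + 2)) :=
    ⟨two.1.pow hW x1.1 (by norm_num) (h40 x1.2 (by norm_num))
      (h40 (a := 1) (by rwa [pow_one]) (by norm_num)), by rwa [pow_one]⟩
  have P : EvalsLe fm W 1 30 (varE q) l _ := ⟨evals_var hW hq, hP⟩
  have dd := vδ.mul vδ hW (by norm_num)
  have M := ((((A.mul (vk.mul vk hW (by norm_num)) hW (by norm_num)).mul vr hW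
    (by norm_num)).mul (vs.mul vs hW (by norm_num)) hW (by norm_num)).mul
    (dd.mul dd hW (by norm_num)) hW (by norm_num)).mul P hW (by norm_num)
  have hv : size1 δ k s n r =
      2 ^ (k + 2) * (k * k) * r * (s * s) * (δ * δ * (δ * δ)) * pMax δ k s n r := by
    unfold size1
    ring
  rw [hv]
  exact ⟨M.1.mono hW (by norm_num), M.2⟩

end Parameters

/-- The output of the points. -/
def pointsC (d q u v w : ℕ) : ℕ → Program :=
  forC (varE q) fun ip => forC (varE u) fun ic => forC (varE w) fun im => forC (varE 0) fun ii =>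
    emitC (coordE d u v ip ic im ii)

/-- The construction of the hitting set. -/
def hittingSetC : ℕ → Program :=
  letC d1E fun d => letC (pMaxE d) fun q => letC (size1E q) fun u => letC size2E fun v =>
    letC (powE (varE v) (addE (varE 4) (constE 1))) fun w => pointsC d q u v w

/-- The list of the points with given numbers `N`, `N₁`, `N₂`, `M` of choices. -/
def pointList (fm : ℕ → L) (n δ r D N N₁ N₂ M : ℕ) : List (Fin n → L) :=
  (List.range N).flatMap fun p => (List.range N₁).flatMap fun c =>
    (List.range M).map fun m i => coord fm n δ r D N₁ N₂ p c m i

theorem flatMap_pointList (fm : ℕ → L) (n δ r D N N₁ N₂ M : ℕ) :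
    (pointList fm n δ r D N N₁ N₂ M).flatMap List.ofFn =
      (List.range N).flatMap fun p => (List.range N₁).flatMap fun c =>
        (List.range M).flatMap fun m => (List.range n).flatMap fun i =>
          [coord fm n δ r D N₁ N₂ p c m i] := by
  simp only [pointList, List.flatMap_assoc, List.flatMap_map]
  congr! 6 with p c m
  rw [← List.map_eq_flatMap]
  refine List.ext_getElem (by simp) fun i _ _ => by simp

theorem getElem?_snoc (l : List ℕ) (v : ℕ) : (l ++ [v])[l.length]? = some v := by simp

theorem getElem?_snoc_snoc (l : List ℕ) (d v : ℕ) :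
    (l ++ [d] ++ [v])[l.length + 1]? = some v := by simp

theorem prefix_append_two {l l' : List ℕ} {d i : ℕ} (h : l <+: l') : l <+: l' ++ [d] ++ [i] := by
  rw [List.append_assoc]
  exact h.trans (List.prefix_append _ _)

/-- A coordinate costs `W ^ 2000`. From the inside outwards, the four loops have at most `W`, `W ^
2`, `W ^ 40` and `W ^ 30` rounds. -/
theorem emits_points (hW : 64 ≤ W) {n δ k s r D N N₁ N₂ M d q u v w : ℕ}
    (hl : [n, δ, k, s, r] <+: l) (hd : l[d]? = some D) (hq : l[q]? = some N)
    (hu : l[u]? = some N₁) (hv : l[v]? = some N₂) (hw : l[w]? = some M) (hN₂ : 1 ≤ N₂)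
    (hnW : n ≤ W) (hδW : δ + 1 ≤ W) (hrW : r + 1 ≤ W) (hDW : D ≤ W ^ 2)
    (hnD : (n + 1) ^ (r + 1) ≤ D) (hNW : N ≤ W ^ 30) (hN₁W : N₁ ≤ W ^ 40) (hMW : M ≤ W ^ 2)
    (hN₂W : N₂ ^ (r + 1) ≤ W ^ 40) :
    Emits fm W 2100 (pointsC d q u v w) l
      ((pointList fm n δ r D N N₁ N₂ M).flatMap List.ofFn) := by
  have h0 : ([n, δ, k, s, r] : List ℕ)[0]? = some n := rfl
  rw [flatMap_pointList]
  refine (emits_for hW (j := 2060) ((evals_var hW hq).mono hW (by norm_num)) hNW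
    fun l₁ hl₁ x₁ p hp => ?_).mono hW (by norm_num)
  have g₁ : l <+: l₁ ++ [x₁] ++ [p] := prefix_append_two hl₁
  refine (emits_for hW (j := 2015) ((evals_var hW (getElem?_of_prefix hu g₁)).mono hW
    (by norm_num)) hN₁W fun l₂ hl₂ x₂ c hc => ?_).mono hW (by norm_num)
  have g₂ := prefix_append_two (d := x₂) (i := c) hl₂
  refine (emits_for hW (j := 2010) ((evals_var hW (getElem?_of_prefix hw (g₁.trans g₂))).mono hW
    (by norm_num)) hMW fun l₃ hl₃ x₃ m hm => ?_).mono hW (by norm_num)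
  have g₃ := prefix_append_two (d := x₃) (i := m) hl₃
  refine (emits_for hW (j := 2005) (a := 1) ((evals_var hW (getElem?_of_prefix h0
    (hl.trans (g₁.trans (g₂.trans g₃))))).mono hW (by norm_num)) (by rwa [pow_one])
    fun l₄ hl₄ x₄ i hi => ?_).mono hW (by norm_num)
  have g₄ := prefix_append_two (d := x₄) (i := i) hl₄
  have g := g₁.trans (g₂.trans (g₃.trans g₄))
  refine (emits_emit hW (fevals_coord hW (hl.trans g) (getElem?_of_prefix hd g)
    (getElem?_of_prefix hu g) (getElem?_of_prefix hv g)
    (getElem?_of_prefix (getElem?_snoc_snoc l₁ x₁ p) (g₂.trans (g₃.trans g₄)))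
    (getElem?_of_prefix (getElem?_snoc_snoc l₂ x₂ c) (g₃.trans g₄))
    (getElem?_of_prefix (getElem?_snoc_snoc l₃ x₃ m) g₄) (getElem?_snoc_snoc l₄ x₄ i) hi hN₂ hnW
    hδW hrW hDW hnD ?_ ?_ hN₂W)).mono hW (by norm_num)
  · exact (Nat.succ_le_of_lt hp).trans (hNW.trans (Nat.pow_le_pow_right (by omega) (by norm_num)))
  · exact hm.le.trans (hMW.trans (Nat.pow_le_pow_right (by omega) (by norm_num)))

theorem emits_hittingSet {n δ k s r : ℕ} (hn : 1 ≤ n) (hδ : 1 ≤ δ) (hk : 1 ≤ k) (hs : 1 ≤ s)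
    (hr : 1 ≤ r) :
    Emits fm (timeUnit δ k s n r) 2200 hittingSetC [n, δ, k, s, r]
      ((pointList fm n δ r (D1 δ n r) (pMax δ k s n r) (size1 δ k s n r) (size2 δ s)
        (size2 δ s ^ (r + 1))).flatMap List.ofFn) := by
  have hB := base_le_timeUnit hn hδ hk hs hr
  have hkW := two_pow_six_mul_le_timeUnit (k := k) hn hδ hs hr
  have hDW := D1_le_timeUnit hn hδ hk hs hr
  have hMW := size2_pow_le_timeUnit hn hδ hk hs hr
  have hX := pow_exponent_le_timeUnit hn hδ hk hs hr
  have hy : 1 ≤ δ * r * s * n := Nat.mul_pos (Nat.mul_pos (Nat.mul_pos hδ hr) hs) hn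
  have hny : n ≤ δ * r * s * n := Nat.le_of_dvd hy ⟨δ * r * s, by ring⟩
  have hδy : δ ≤ δ * r * s * n := Nat.le_of_dvd hy ⟨r * s * n, by ring⟩
  have hry : r ≤ δ * r * s * n := Nat.le_of_dvd hy ⟨δ * s * n, by ring⟩
  have hsy : s ≤ δ * r * s * n := Nat.le_of_dvd hy ⟨δ * r * n, by ring⟩
  have hδsy : δ * s ≤ δ * r * s * n := Nat.le_of_dvd hy ⟨r * n, by ring⟩
  set W := timeUnit δ k s n r with hWdef
  have hW : 64 ≤ W := by omega
  have h40 : ∀ {v : ℕ}, v ≤ W ^ 2 → v ≤ W ^ 40 := fun h =>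
    h.trans (Nat.pow_le_pow_right (by omega) (by norm_num))
  have hW40 : ∀ {v : ℕ}, v ≤ W → v ≤ W ^ 40 := fun h => h.trans (Nat.le_self_pow (by norm_num) W)
  have hN₂ : size2 δ s ≤ W := by
    unfold size2
    omega
  have hnD : (n + 1) ^ (r + 1) ≤ D1 δ n r := succ_pow_le_D1 hn hδ hr
  refine (emits_let hW (j := 2150) ((evalsLe_d1 hn hδ hW (by omega) (by omega) (by omega) hDW
    List.prefix_rfl).1.mono hW (by norm_num)) fun l₁ g₁ => ?_).mono hW (by norm_num)
  have g₁' := g₁.trans (List.prefix_append l₁ [D1 δ n r])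
  have k₁ := getElem?_snoc l₁ (D1 δ n r)
  have hP := evalsLe_pMax (fm := fm) hn hδ hk hs hr hW (by omega) (by omega) (by omega) (by omega)
    hkW hDW hX g₁' k₁
  refine (emits_let hW (j := 2140) (hP.1.mono hW (by norm_num)) fun l₂ g₂ => ?_).mono hW
    (by norm_num)
  have g₂' := g₂.trans (List.prefix_append l₂ [pMax δ k s n r])
  have k₂ := getElem?_snoc l₂ (pMax δ k s n r)
  have hS := evalsLe_size1 (fm := fm) hW (by omega) (by omega) (by omega) hk hkW
    (g₁'.trans g₂') hP.2 k₂
  refine (emits_let hW (j := 2130) (hS.1.mono hW (by norm_num)) fun l₃ g₃ => ?_).mono hW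
    (by norm_num)
  have g₃' := g₃.trans (List.prefix_append l₃ [size1 δ k s n r])
  have k₃ := getElem?_snoc l₃ (size1 δ k s n r)
  have e₃ := g₁'.trans (g₂'.trans g₃')
  have vδ := evals_var (fm := fm) hW (getElem?_of_prefix (v := δ) (i := 1) rfl e₃)
  have vs := evals_var (fm := fm) hW (getElem?_of_prefix (v := s) (i := 3) rfl e₃)
  refine (emits_let hW (j := 2120) (((vδ.mul hW vs (hW40 (by omega))).add hW
    (evals_const hW 1)).mono hW (by norm_num)) fun l₄ g₄ => ?_).mono hW (by norm_num)
  have g₄' := g₄.trans (List.prefix_append l₄ [δ * s + 1])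
  have k₄ : (l₄ ++ [δ * s + 1])[l₄.length]? = some (size2 δ s) := getElem?_snoc l₄ _
  have vv := evals_var (fm := fm) hW k₄
  have vr := evals_var (fm := fm) hW (getElem?_of_prefix (v := r) (i := 4) rfl (e₃.trans g₄'))
  refine (emits_let hW (j := 2110) ((vv.pow hW (vr.add hW (evals_const hW 1)) (Nat.succ_pos _)
    (hW40 (by omega)) (h40 hMW)).mono hW (by norm_num)) fun l₅ g₅ => ?_).mono hW (by norm_num)
  have g₅' := g₅.trans (List.prefix_append l₅ [size2 δ s ^ (r + 1)])
  exact (emits_points hW (e₃.trans (g₄'.trans g₅'))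
    (getElem?_of_prefix k₁ (g₂'.trans (g₃'.trans (g₄'.trans g₅'))))
    (getElem?_of_prefix k₂ (g₃'.trans (g₄'.trans g₅'))) (getElem?_of_prefix k₃ (g₄'.trans g₅'))
    (getElem?_of_prefix k₄ g₅') (getElem?_snoc _ _) (Nat.succ_pos _) (by omega) (by omega)
    (by omega) hDW hnD hP.2 hS.2 hMW (h40 hMW)).mono hW (by norm_num)

theorem coord_eq_eval (fm : ℕ → L) {n r : ℕ} (δ D N₁ N₂ p c m : ℕ) (i : Fin n)
    {a : Fin (r + 1) → L} (ha : ∀ j, a j = fm (N₁ + m / N₂ ^ j.val % N₂)) :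
    coord fm n δ r D N₁ N₂ p c m i = MvPolynomial.eval a (psi n r D (D2 δ) (p + 1) (fm c) i) := by
  simp [coord, psi, D2, ha, Finset.sum_range]

/-- The outer loop variable starts at 0 and stands for the modulus `p + 1`. A number `m` below `|H₂|
^ (r + 1)` encodes a point of `H₂ ^ (r + 1)` by its base-`|H₂|` digits. -/
theorem mem_pointList {n δ k s r : ℕ} (h₁ : Fin (size1 δ k s n r) → L)
    (h₂ : Fin (size2 δ s) → L)
    (hfm₁ : ∀ i : Fin (size1 δ k s n r), fm i = h₁ i)
    (hfm₂ : ∀ i : Fin (size2 δ s), fm (size1 δ k s n r + i) = h₂ i) (v : Fin n → L) :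
    v ∈ pointList fm n δ r (D1 δ n r) (pMax δ k s n r) (size1 δ k s n r) (size2 δ s)
        (size2 δ s ^ (r + 1)) ↔
      v ∈ hittingSet δ k s n r (Set.range h₁) (Set.range h₂) := by
  simp only [pointList, List.mem_flatMap, List.mem_map, List.mem_range, hittingSet,
    Set.mem_ofPred_eq]
  constructor
  · rintro ⟨p, hp, c, hc, m, hm, rfl⟩
    refine ⟨p + 1, Nat.succ_pos p, hp, h₁ ⟨c, hc⟩, ⟨_, rfl⟩,
      fun j => h₂ ⟨m / size2 δ s ^ j.val % size2 δ s, Nat.mod_lt _ (Nat.succ_pos _)⟩,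
      fun j => ⟨_, rfl⟩, funext fun i => ?_⟩
    rw [coord_eq_eval fm δ _ _ _ p c m i fun j => (hfm₂ ⟨_, Nat.mod_lt _ (Nat.succ_pos _)⟩).symm,
      ← hfm₁]
  · rintro ⟨p, hp, hp', _, ⟨c, rfl⟩, a, ha, rfl⟩
    choose d hd using ha
    refine ⟨p - 1, by omega, c, c.2, (finFunctionFinEquiv d).val, (finFunctionFinEquiv d).2,
      funext fun i => ?_⟩
    rw [coord_eq_eval fm δ _ _ _ (p - 1) c _ i (a := a) fun j => ?_, Nat.sub_add_cancel hp, hfm₁]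
    rw [← hd, ← hfm₂]
    have := congrArg Fin.val (congrFun (finFunctionFinEquiv.symm_apply_apply d) j)
    rw [← this]
    rfl

theorem constructs_hittingSet {n δ k s r : ℕ} (hn : 1 ≤ n) (hδ : 1 ≤ δ) (hk : 1 ≤ k) (hs : 1 ≤ s)
    (hr : 1 ≤ r) (h₁ : Fin (size1 δ k s n r) → L) (h₂ : Fin (size2 δ s) → L) :
    Constructs (hittingSetC 5) (startState n δ k s r h₁ h₂) (timeUnit δ k s n r ^ 2200)
      (hittingSet δ k s n r (Set.range h₁) (Set.range h₂)) := by
  -- The input occupies the registers 0 to 4, so the stack starts at height 5.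
  obtain ⟨t, ht, τ, hrun, -, hout⟩ := emits_hittingSet hn hδ hk hs hr
    [n, δ, k, s, r] List.prefix_rfl (startState n δ k s r h₁ h₂) ⟨rfl, fun i v hv => by
      simp [startState, List.getD, hv]⟩
  refine ⟨t, τ, _, hrun, ht, hout, mem_pointList h₁ h₂ (fun i => ?_) fun i => ?_⟩
  · simp [startState, List.getD, List.getElem?_append_left]
  · simp [startState, List.getD]

end Construction

end DepthFour

theorem theorem3 :
    ∃ (P : DepthFour.Program) (q : Polynomial ℕ),
      ∀ (K F L : Type*) [Field K] [Field F] [Field L] [Algebra K F] [Algebra F L] [Algebra K L]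
        [IsScalarTower K F L] [IsAlgClosure K L] [Infinite F]
        (n δ k s r : ℕ), 1 ≤ n → 1 ≤ δ → 1 ≤ k → 1 ≤ s →
        r = DepthFour.rankBound F δ k s →
        (ringChar K = 0 ∨ δ ^ r < ringChar K) →
        ∀ (h₁ : Fin (DepthFour.size1 δ k s n r) ↪ L) (h₂ : Fin (DepthFour.size2 δ s) ↪ L),
          DepthFour.IsHittingSet K δ k s n
            (DepthFour.hittingSet δ k s n r (Set.range h₁) (Set.range h₂)) ∧
          DepthFour.Constructs P (DepthFour.startState n δ k s r h₁ h₂)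
            ((q.eval (δ * r * s * n)) ^ (r * k * δ ^ 2))
            (DepthFour.hittingSet δ k s n r (Set.range h₁) (Set.range h₂)) := by
  -- This polynomial is chosen so that `q(δ r s n) ^ (r k δ²)` is exactly `timeUnit ^ 2200`.
  refine ⟨DepthFour.hittingSetC 5, (Polynomial.C 64 * Polynomial.X) ^ 2200, ?_⟩
  intro K F L _ _ _ _ _ _ _ _ _ n δ k s r hn hδ hk hs hr hchar h₁ h₂
  refine ⟨DepthFour.isHittingSet_hittingSet hn hδ hk hs hr hchar h₁ h₂, ?_⟩
  have hT : (((Polynomial.C 64 * Polynomial.X) ^ 2200 : Polynomial ℕ).eval (δ * r * s * n)) ^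
      (r * k * δ ^ 2) = DepthFour.timeUnit δ k s n r ^ 2200 := by
    rw [Polynomial.eval_pow, Polynomial.eval_mul, Polynomial.eval_C, Polynomial.eval_X,
      DepthFour.timeUnit, pow_right_comm]
  rw [hT]
  exact DepthFour.constructs_hittingSet hn hδ hk hs
    (hr ▸ (DepthFour.rankBound_spec F δ k s).1) h₁ h₂
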